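/- **Conventions.** All vector spaces are over $\mathbb C$; superspaces are $\mathbb Z/2$-graded, $|\cdot|$ is the parity, and $[S,T]=ST-(-1)^{|S||T|}TS$ for homogeneous endomorphisms. Fix integers $m,n\ge 1$, put $\dot A=\mathbb C[t_1^{\pm1},\dots,t_m^{\pm1}]\otimes\Lambda_n$, where $\Lambda_n$ is the Grassmann algebra in $\zeta_1,\dots,\zeta_n$, and let $\dot{\mathfrak k}=\mathrm{Der}(\dot A)$ be the Lie superalgebra of superderivations. Put $d_i=t_i\frac{d}{dt_i}$, $\partial_k=\frac{\partial}{\partial\zeta_k}$, $t^{r}=\prod_i t_i^{r_i}$, and $\zeta_I=\zeta_{j_1}\cdots\zeta_{j_p}$ for $I=\{j_1<\dots<j_p\}$. The superspace $\mathfrak g=\dot A\oplus\dot{\mathfrak k}$ has the supercommutative product $(a\oplus\delta)\cdot(b\oplus\sigma)=ab\oplus(a\sigma+(-1)^{|b||\delta|}b\delta)$, the Lie superbracket $\{a\oplus\delta,b\oplus\sigma\}=(\delta(b)-(-1)^{|a||\sigma|}\sigma(a))\oplus[\delta,\sigma]$, and the projection $\pi:\mathfrak g\to\dot A$. For $x\in\mathfrak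 g$ and $a\in\dot A$ write $x(a)=\{x,a\}\in\dot A$. **QP-modules.** A quasi-Poisson (QP-) module over $(\dot A,\dot{\mathfrak k})$ is a superspace $M$ with parity preserving linear maps $\varphi:\dot A\to\mathrm{End}(M)$ and $\psi,\hat\varphi:\mathfrak g\to\mathrm{End}(M)$ such that $\varphi$ is a homomorphism of unital associative superalgebras, $\psi$ is a homomorphism of Lie superalgebras for $\{\cdot,\cdot\}$, and, for homogeneous $x,y\in\mathfrak g$ and $a\in\dot A$, $$[\hat\varphi_x,\hat\varphi_y]=\hat\varphi_{x\cdot\pi(y)}-\hat\varphi_{\pi(x)\cdot y},\quad \hat\varphi_{a\cdot x}=\varphi_a\hat\varphi_x,\quad [\hat\varphi_x,\varphi_a]=0,\quad [\psi_x,\varphi_a]=\varphi_{x(a)},$$ $$[\hat\varphi_x,\psi_y]=\hat\varphi_{\{x,y\}}-(-1)^{|x||y|}\varphi_{\pi(y)}\psi_x+\psi_{x\cdot\pi(y)}.$$ It is *simple* if it is nonzero and has no sub-superspaces invariant under all $\varphi_a,\psi_x,\hat\varphi_x$ other than $0$ and $M$. Put $\mathfrak t=\mathrm{span}\{1,d_i,\zeta_k\partial_k\}\subset\mathfrak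 g$ and $\mathfrak t'=\mathrm{span}\{1,d_i\}$ $(1\le i\le m$, $1\le k\le n)$. The module is *cuspidal* if $M=\bigoplus_{\lambda\in\mathfrak t^*}M^\lambda$ with $M^\lambda=\{v: \psi_hv=\lambda(h)v\ \forall h\in\mathfrak t\}$, where the $M^\lambda$ are finite dimensional with bounded dimensions. **The algebra $\mathcal T$.** Let $A=\mathbb C[t_0^{\pm1}]\otimes\dot A$ and $\mathfrak k=\mathrm{Der}(A)$, with $d_0=t_0\frac{d}{dt_0}$. For $r=(r_0,\dots,r_m)\in\mathbb Z^{m+1}$ put $r'=(r_1,\dots,r_m)$. Identify $A=L(\dot A)$ and $\mathfrak k=L(\mathfrak g)$, where $L(V)=\mathbb C[t_0^{\pm1}]\otimes V$, via $t_0^{s}a\mapsto t_0^s\otimes a$, $t_0^sa\,d_0\mapsto t_0^s\otimes a$ and $t_0^s\delta\mapsto t_0^s\otimes\delta$ $(a\in\dot A$, $\delta\in\dot{\mathfrak k})$. For a QP-module $M$, the subspace $A\#\mathfrak k=A\otimes\mathfrak k$ of the smash product $A\# U(\mathfrak k)$ acts on $L(M)$ by $(a\#x)*w=a\cdot(x*w)$,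 where $$(t_0^r\otimes x)*(t_0^s\otimes v)=t_0^{r+s}\otimes(\psi_xv-r\hat\varphi_xv+s\varphi_{\pi(x)}v),\qquad (t_0^r\otimes a)\cdot(t_0^s\otimes v)=t_0^{r+s}\otimes\varphi_av .$$ Let $\tau(I,J)=\sum_{j\in J}|\{i\in I: j<i\}|$. For $r\in\mathbb Z^{m+1}$ and $\partial\in\{d_0,\dots,d_m,\partial_1,\dots,\partial_n\}$ put $X_{r,\emptyset,\partial}=t^{-r}\#t^r\partial-1\#\partial$ and, for $\emptyset\neq J\subseteq\{1,\dots,n\}$, $X_{r,J,\partial}=\sum_{I\subseteq J}(-1)^{|I|+\tau(I,J\setminus I)}\,t^{-r}\zeta_I\#t^r\zeta_{J\setminus I}\partial$. Let $\mathcal T\subset A\#\mathfrak k$ be the span of all $X_{r,J,\partial}$ with $J\ne\emptyset$ and all $X_{s,\emptyset,\partial}$ with $s\neq0$. A subspace $U\subseteq M$, identified with $t_0^0\otimes U\subseteq L(M)$, is a *$\mathcal T$-submodule* if $\mathcal T* U\subseteq U$. **Shen–Larsson QP-modules.** Write $\partial_{0}=1\in\dot A\subset\mathfrak g$ (it acts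 by zero on $\dot A$), $\partial_i=d_i$ $(1\le i\le m)$ and $\partial_{\bar k}=\partial/\partial\zeta_k$ $(1\le k\le n)$, and let $E_{\alpha,\beta}$, $\alpha,\beta\in\{0,\dots,m,\bar1,\dots,\bar n\}$, be the matrix units of $\mathfrak{gl}(m+1,n)$, where $0,\dots,m$ are even and $\bar1,\dots,\bar n$ odd indices. For a $\mathfrak{gl}(m+1,n)$-module $\Omega$ and $\bar\varrho=(\varrho(\alpha))_\alpha\in\mathbb C^{m+1+n}$ with $\varrho(\bar k)=0$ for all $k$, $M_{\dot A}(\Omega,\bar\varrho)$ is the superspace $\dot A\otimes\Omega$ with, for homogeneous $a,b\in\dot A$, $$\varphi_a(b\otimes\omega)=ab\otimes\omega,\qquad \hat\varphi_{a\partial_\alpha}(b\otimes\omega)=-(-1)^{|b||\partial_\alpha|}ab\otimes E_{0,\alpha}\omega,$$ $$\psi_{a\partial_\alpha}(b\otimes\omega)=a(\partial_\alpha(b)+\varrho(\alpha)b)\otimes\omega+\sum_{\beta\ne0}(-1)^{|ab||\partial_\beta|+|\partial_\beta|+|b||\partial_\alpha|}\partial_\beta(a)b\otimes E_{\beta,\alpha}\omega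 .$$ A $\mathfrak{gl}(m+1,n)$-module is *admissible* if it is the direct sum of its weight spaces for the diagonal matrices, and these are finite dimensional of bounded dimension. **Theorem.** Let $(M,\varphi,\hat\varphi,\psi)$ be a simple cuspidal QP-module over $(\dot A,\dot{\mathfrak k})$. For $\mu\in(\mathfrak t')^*$ put $M_{(\mu)}=\bigoplus_{\lambda|_{\mathfrak t'}=\mu}M^\lambda$. Fix $\mu_0\in(\mathfrak t')^*$ with $N:=M_{(\mu_0)}\neq0$, and put $\Omega=\{u\in N:\psi_{\partial_k}u=0\ \text{for}\ 1\le k\le n\}$. Then: (i) $\Omega$ is invariant under $\varphi_{t_j^{-1}}\psi_{t_j\partial}-\psi_\partial$, $\varphi_{\zeta_p}\psi_\partial-\psi_{\zeta_p\partial}$ and $\hat\varphi_\partial$ for $1\le j\le m$, $1\le p\le n$ and $\partial\in\{1,d_i,\partial_k\mid 1\le i\le m,\,1\le k\le n\}$. (ii) $\Omega$ is a $\mathcal T$-submodule. It is invariant under the operators $\psi_{\zeta_k\partial_k}$ $(1\le k\le n)$ and is the direct sum of its joint eigenspaces for them, which are finite dimensional of bounded dimension. (iii) If $U\neq0$ is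 a $\mathcal T$-submodule contained in $\Omega$, then $\mathrm{span}\{\varphi_{\zeta_I}u\mid I\subseteq\{1,\dots,n\},u\in U\}=N$ and $\mathrm{span}\{\varphi_au\mid a\in\dot A,u\in U\}=M$. (iv) $\Omega$ is a simple $\mathcal T$-module: $\Omega\ne0$, and its only $\mathcal T$-submodules are $0$ and $\Omega$. Moreover, $\Omega$ is a sub-superspace of $M$ and a simple admissible $\mathfrak{gl}(m+1,n)$-module via $$\Phi(E_{0,\beta})=-\hat\varphi_{\partial_\beta},\qquad \Phi(E_{i,\beta})=\varphi_{t_i^{-1}}\psi_{t_i\partial_\beta}-\psi_{\partial_\beta},\qquad \Phi(E_{\bar k,\beta})=\psi_{\zeta_k\partial_\beta}-\varphi_{\zeta_k}\psi_{\partial_\beta}$$ for $1\le i\le m$, $1\le k\le n$ and $\beta\in\{0,\dots,m,\bar1,\dots,\bar n\}$. (v) $M$ is isomorphic, by a parity preserving isomorphism of QP-modules, to the Shen–Larsson QP-module $M_{\dot A}(\Omega,\bar\varrho)$, where $\Omega$ carries the representation $\Phi$ and $\bar\varrho=(\mu_0(1),\mu_0(d_1),\dots,\mu_0(d_m),0,\dots,0)$.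 -/

import Mathlib

open scoped TensorProduct

noncomputable section

namespace QP

/-! ### Superspaces and supercommutative superalgebras over `ℂ`

A superspace is a complex vector space `V` together with a family `𝓥 : ZMod 2 → Submodule ℂ V`
such that `V` is the internal direct sum of `𝓥 0` (even part) and `𝓥 1` (odd part). -/

/-- The sign `(-1)^(p q)` for parities `p` and `q`. -/
def sgn (p q : ZMod 2) : ℂ := (-1) ^ (p.val * q.val)

theorem zmod_two_cases (p : ZMod 2) : p = 0 ∨ p = 1 := by
  fin_cases p
  · exact Or.inl rfl
  · exact Or.inr rfl

@[simp] theorem sgn_zero_left (q : ZMod 2) : sgn 0 q = 1 := by simp [sgn]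

@[simp] theorem sgn_zero_right (p : ZMod 2) : sgn p 0 = 1 := by simp [sgn]

@[simp] theorem sgn_one_one : sgn 1 1 = -1 := by simp [sgn, ZMod.val_one]

theorem one_add_one_parity : (1 : ZMod 2) + 1 = 0 := rfl

theorem sgn_add_right (p q r : ZMod 2) : sgn p (q + r) = sgn p q * sgn p r := by
  rcases zmod_two_cases p with rfl | rfl <;> rcases zmod_two_cases q with rfl | rfl <;>
    rcases zmod_two_cases r with rfl | rfl <;> simp [one_add_one_parity]

theorem sgn_add_left (p q r : ZMod 2) : sgn (p + q) r = sgn p r * sgn q r := by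
  rcases zmod_two_cases p with rfl | rfl <;> rcases zmod_two_cases q with rfl | rfl <;>
    rcases zmod_two_cases r with rfl | rfl <;> simp [one_add_one_parity]

theorem sgn_comm (p q : ZMod 2) : sgn p q = sgn q p := by
  simp [sgn, mul_comm]

theorem sgn_mul_self (p q : ZMod 2) : sgn p q * sgn p q = 1 := by
  rcases zmod_two_cases p with rfl | rfl <;> rcases zmod_two_cases q with rfl | rfl <;> simp

/-- The supercommutator `[S, T] = S T - (-1)^(p q) T S` of endomorphisms of parities `p`, `q`. -/
def scomm {V : Type*} [AddCommGroup V] [Module ℂ V] (p q : ZMod 2) (S T : Module.End ℂ V) :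
    Module.End ℂ V :=
  S * T - sgn p q • (T * S)

/-- A subspace of a superspace is a sub-superspace if it is spanned by homogeneous elements. -/
def IsSubsuperspace {V : Type*} [AddCommGroup V] [Module ℂ V] (𝓥 : ZMod 2 → Submodule ℂ V)
    (W : Submodule ℂ V) : Prop :=
  W ≤ (W ⊓ 𝓥 0) ⊔ (W ⊓ 𝓥 1)

section General

variable {A : Type*} [Ring A] [Algebra ℂ A]

/-- `A` with the even and odd parts `𝒜 0`, `𝒜 1` is a unital associative supercommutative
superalgebra. -/
class IsSupercommutative (𝒜 : ZMod 2 → Submodule ℂ A) : Prop where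
  isInternal : DirectSum.IsInternal 𝒜
  one_mem : (1 : A) ∈ 𝒜 0
  mul_mem : ∀ {p q : ZMod 2} {a b : A}, a ∈ 𝒜 p → b ∈ 𝒜 q → a * b ∈ 𝒜 (p + q)
  mul_comm : ∀ {p q : ZMod 2} {a b : A}, a ∈ 𝒜 p → b ∈ 𝒜 q → a * b = sgn p q • (b * a)

variable (𝒜 : ZMod 2 → Submodule ℂ A)

/-- The superderivations of `A` of parity `p`. -/
def superDer (p : ZMod 2) : Submodule ℂ (Module.End ℂ A) where
  carrier := {D | (∀ q, ∀ a ∈ 𝒜 q, D a ∈ 𝒜 (p + q)) ∧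
    ∀ q, ∀ a ∈ 𝒜 q, ∀ b, D (a * b) = D a * b + sgn p q • (a * D b)}
  add_mem' := by
    rintro D E ⟨hD, hD'⟩ ⟨hE, hE'⟩
    refine ⟨fun q a ha => add_mem (hD q a ha) (hE q a ha), fun q a ha b => ?_⟩
    simp only [LinearMap.add_apply, hD' q a ha, hE' q a ha, add_mul, mul_add, smul_add]
    abel
  zero_mem' := ⟨fun q a _ => zero_mem _, fun q a _ b => by simp⟩
  smul_mem' := by
    rintro c D ⟨hD, hD'⟩
    refine ⟨fun q a ha => Submodule.smul_mem _ c (hD q a ha), fun q a ha b => ?_⟩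
    simp only [LinearMap.smul_apply, hD' q a ha, smul_add, smul_mul_assoc, mul_smul_comm]
    rw [smul_comm c]

/-- The homogeneous component of parity `p` of the superspace `𝔤 = A ⊕ Der(A)`, whose elements
`a ⊕ δ` are written as pairs `(a, δ)`. -/
def qpHom (p : ZMod 2) : Submodule ℂ (A × Module.End ℂ A) :=
  (𝒜 p).prod (superDer 𝒜 p)

/-- The superspace `𝔤 = A ⊕ Der(A)` underlying the quasi-Poisson superalgebra associated to the
Lie-Rinehart pair `(A, Der(A))`; here `Der(A)` consists of all sums of an even and an odd
superderivation. -/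
def qpAlg : Submodule ℂ (A × Module.End ℂ A) := qpHom 𝒜 0 ⊔ qpHom 𝒜 1

theorem qpHom_le (p : ZMod 2) : qpHom 𝒜 p ≤ qpAlg 𝒜 := by
  rcases zmod_two_cases p with rfl | rfl
  · exact le_sup_left
  · exact le_sup_right

/-- The projection `π : 𝔤 → A`. -/
def proj (x : qpAlg 𝒜) : A := x.1.1

/-- The action of `x ∈ 𝔤` on `A`: `x(a) = {x, a}`. -/
def qact (x : qpAlg 𝒜) (a : A) : A := x.1.2 a

variable {𝒜}

theorem bracket_mem {p q : ZMod 2} {x y : A × Module.End ℂ A} (hx : x ∈ qpHom 𝒜 p)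
    (hy : y ∈ qpHom 𝒜 q) :
    (x.2 y.1 - sgn p q • y.2 x.1, scomm p q x.2 y.2) ∈ qpHom 𝒜 (p + q) := by
  obtain ⟨a, D⟩ := x
  obtain ⟨b, E⟩ := y
  obtain ⟨ha, hD, hD'⟩ := hx
  obtain ⟨hb, hE, hE'⟩ := hy
  simp only at ha hD hD' hb hE hE'
  refine ⟨sub_mem (hD q b hb) (Submodule.smul_mem _ _ ?_), ?_, ?_⟩
  · simpa [add_comm] using hE p a ha
  · intro r c hc
    refine sub_mem ?_ (Submodule.smul_mem _ _ ?_)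
    · have := hD _ _ (hE r c hc)
      rwa [← add_assoc] at this
    · have := hE _ _ (hD r c hc)
      rwa [← add_assoc, add_comm q p] at this
  · intro r c hc d
    simp only [scomm, LinearMap.sub_apply, Module.End.mul_apply, LinearMap.smul_apply,
      hE' r c hc, hD' r c hc, map_add, map_smul, hD' _ _ (hE r c hc), hE' _ _ (hD r c hc),
      sgn_add_right, sgn_add_left]
    have h1 : sgn q p = sgn p q := sgn_comm q p
    rw [h1]
    have h2 := sgn_mul_self p q
    simp only [sub_mul, mul_sub, smul_add, smul_sub, smul_mul_assoc, mul_smul_comm, smul_smul]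
    have e1 : sgn p q * (sgn p q * sgn q r) = sgn q r := by rw [← mul_assoc, h2, one_mul]
    rw [e1, mul_comm (sgn q r) (sgn p r)]
    rw [show sgn p q * (sgn p r * sgn q r) = sgn p r * sgn q r * sgn p q by ring]
    abel

variable [h𝒜 : IsSupercommutative 𝒜]

theorem sup_eq_top : 𝒜 0 ⊔ 𝒜 1 = ⊤ := by
  have h := h𝒜.isInternal.submodule_iSup_eq_top
  rw [eq_top_iff, ← h]
  refine iSup_le fun p => ?_
  rcases zmod_two_cases p with rfl | rfl
  · exact le_sup_left
  · exact le_sup_right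

theorem smul_mem_qpHom {p q : ZMod 2} {a : A} {x : A × Module.End ℂ A} (ha : a ∈ 𝒜 p)
    (hx : x ∈ qpHom 𝒜 q) : (a * x.1, LinearMap.mulLeft ℂ a * x.2) ∈ qpHom 𝒜 (p + q) := by
  obtain ⟨b, D⟩ := x
  obtain ⟨hb, hD, hD'⟩ := hx
  refine ⟨h𝒜.mul_mem ha hb, ?_, ?_⟩
  · intro r c hc
    have := h𝒜.mul_mem ha (hD r c hc)
    rwa [← add_assoc] at this
  · intro r c hc d
    simp only at hD'
    simp only [Module.End.mul_apply, LinearMap.mulLeft_apply, hD' r c hc, mul_add,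
      mul_smul_comm, sgn_add_left, ← mul_assoc]
    rw [h𝒜.mul_comm ha hc, smul_mul_assoc, smul_smul, mul_comm]

theorem smul_mem_qpAlg (a : A) {x : A × Module.End ℂ A} (hx : x ∈ qpAlg 𝒜) :
    (a * x.1, LinearMap.mulLeft ℂ a * x.2) ∈ qpAlg 𝒜 := by
  obtain ⟨a₀, ha₀, a₁, ha₁, rfl⟩ := Submodule.mem_sup.1
    (show a ∈ 𝒜 0 ⊔ 𝒜 1 by rw [sup_eq_top]; trivial)
  obtain ⟨x₀, hx₀, x₁, hx₁, rfl⟩ := Submodule.mem_sup.1 hx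
  have key : ((a₀ + a₁) * (x₀ + x₁).1, LinearMap.mulLeft ℂ (a₀ + a₁) * (x₀ + x₁).2) =
      ((a₀ * x₀.1, LinearMap.mulLeft ℂ a₀ * x₀.2) + (a₀ * x₁.1, LinearMap.mulLeft ℂ a₀ * x₁.2)) +
      ((a₁ * x₀.1, LinearMap.mulLeft ℂ a₁ * x₀.2) +
        (a₁ * x₁.1, LinearMap.mulLeft ℂ a₁ * x₁.2)) := by
    refine Prod.ext ?_ (LinearMap.ext fun c => ?_)
    · simp only [Prod.fst_add, add_mul, mul_add]
      abel
    · simp only [Prod.snd_add, LinearMap.add_apply, Module.End.mul_apply,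
        LinearMap.mulLeft_apply, add_mul, mul_add]
      abel
  rw [key]
  exact add_mem
    (add_mem (qpHom_le 𝒜 _ (smul_mem_qpHom ha₀ hx₀)) (qpHom_le 𝒜 _ (smul_mem_qpHom ha₀ hx₁)))
    (add_mem (qpHom_le 𝒜 _ (smul_mem_qpHom ha₁ hx₀)) (qpHom_le 𝒜 _ (smul_mem_qpHom ha₁ hx₁)))

variable (𝒜) in
/-- The Lie superbracket of `𝔤` on homogeneous elements `x = a ⊕ δ`, `y = b ⊕ σ` of parities
`p`, `q`: `{x, y} = (δ(b) - (-1)^(p q) σ(a)) ⊕ [δ, σ]`. -/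
def bracket {p q : ZMod 2} {x y : A × Module.End ℂ A} (hx : x ∈ qpHom 𝒜 p)
    (hy : y ∈ qpHom 𝒜 q) : qpAlg 𝒜 :=
  ⟨(x.2 y.1 - sgn p q • y.2 x.1, scomm p q x.2 y.2), qpHom_le 𝒜 _ (bracket_mem hx hy)⟩

/-- The product `a · x` for `a ∈ A` and `x = b ⊕ δ ∈ 𝔤`, that is `a b ⊕ a δ`. -/
def lmul (a : A) (x : qpAlg 𝒜) : qpAlg 𝒜 :=
  ⟨(a * x.1.1, LinearMap.mulLeft ℂ a * x.1.2), smul_mem_qpAlg a x.2⟩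

/-- The product `x · b` for `x ∈ 𝔤` of parity `p` and `b ∈ A` of parity `q`; in the
supercommutative superalgebra `𝔤` it equals `(-1)^(p q) b · x`. -/
def rmul (p q : ZMod 2) (x : qpAlg 𝒜) (b : A) : qpAlg 𝒜 := sgn p q • lmul b x

/-! ### Quasi-Poisson modules -/

variable (𝒜)

/-- The three maps `φ : A → End(M)`, `ψ : 𝔤 → End(M)`, `φ̂ : 𝔤 → End(M)` which make up the data
of a quasi-Poisson module. -/
structure QPData (M : Type*) [AddCommGroup M] [Module ℂ M] where
  /-- the associative action `φ` -/
  φ : A →ₐ[ℂ] Module.End ℂ M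
  /-- the Lie action `ψ` -/
  ψ : qpAlg 𝒜 →ₗ[ℂ] Module.End ℂ M
  /-- the map `φ̂` -/
  φhat : qpAlg 𝒜 →ₗ[ℂ] Module.End ℂ M

variable {𝒜}
variable {M : Type*} [AddCommGroup M] [Module ℂ M] (𝓜 : ZMod 2 → Submodule ℂ M)

/-- The data `(φ, ψ, φ̂)` make the superspace `M` a quasi-Poisson module over the Lie-Rinehart
pair `(A, Der(A))`. The identities which involve signs are stated for homogeneous elements. -/
structure IsQPModule (S : QPData 𝒜 M) : Prop where
  isInternal : DirectSum.IsInternal 𝓜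
  φ_parity : ∀ (p q : ZMod 2), ∀ a ∈ 𝒜 p, ∀ v ∈ 𝓜 q, S.φ a v ∈ 𝓜 (p + q)
  ψ_parity : ∀ (p q : ZMod 2) (x : qpAlg 𝒜), x.1 ∈ qpHom 𝒜 p →
    ∀ v ∈ 𝓜 q, S.ψ x v ∈ 𝓜 (p + q)
  φhat_parity : ∀ (p q : ZMod 2) (x : qpAlg 𝒜), x.1 ∈ qpHom 𝒜 p →
    ∀ v ∈ 𝓜 q, S.φhat x v ∈ 𝓜 (p + q)
  ψ_bracket : ∀ (p q : ZMod 2) (x y : qpAlg 𝒜) (hx : x.1 ∈ qpHom 𝒜 p) (hy : y.1 ∈ qpHom 𝒜 q),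
    scomm p q (S.ψ x) (S.ψ y) = S.ψ (bracket 𝒜 hx hy)
  φhat_φhat : ∀ (p q : ZMod 2) (x y : qpAlg 𝒜), x.1 ∈ qpHom 𝒜 p → y.1 ∈ qpHom 𝒜 q →
    scomm p q (S.φhat x) (S.φhat y) =
      S.φhat (rmul p q x (proj 𝒜 y)) - S.φhat (lmul (proj 𝒜 x) y)
  φhat_lmul : ∀ (a : A) (x : qpAlg 𝒜), S.φhat (lmul a x) = S.φ a * S.φhat x
  φhat_φ : ∀ (p q : ZMod 2) (x : qpAlg 𝒜), x.1 ∈ qpHom 𝒜 p → ∀ a ∈ 𝒜 q,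
    scomm p q (S.φhat x) (S.φ a) = 0
  φhat_ψ : ∀ (p q : ZMod 2) (x y : qpAlg 𝒜) (hx : x.1 ∈ qpHom 𝒜 p) (hy : y.1 ∈ qpHom 𝒜 q),
    scomm p q (S.φhat x) (S.ψ y) =
      S.φhat (bracket 𝒜 hx hy) - sgn p q • (S.φ (proj 𝒜 y) * S.ψ x) +
        S.ψ (rmul p q x (proj 𝒜 y))
  ψ_φ : ∀ (p q : ZMod 2) (x : qpAlg 𝒜), x.1 ∈ qpHom 𝒜 p → ∀ a ∈ 𝒜 q,
    scomm p q (S.ψ x) (S.φ a) = S.φ (qact 𝒜 x a)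

/-- A quasi-Poisson module is simple if it is nonzero and it has no submodules (that is,
sub-superspaces invariant under all `φ_a`, `ψ_x`, `φ̂_x`) other than zero and itself. -/
structure QPData.IsSimple (S : QPData 𝒜 M) : Prop where
  nontrivial : Nontrivial M
  eq_bot_or_eq_top : ∀ W : Submodule ℂ M, IsSubsuperspace 𝓜 W →
    (∀ a, ∀ v ∈ W, S.φ a v ∈ W) → (∀ x, ∀ v ∈ W, S.ψ x v ∈ W) →
    (∀ x, ∀ v ∈ W, S.φhat x v ∈ W) → W = ⊥ ∨ W = ⊤

/-- Two quasi-Poisson modules are isomorphic: there is a parity preserving linear bijection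
intertwining `φ`, `ψ` and `φ̂`. -/
def QPData.Isomorphic {M' : Type*} [AddCommGroup M'] [Module ℂ M'] (S : QPData 𝒜 M)
    (𝓜' : ZMod 2 → Submodule ℂ M') (S' : QPData 𝒜 M') : Prop :=
  ∃ Θ : M ≃ₗ[ℂ] M', (∀ p, ∀ v ∈ 𝓜 p, Θ v ∈ 𝓜' p) ∧
    (∀ a v, Θ (S.φ a v) = S'.φ a (Θ v)) ∧ (∀ x v, Θ (S.ψ x v) = S'.ψ x (Θ v)) ∧
    (∀ x v, Θ (S.φhat x v) = S'.φhat x (Θ v))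

/-! ### The `L(A) L(𝔤)`-module `L(M)`

For a vector space `V`, the space `L(V) = ℂ[t₀^{±1}] ⊗ V` is `ℤ →₀ V`, where `t₀^r ⊗ v` is
`Finsupp.single r v`. -/

variable (S : QPData 𝒜 M)

/-- The action `(t₀^r ⊗ a) · (t₀^s ⊗ v) = t₀^(r+s) ⊗ φ_a(v)` of `L(A)` on `L(M)`. -/
def loopMul : (ℤ →₀ A) →ₗ[ℂ] Module.End ℂ (ℤ →₀ M) :=
  Finsupp.lsum ℂ fun r =>
    { toFun := fun a => Finsupp.lsum ℂ fun s => Finsupp.lsingle (r + s) ∘ₗ S.φ a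
      map_add' := fun a b => by
        ext s v : 2
        simp
      map_smul' := fun c a => by
        ext s v : 2
        simp }

/-- The action `(t₀^r ⊗ x) * (t₀^s ⊗ v) = t₀^(r+s) ⊗ (ψ_x(v) - r φ̂_x(v) + s φ_{π(x)}(v))` of
`L(𝔤)` on `L(M)`. -/
def loopLie : (ℤ →₀ qpAlg 𝒜) →ₗ[ℂ] Module.End ℂ (ℤ →₀ M) :=
  Finsupp.lsum ℂ fun r =>
    { toFun := fun x => Finsupp.lsum ℂ fun s =>
        Finsupp.lsingle (r + s) ∘ₗ
          (S.ψ x - (r : ℂ) • S.φhat x + (s : ℂ) • S.φ (proj 𝒜 x))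
      map_add' := fun x y => by
        ext s v : 2
        simp only [proj, map_add, Submodule.coe_add, Prod.fst_add, LinearMap.comp_apply,
          Finsupp.lsingle_apply, Finsupp.lsum_single, LinearMap.add_apply, LinearMap.sub_apply,
          LinearMap.smul_apply, smul_add, ← Finsupp.single_add]
        congr 1
        abel
      map_smul' := fun c x => by
        ext s v : 2
        simp only [proj, map_smul, Submodule.coe_smul, Prod.smul_fst, LinearMap.comp_apply,
          Finsupp.lsingle_apply, Finsupp.lsum_single, LinearMap.add_apply, LinearMap.sub_apply,
          LinearMap.smul_apply, RingHom.id_apply, Finsupp.smul_single, smul_add, smul_sub]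
        congr 1
        rw [smul_comm c, smul_comm c] }

/-- The action of the subspace `L(A) # L(𝔤)` of the smash product `L(A) # U(L(𝔤))` on `L(M)`; the
underlying vector space is `L(A) ⊗ L(𝔤)`, and `a # x` acts as `w ↦ a · (x * w)`. -/
def smashAct : ((ℤ →₀ A) ⊗[ℂ] (ℤ →₀ qpAlg 𝒜)) →ₗ[ℂ] Module.End ℂ (ℤ →₀ M) :=
  TensorProduct.lift ((LinearMap.mul ℂ (Module.End ℂ (ℤ →₀ M))).compl₁₂ (loopMul S) (loopLie S))

end General

/-! ### Weight spaces -/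

/-- The weight space for a family of operators `T k` and a family of scalars `l k`: the space of
all `v` with `T k v = l k v` for all `k`. -/
def weightSpace {κ V : Type*} [AddCommGroup V] [Module ℂ V] (T : κ → Module.End ℂ V)
    (l : κ → ℂ) : Submodule ℂ V :=
  ⨅ k, Module.End.eigenspace (T k) (l k)

/-- `V` is the sum of its weight spaces with respect to the operators `T k` (the sum is then
automatically direct), the weight spaces are finite dimensional, and their dimensions are
bounded. -/
def HasBoundedWeights {κ V : Type*} [AddCommGroup V] [Module ℂ V] (T : κ → Module.End ℂ V) :
    Prop :=
  (⨆ l, weightSpace T l = ⊤) ∧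
    ∃ d : ℕ, ∀ l, FiniteDimensional ℂ (weightSpace T l) ∧
      Module.finrank ℂ (weightSpace T l) ≤ d

/-! ### The superalgebra `ℂ[t₁^{±1}, …, t_m^{±1}] ⊗ Λ_n` and its standard derivations -/

/-- The Grassmann algebra `Λ_n` in `n` variables `ζ₁, …, ζ_n`. -/
abbrev Grass (n : ℕ) : Type := ExteriorAlgebra ℂ (Fin n → ℂ)

/-- The superalgebra `ℂ[t₁^{±1}, …, t_m^{±1}] ⊗ Λ_n`, realized as the algebra of Laurent
polynomials in (central) variables `t₁, …, t_m` with coefficients in `Λ_n`; the element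
`t^r ⊗ x` is `AddMonoidAlgebra.single r x`. -/
abbrev SAlg (m n : ℕ) : Type := AddMonoidAlgebra (Grass n) (Fin m → ℤ)

variable {m n : ℕ}

variable (n) in
/-- The monomial `t^r`. -/
def tpow (r : Fin m → ℤ) : SAlg m n := AddMonoidAlgebra.single r 1

variable (m) in
/-- The odd generator `ζ_k`. -/
def zeta (k : Fin n) : SAlg m n :=
  AddMonoidAlgebra.single 0 (ExteriorAlgebra.ι ℂ (Pi.single k 1))

variable (m) in
/-- The monomial `ζ_I = ζ_{j₁} ⋯ ζ_{j_p}` for `I = {j₁ < ⋯ < j_p}`. -/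
def zetaI (I : Finset (Fin n)) : SAlg m n :=
  ((I.sort (fun i j => i ≤ j)).map (zeta m)).prod

variable (m n) in
/-- The parity automorphism of `SAlg m n`, with `t_i ↦ t_i` and `ζ_k ↦ -ζ_k`. -/
def parityAut : SAlg m n →ₐ[ℂ] SAlg m n :=
  AddMonoidAlgebra.mapAlgHom (Fin m → ℤ)
    (CliffordAlgebra.involute (Q := (0 : QuadraticForm ℂ (Fin n → ℂ))))

@[simp] theorem parityAut_single (r : Fin m → ℤ) (x : Grass n) :
    parityAut m n (AddMonoidAlgebra.single r x) =
      AddMonoidAlgebra.single r (CliffordAlgebra.involute x) := by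
  simp [parityAut]

variable (m n) in
/-- The parity `ℤ/2`-grading of `SAlg m n`: the even part is where the parity automorphism is `1`,
the odd part is where it is `-1`. -/
def par (p : ZMod 2) : Submodule ℂ (SAlg m n) :=
  Module.End.eigenspace (parityAut m n).toLinearMap ((-1) ^ p.val)

theorem mem_par {p : ZMod 2} {a : SAlg m n} : a ∈ par m n p ↔ parityAut m n a = sgn 1 p • a := by
  rw [par, Module.End.mem_eigenspace_iff]
  simp [sgn, ZMod.val_one]

theorem parityAut_parityAut (a : SAlg m n) : parityAut m n (parityAut m n a) = a := by
  induction a using AddMonoidAlgebra.induction_linear with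
  | zero => simp
  | add x y hx hy => rw [map_add, map_add, hx, hy]
  | single r x => simp

/-- Supercommutativity of the Grassmann algebra, written without reference to parities. -/
theorem grass_comm (x y : Grass n) :
    (2 : ℂ) • (x * y) = (y + CliffordAlgebra.involute y) * x +
      (y - CliffordAlgebra.involute y) * CliffordAlgebra.involute x := by
  induction x using CliffordAlgebra.left_induction generalizing y with
  | algebraMap r =>
    rw [AlgHom.commutes, ← add_mul, two_smul, Algebra.commutes, add_add_sub_cancel, add_mul]
  | add x₁ x₂ h₁ h₂ =>
    simp only [add_mul, map_add, mul_add, sub_mul, smul_add] at *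
    rw [h₁, h₂]
    abel
  | ι_mul x v h =>
    have hv : ∀ z : Grass n, CliffordAlgebra.ι _ v * z =
        CliffordAlgebra.involute z * CliffordAlgebra.ι _ v := by
      intro z
      induction z using CliffordAlgebra.left_induction with
      | algebraMap r => rw [AlgHom.commutes, Algebra.commutes]
      | add x y hx hy => rw [mul_add, map_add, add_mul, hx, hy]
      | ι_mul z w hz =>
        have h0 := ExteriorAlgebra.ι_add_mul_swap (R := ℂ) v w
        have h1 : CliffordAlgebra.ι (0 : QuadraticForm ℂ (Fin n → ℂ)) v * CliffordAlgebra.ι _ w =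
            - (CliffordAlgebra.ι _ w * CliffordAlgebra.ι _ v) := eq_neg_of_add_eq_zero_left h0
        rw [← mul_assoc, h1, map_mul, CliffordAlgebra.involute_ι, neg_mul, neg_mul, neg_mul,
          mul_assoc, hz, mul_assoc]
    rw [mul_assoc, ← mul_smul_comm, h, mul_add, ← mul_assoc, ← mul_assoc, hv, hv, map_mul,
      CliffordAlgebra.involute_ι, map_add, map_sub, CliffordAlgebra.involute_involute]
    simp only [add_mul, sub_mul, neg_mul, mul_neg, mul_assoc]
    abel

/-- Supercommutativity of `SAlg m n`, written without reference to parities. -/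
theorem salg_comm (a b : SAlg m n) :
    (2 : ℂ) • (a * b) = (b + parityAut m n b) * a + (b - parityAut m n b) * parityAut m n a := by
  induction a using AddMonoidAlgebra.induction_linear with
  | zero => simp
  | add x y hx hy =>
    rw [add_mul, smul_add, hx, hy, map_add, mul_add, mul_add]
    abel
  | single r x =>
    induction b using AddMonoidAlgebra.induction_linear with
    | zero => simp
    | add x y hx hy =>
      rw [mul_add, smul_add, hx, hy]
      simp only [map_add, add_mul, sub_mul]
      abel
    | single s y =>
      have h := congrArg (fun z => AddMonoidAlgebra.single (s + r) z) (grass_comm x y)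
      simp only [add_mul, sub_mul, AddMonoidAlgebra.single_add, AddMonoidAlgebra.single_sub,
        ← AddMonoidAlgebra.smul_single] at h
      simp only [parityAut_single, add_mul, sub_mul, AddMonoidAlgebra.single_mul_single]
      rw [add_comm r s]
      exact h

instance isSupercommutative_par : IsSupercommutative (par m n) where
  isInternal := by
    rw [DirectSum.isInternal_submodule_iff_isCompl (i := 0) (j := 1) _ (by decide) (by
      ext p
      simpa using zmod_two_cases p)]
    constructor
    · rw [Submodule.disjoint_def]
      intro a h0 h1
      rw [mem_par] at h0 h1
      rw [h1] at h0
      simp only [sgn_one_one, sgn_zero_right, one_smul, neg_smul] at h0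
      have h2 : (2 : ℂ) • a = 0 := by
        rw [two_smul]
        nth_rewrite 1 [← h0]
        exact neg_add_cancel a
      exact (smul_eq_zero.mp h2).resolve_left two_ne_zero
    · rw [codisjoint_iff, eq_top_iff]
      intro a _
      refine Submodule.mem_sup.2 ⟨(1 / 2 : ℂ) • (a + parityAut m n a), ?_,
        (1 / 2 : ℂ) • (a - parityAut m n a), ?_, ?_⟩
      · rw [mem_par, map_smul, map_add, parityAut_parityAut, add_comm]
        simp
      · rw [mem_par, map_smul, map_sub, parityAut_parityAut]
        simp only [sgn_one_one, neg_smul, one_smul, ← smul_neg, neg_sub]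
      · rw [← smul_add]
        have : a + parityAut m n a + (a - parityAut m n a) = (2 : ℂ) • a := by
          rw [two_smul]
          abel
        rw [this, smul_smul]
        norm_num
  one_mem := by simp [mem_par]
  mul_mem := by
    intro p q a b ha hb
    rw [mem_par] at ha hb ⊢
    rw [map_mul, ha, hb, sgn_add_right, smul_mul_smul_comm]
  mul_comm := by
    intro p q a b ha hb
    rw [mem_par] at ha hb
    have h := salg_comm a b
    rw [ha, hb] at h
    have h2 : (2 : ℂ) • (a * b) = (2 : ℂ) • (sgn p q • (b * a)) := by
      rw [h]
      rcases zmod_two_cases p with rfl | rfl <;> rcases zmod_two_cases q with rfl | rfl <;>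
        simp [two_smul, ← mul_add, add_mul]
    exact smul_right_injective _ (two_ne_zero) h2

/-- The linear operator `t^r ⊗ x ↦ t^r ⊗ f_r(x)` on `SAlg m n`. -/
def coeffMap (f : (Fin m → ℤ) → Grass n →ₗ[ℂ] Grass n) : Module.End ℂ (SAlg m n) :=
  (AddMonoidAlgebra.coeffLinearEquiv ℂ).symm.toLinearMap ∘ₗ
    (Finsupp.lsum ℂ fun r : Fin m → ℤ => Finsupp.lsingle r ∘ₗ f r) ∘ₗ
    (AddMonoidAlgebra.coeffLinearEquiv ℂ).toLinearMap

@[simp] theorem coeffMap_single (f : (Fin m → ℤ) → Grass n →ₗ[ℂ] Grass n) (r : Fin m → ℤ)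
    (x : Grass n) : coeffMap f (AddMonoidAlgebra.single r x) = AddMonoidAlgebra.single r (f r x) := by
  simp [coeffMap]

variable (n) in
/-- The even derivation `d_i = t_i d/dt_i`, `t^r ⊗ x ↦ r_i t^r ⊗ x`. -/
def dt (i : Fin m) : Module.End ℂ (SAlg m n) := coeffMap fun r => (r i : ℂ) • LinearMap.id

/-- The left derivative `∂/∂ζ_k` of the Grassmann algebra, that is, the contraction with the
`k`-th coordinate form. -/
def grassD (k : Fin n) : Grass n →ₗ[ℂ] Grass n :=
  CliffordAlgebra.contractLeft (LinearMap.proj k : (Fin n → ℂ) →ₗ[ℂ] ℂ)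

variable (m) in
/-- The odd derivation `∂_k = ∂/∂ζ_k`, `t^r ⊗ x ↦ t^r ⊗ ∂x/∂ζ_k`. -/
def dz (k : Fin n) : Module.End ℂ (SAlg m n) := coeffMap fun _ => grassD k

theorem grassD_mul (k : Fin n) (x y : Grass n) :
    grassD k (x * y) = grassD k x * y + CliffordAlgebra.involute x * grassD k y := by
  induction x using CliffordAlgebra.left_induction with
  | algebraMap r =>
    rw [grassD, CliffordAlgebra.contractLeft_algebraMap_mul,
      CliffordAlgebra.contractLeft_algebraMap, AlgHom.commutes, zero_mul, zero_add]
  | add x₁ x₂ h₁ h₂ =>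
    rw [add_mul, map_add, h₁, h₂, map_add, map_add, add_mul, add_mul]
    abel
  | ι_mul x v h =>
    rw [grassD] at *
    rw [mul_assoc, CliffordAlgebra.contractLeft_ι_mul, CliffordAlgebra.contractLeft_ι_mul, h,
      map_mul, CliffordAlgebra.involute_ι, mul_add, sub_mul, smul_mul_assoc]
    simp only [mul_assoc, neg_mul]
    abel

theorem involute_grassD (k : Fin n) (x : Grass n) :
    CliffordAlgebra.involute (grassD k x) = - grassD k (CliffordAlgebra.involute x) := by
  induction x using CliffordAlgebra.left_induction with
  | algebraMap r =>
    rw [AlgHom.commutes, grassD, CliffordAlgebra.contractLeft_algebraMap, map_zero, neg_zero]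
  | add x₁ x₂ h₁ h₂ =>
    rw [map_add, map_add, h₁, h₂, map_add, map_add, neg_add]
  | ι_mul x v h =>
    rw [grassD] at *
    rw [CliffordAlgebra.contractLeft_ι_mul, map_sub, map_mul, h, map_mul,
      CliffordAlgebra.involute_ι, map_smul, neg_mul, neg_mul, map_neg,
      CliffordAlgebra.contractLeft_ι_mul, mul_neg, neg_neg, neg_neg]

theorem dt_mul (i : Fin m) (a b : SAlg m n) : dt n i (a * b) = dt n i a * b + a * dt n i b := by
  induction a using AddMonoidAlgebra.induction_linear with
  | zero => simp
  | add x y hx hy =>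
    rw [add_mul, map_add, hx, hy, map_add, add_mul, add_mul]
    abel
  | single r x =>
    induction b using AddMonoidAlgebra.induction_linear with
    | zero => simp
    | add x y hx hy =>
      rw [mul_add, map_add, hx, hy, map_add, mul_add, mul_add]
      abel
    | single s y =>
      simp only [dt, AddMonoidAlgebra.single_mul_single, coeffMap_single, LinearMap.smul_apply,
        LinearMap.id_apply, smul_mul_assoc, mul_smul_comm, ← AddMonoidAlgebra.single_add,
        ← add_smul, Pi.add_apply, Int.cast_add]

theorem parityAut_dt (i : Fin m) (a : SAlg m n) :
    parityAut m n (dt n i a) = dt n i (parityAut m n a) := by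
  induction a using AddMonoidAlgebra.induction_linear with
  | zero => simp
  | add x y hx hy => rw [map_add, map_add, hx, hy, map_add, map_add]
  | single r x => simp [dt]

theorem dz_mul (k : Fin n) (a b : SAlg m n) :
    dz m k (a * b) = dz m k a * b + parityAut m n a * dz m k b := by
  induction a using AddMonoidAlgebra.induction_linear with
  | zero => simp
  | add x y hx hy =>
    rw [add_mul, map_add, hx, hy, map_add, map_add, add_mul, add_mul]
    abel
  | single r x =>
    induction b using AddMonoidAlgebra.induction_linear with
    | zero => simp
    | add x y hx hy =>
      rw [mul_add, map_add, hx, hy, map_add, mul_add, mul_add]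
      abel
    | single s y =>
      simp only [dz, AddMonoidAlgebra.single_mul_single, coeffMap_single, parityAut_single,
        ← AddMonoidAlgebra.single_add, grassD_mul]

theorem parityAut_dz (k : Fin n) (a : SAlg m n) :
    parityAut m n (dz m k a) = - dz m k (parityAut m n a) := by
  induction a using AddMonoidAlgebra.induction_linear with
  | zero => simp
  | add x y hx hy => rw [map_add, map_add, hx, hy, map_add, map_add, neg_add]
  | single r x => simp [dz, involute_grassD, AddMonoidAlgebra.single_neg]

theorem dt_mem (i : Fin m) : dt n i ∈ superDer (par m n) 0 := by
  refine ⟨fun q a ha => ?_, fun q a _ b => ?_⟩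
  · rw [mem_par] at ha ⊢
    rw [parityAut_dt, ha, map_smul, zero_add]
  · rw [dt_mul, sgn_zero_left, one_smul]

theorem dz_mem (k : Fin n) : dz m k ∈ superDer (par m n) 1 := by
  refine ⟨fun q a ha => ?_, fun q a ha b => ?_⟩
  · rw [mem_par] at ha ⊢
    rw [parityAut_dz, ha, map_smul, sgn_add_right, sgn_one_one, neg_one_mul, neg_smul]
  · rw [mem_par] at ha
    rw [dz_mul, ha, smul_mul_assoc]

/-! ### The elements `∂_α` and `𝔤 = A ⊕ Der(A)` for `A = SAlg m n`

The indices `0, 1, …, m` and `1̄, …, n̄` are `Sum.inl 0`, `Sum.inl i.succ` for `i : Fin m`, and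
`Sum.inr k` for `k : Fin n`. -/

/-- The index set `{0, …, m, 1̄, …, n̄}` of the rows and columns of matrices in `𝔤𝔩(m+1, n)`. -/
abbrev Idx (m n : ℕ) : Type := Fin (m + 1) ⊕ Fin n

/-- The parity of an index: `0, …, m` are even, `1̄, …, n̄` are odd. -/
def idxPar : Idx m n → ZMod 2 := Sum.elim (fun _ => 0) (fun _ => 1)

/-- The quasi-Poisson superalgebra `𝔤 = A ⊕ Der(A)` of `A = SAlg m n`. -/
abbrev QPg (m n : ℕ) : Submodule ℂ (SAlg m n × Module.End ℂ (SAlg m n)) := qpAlg (par m n)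

/-- The elements `∂_0 = 1`, `∂_i = d_i` (`1 ≤ i ≤ m`), `∂_k̄ = ∂/∂ζ_k` (`1 ≤ k ≤ n`) of `𝔤`. -/
def del : Idx m n → QPg m n :=
  Sum.elim
    (Fin.cases ⟨(1, 0), qpHom_le _ 0 ⟨isSupercommutative_par.one_mem, zero_mem _⟩⟩
      fun i => ⟨(0, dt n i), qpHom_le _ 0 ⟨zero_mem _, dt_mem i⟩⟩)
    fun k => ⟨(0, dz m k), qpHom_le _ 1 ⟨zero_mem _, dz_mem k⟩⟩

/-- The coefficients of `x ∈ 𝔤` in the `A`-basis `∂_α` of `𝔤`: for `x = a ⊕ δ` these are `a`,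
`δ(t_i) t_i⁻¹` and `δ(ζ_k)`. -/
def coord : Idx m n → QPg m n →ₗ[ℂ] SAlg m n :=
  Sum.elim
    (Fin.cases (LinearMap.fst ℂ _ _ ∘ₗ (QPg m n).subtype)
      fun i => LinearMap.mulRight ℂ (tpow n (-Pi.single i 1)) ∘ₗ
        LinearMap.applyₗ (tpow n (Pi.single i 1)) ∘ₗ LinearMap.snd ℂ _ _ ∘ₗ (QPg m n).subtype)
    fun k => LinearMap.applyₗ (zeta m k) ∘ₗ LinearMap.snd ℂ _ _ ∘ₗ (QPg m n).subtype

/-- The operator `a ↦ (-1)^(p |a|) a` on `A`. -/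
def twist (p : ZMod 2) : Module.End ℂ (SAlg m n) := (parityAut m n).toLinearMap ^ p.val

/-! ### `𝔤𝔩(m+1, n)` and its modules -/

/-- The matrix `x ∈ 𝔤𝔩(m+1, n)` is homogeneous of parity `p`. -/
def IsHomMatrix (p : ZMod 2) (x : Matrix (Idx m n) (Idx m n) ℂ) : Prop :=
  ∀ α β, x α β ≠ 0 → idxPar α + idxPar β = p

section Gl

variable {W : Type*} [AddCommGroup W] [Module ℂ W] (𝓦 : ZMod 2 → Submodule ℂ W)
  (ρ : Matrix (Idx m n) (Idx m n) ℂ →ₗ[ℂ] Module.End ℂ W)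

/-- The superspace `W` is a module over the Lie superalgebra `𝔤𝔩(m+1, n)` through `ρ`. -/
structure IsGlModule : Prop where
  isInternal : DirectSum.IsInternal 𝓦
  parity : ∀ (p q : ZMod 2) (x : Matrix (Idx m n) (Idx m n) ℂ), IsHomMatrix p x →
    ∀ w ∈ 𝓦 q, ρ x w ∈ 𝓦 (p + q)
  map_bracket : ∀ (p q : ZMod 2) (x y : Matrix (Idx m n) (Idx m n) ℂ), IsHomMatrix p x →
    IsHomMatrix q y → ρ (x * y - sgn p q • (y * x)) = scomm p q (ρ x) (ρ y)

/-- A `𝔤𝔩(m+1, n)`-module is admissible if it is a weight module with respect to the diagonal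
matrices, with finite dimensional weight spaces of bounded dimension. -/
def IsAdmissible : Prop :=
  HasBoundedWeights fun α : Idx m n => ρ (Matrix.single α α 1)

/-- A `𝔤𝔩(m+1, n)`-module is simple: it is nonzero, and zero and `W` are the only invariant
subspaces (homogeneous or not). -/
def IsSimpleGl : Prop :=
  Nontrivial W ∧ ∀ U : Submodule ℂ W, (∀ x, ∀ u ∈ U, ρ x u ∈ U) → U = ⊥ ∨ U = ⊤

/-! ### Shen-Larsson quasi-Poisson modules -/

/-- The parity of `A ⊗ W`. -/
def tensorPar (p : ZMod 2) : Submodule ℂ (SAlg m n ⊗[ℂ] W) :=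
  ⨆ q : ZMod 2, Submodule.map₂ (TensorProduct.mk ℂ (SAlg m n) W) (par m n q) (𝓦 (p - q))

/-- The Shen-Larsson quasi-Poisson module `A ⊗ W` attached to a `𝔤𝔩(m+1, n)`-module `W` and a tuple
`μ` of scalars. For homogeneous `a, b ∈ A` one has `φ_a(b ⊗ w) = a b ⊗ w`,
`φ̂_{a ∂_α}(b ⊗ w) = -(-1)^(|b| |∂_α|) a b ⊗ E_{0,α} w` and
`ψ_{a ∂_α}(b ⊗ w) = a (∂_α(b) + μ(α) b) ⊗ w
  + ∑_{β ≠ 0} (-1)^(|a b| |∂_β| + |∂_β| + |b| |∂_α|) ∂_β(a) b ⊗ E_{β,α} w`,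
where `∂_0(b) = 0`. -/
def shenLarsson (μ : Idx m n → ℂ) : QPData (par m n) (SAlg m n ⊗[ℂ] W) where
  φ := Algebra.lsmul ℂ ℂ (SAlg m n ⊗[ℂ] W)
  ψ :=
    { toFun := fun x => ∑ α : Idx m n,
        (TensorProduct.map
          (LinearMap.mulLeft ℂ (coord α x) * ((del α).1.2 + μ α • 1)) LinearMap.id +
        ∑ β : Idx m n, (if β = Sum.inl 0 then (0 : ℂ) else sgn (idxPar β) 1) •
          TensorProduct.map
            (LinearMap.mulLeft ℂ ((del β).1.2 (twist (idxPar β) (coord α x))) *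
              twist (idxPar β + idxPar α))
            (ρ (Matrix.single β α 1)))
      map_add' := by
        intro x y
        rw [← Finset.sum_add_distrib]
        refine Finset.sum_congr rfl fun α _ => ?_
        have hl : ∀ a b : SAlg m n, LinearMap.mulLeft ℂ (a + b) =
            LinearMap.mulLeft ℂ a + LinearMap.mulLeft ℂ b := fun a b =>
          LinearMap.ext fun c => add_mul a b c
        simp only [map_add, hl, add_mul, TensorProduct.map_add_left, smul_add,
          Finset.sum_add_distrib]
        abel
      map_smul' := by
        intro c x
        rw [RingHom.id_apply, Finset.smul_sum]
        refine Finset.sum_congr rfl fun α _ => ?_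
        have hl : ∀ a : SAlg m n, LinearMap.mulLeft ℂ (c • a) = c • LinearMap.mulLeft ℂ a :=
          fun a => LinearMap.ext fun b => smul_mul_assoc c a b
        simp only [map_smul, hl, smul_mul_assoc, TensorProduct.map_smul_left, smul_add,
          Finset.smul_sum]
        congr 1
        exact Finset.sum_congr rfl fun β _ => smul_comm _ _ _ }
  φhat :=
    { toFun := fun x => (-1 : ℂ) • ∑ α : Idx m n,
        TensorProduct.map (LinearMap.mulLeft ℂ (coord α x) * twist (idxPar α))
          (ρ (Matrix.single (Sum.inl 0) α 1))
      map_add' := by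
        intro x y
        have hl : ∀ a b : SAlg m n, LinearMap.mulLeft ℂ (a + b) =
            LinearMap.mulLeft ℂ a + LinearMap.mulLeft ℂ b := fun a b =>
          LinearMap.ext fun c => add_mul a b c
        simp only [map_add, hl, add_mul, TensorProduct.map_add_left, Finset.sum_add_distrib,
          smul_add]
      map_smul' := by
        intro c x
        have hl : ∀ a : SAlg m n, LinearMap.mulLeft ℂ (c • a) = c • LinearMap.mulLeft ℂ a :=
          fun a => LinearMap.ext fun b => smul_mul_assoc c a b
        simp only [map_smul, hl, smul_mul_assoc, TensorProduct.map_smul_left, RingHom.id_apply,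
          ← Finset.smul_sum]
        exact smul_comm _ _ _ }

end Gl

/-! ### The subspace `𝒯` of the smash product

Write `t^r = t₀^{r₀} t^{r'}` with `r' = (r₁, …, r_m)` for `r ∈ ℤ^{m+1}`. The Lie-Rinehart pair of
`ℂ[t₀^{±1}, …, t_m^{±1}] ⊗ Λ_n` and its superderivations is `(L(A), L(𝔤))` for `A = SAlg m n`, where
`t^r a` corresponds to `t₀^{r₀} ⊗ t^{r'} a`, and `t^r a ∂_α` corresponds to
`t₀^{r₀} ⊗ t^{r'} a · ∂_α`; in particular `d_0 = t₀ d/dt₀` corresponds to `1 ⊗ ∂_0`. -/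

/-- `τ(I, J) = ∑_{j ∈ J} |{i ∈ I | j < i}|`. -/
def tau (I J : Finset (Fin n)) : ℕ := ∑ j ∈ J, (I.filter fun i => j < i).card

/-- The element `t^r ζ_I` of `ℂ[t₀^{±1}, …, t_m^{±1}] ⊗ Λ_n = L(A)`. -/
def bigMono (r : Fin (m + 1) → ℤ) (I : Finset (Fin n)) : ℤ →₀ SAlg m n :=
  Finsupp.single (r 0) (tpow n (Fin.tail r) * zetaI m I)

/-- The derivation `t^r ζ_I ∂_α` of `ℂ[t₀^{±1}, …, t_m^{±1}] ⊗ Λ_n`, as an element of `L(𝔤)`. -/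
def bigDer (r : Fin (m + 1) → ℤ) (I : Finset (Fin n)) (α : Idx m n) : ℤ →₀ QPg m n :=
  Finsupp.single (r 0) (lmul (tpow n (Fin.tail r) * zetaI m I) (del α))

/-- The elements `X_{r,J,∂_α}`. -/
def Xelt (r : Fin (m + 1) → ℤ) (J : Finset (Fin n)) (α : Idx m n) :
    (ℤ →₀ SAlg m n) ⊗[ℂ] (ℤ →₀ QPg m n) :=
  if J = ∅ then
    bigMono (-r) ∅ ⊗ₜ[ℂ] bigDer r ∅ α - bigMono 0 ∅ ⊗ₜ[ℂ] bigDer 0 ∅ α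
  else
    ∑ I ∈ J.powerset, (-1 : ℂ) ^ (I.card + tau I (J \ I)) •
      (bigMono (-r) I ⊗ₜ[ℂ] bigDer r (J \ I) α)

variable (m n) in
/-- The span `𝒯` of all `X_{r,J,∂_α}` with `J ≠ ∅` and all `X_{s,∅,∂_α}` with `s ≠ 0`. -/
def calT : Submodule ℂ ((ℤ →₀ SAlg m n) ⊗[ℂ] (ℤ →₀ QPg m n)) :=
  Submodule.span ℂ {x | ∃ (r : Fin (m + 1) → ℤ) (J : Finset (Fin n)) (α : Idx m n),
    (J ≠ ∅ ∨ r ≠ 0) ∧ x = Xelt r J α}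

/-! ### Cuspidal quasi-Poisson modules, and the subspaces `N` and `Ω` -/

section Cuspidal

variable {M : Type*} [AddCommGroup M] [Module ℂ M] (S : QPData (par m n) M)

/-- The elements `1, d_i, ζ_k ∂_k` of `𝔤`, whose span is `𝔱`. -/
def torus : Idx m n → QPg m n :=
  Sum.elim (fun i => del (Sum.inl i)) fun k => lmul (zeta m k) (del (Sum.inr k))

/-- The quasi-Poisson module is cuspidal: `(M, ψ)` has a weight space decomposition with respect to
`𝔱 = span {1, d_i, ζ_k ∂_k}` with finite dimensional weight spaces of bounded dimension. -/
def QPData.IsCuspidal : Prop := HasBoundedWeights fun α => S.ψ (torus α)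

/-- The sum `M_(μ)` of all weight spaces `M^λ` with `λ|_𝔱' = μ`, where `𝔱' = span {1, d_i}`; the
functionals `λ` and `μ` are given by their values on the bases of `𝔱` and `𝔱'`. -/
def QPData.block (μ : Fin (m + 1) → ℂ) : Submodule ℂ M :=
  ⨆ (l : Idx m n → ℂ) (_ : ∀ i, l (Sum.inl i) = μ i), weightSpace (fun α => S.ψ (torus α)) l

/-- `Ω(N) = {u ∈ N | ψ_{∂_k}(u) = 0 for 1 ≤ k ≤ n}`. -/
def QPData.omega (N : Submodule ℂ M) : Submodule ℂ M :=
  N ⊓ ⨅ k : Fin n, LinearMap.ker (S.ψ (del (Sum.inr k)))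

/-- The subspace `U` of `M`, identified with the subspace `t₀^0 ⊗ U` of `L(M)`, is invariant under
the action of `𝒯` on `L(M)`. -/
def QPData.IsTInvariant (U : Submodule ℂ M) : Prop :=
  ∀ x ∈ calT m n, ∀ u ∈ U, ∃ w ∈ U, smashAct S x (Finsupp.single 0 u) = Finsupp.single 0 w

/-- The operators `Φ(E_{α,β})`:
`Φ(E_{0,β}) = -φ̂_{∂_β}`, `Φ(E_{i,β}) = φ_{t_i⁻¹} ψ_{t_i ∂_β} - ψ_{∂_β}` for `1 ≤ i ≤ m`, and
`Φ(E_{k̄,β}) = ψ_{ζ_k ∂_β} - φ_{ζ_k} ψ_{∂_β}` for `1 ≤ k ≤ n`. -/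
def QPData.glOp (α β : Idx m n) : Module.End ℂ M :=
  Sum.elim
    (Fin.cases (-S.φhat (del β)) fun i : Fin m =>
      S.φ (tpow n (-Pi.single i 1)) * S.ψ (lmul (tpow n (Pi.single i 1)) (del β)) -
        S.ψ (del β))
    (fun k => S.ψ (lmul (zeta m k) (del β)) - S.φ (zeta m k) * S.ψ (del β)) α

end Cuspidal

end QP

end

noncomputable section

namespace QP

variable {m n : ℕ}

/-! ### The algebra `SAlg m n` -/

/-! `M` behaves like the sections of a bundle on a supertorus with function algebra `A = SAlg m n`,
and `Ω` is its fibre at the point `t_i = 1`, `ζ_k = 0`; the augmentation `aug` is evaluation at this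
point.

Simplicity makes the parity of a weight vector a function of its weight (`iSup_pieces`). Every
torus-stable subspace is therefore a sub-superspace, and simplicity of `M` applies to invariant
subspaces without any check of homogeneity (`IsBased.eq_top`). The operators `ψ_{∂_k}` and `φ_{ζ_k}`
satisfy Clifford relations and the `φ_{t^r}` are invertible and permute the blocks; it follows that
`a ⊗ u ↦ φ_a u` is a bijection `A ⊗ Ω → M` (`theta_injective`, `theta_surjective`), and evaluation
in the first factor gives `ev : M → Ω`.

A vector field `a ∂_α` with `aug a = 0` vanishes at the point, so `ψ_{a ∂_α}` descends along `ev` to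
an operator `X (a ∂_α)` on `Ω` (`ev_ψ`), and the quasi-Poisson relations descend with it. The
alternating sums defining `X_{r,J,∂}` are built so that they send `Ω` to vectors killed by all
`ψ_{∂_k}`; such a vector of the block equals its own evaluation, so `𝒯` acts on `Ω` through the
operators `X` and `φ̂_∂` (`smashAct_Xelt`). If `U ≤ Ω` is stable under these, then `φ_A U` is a
submodule of `M` (`family_mem_gen`, `gen_eq_top`). Hence `φ_A U = M` for `U ≠ 0`, and `U = Ω` by
evaluation.

The decisive step is that `X (b ∂_α) = 0` once `b` vanishes to second order (`X_secondOrder`).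
Finite dimensional weight spaces force high powers of `t_i - 1` to act by zero on each weight space
(`exists_pow_bound`). Modulo those, `b` is a sum of Euler eigenvectors of degree at least two, which
strictly raise the eigenvalue of the total Euler operator `etot`. Sums of eigenspaces along `c + ℕ`
are stable, so simplicity leaves only one eigenvalue and the raising operators vanish.

Thus `X (b ∂_α)` depends only on the first derivatives of `b` at the point. The operators attached
to the local coordinates, together with `-φ̂_∂`, satisfy the relations of the matrix units of
`𝔤𝔩(m+1, n)` (`G_G`), and simplicity and admissibility follow from the previous facts. Finally `ψ_{a
∂_α}` on `Ω` and the Shen-Larsson formula have the same evaluations and the same compatibility with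
`ψ_{∂_k}`, which makes them equal (`ψ_om`). -/

theorem tpow_zero : tpow n (0 : Fin m → ℤ) = 1 := rfl

theorem tpow_add (r s : Fin m → ℤ) : tpow n (r + s) = tpow n r * tpow n s := by
  simp [tpow, AddMonoidAlgebra.single_mul_single]

theorem tpow_neg_mul (r : Fin m → ℤ) : tpow n (-r) * tpow n r = 1 := by
  rw [← tpow_add, neg_add_cancel, tpow_zero]

theorem tpow_mul_neg (r : Fin m → ℤ) : tpow n r * tpow n (-r) = 1 := by
  rw [← tpow_add, add_neg_cancel, tpow_zero]

theorem tpow_comm (r : Fin m → ℤ) (a : SAlg m n) : tpow n r * a = a * tpow n r := by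
  induction a using AddMonoidAlgebra.induction_linear with
  | zero => simp
  | add x y hx hy => rw [mul_add, add_mul, hx, hy]
  | single s x => simp [tpow, AddMonoidAlgebra.single_mul_single, add_comm]

theorem zeta_mul_zeta (k l : Fin n) : zeta m k * zeta m l = -(zeta m l * zeta m k) := by
  have h := ExteriorAlgebra.ι_add_mul_swap (R := ℂ) (Pi.single k 1 : Fin n → ℂ) (Pi.single l 1)
  rw [eq_neg_iff_add_eq_zero]
  simp only [zeta, AddMonoidAlgebra.single_mul_single, ← AddMonoidAlgebra.single_add]
  rw [h, AddMonoidAlgebra.single_zero]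

theorem zeta_mul_self (k : Fin n) : zeta m k * zeta m k = 0 := by
  simp [zeta, AddMonoidAlgebra.single_mul_single]

theorem zetaI_empty : zetaI m (∅ : Finset (Fin n)) = 1 := by simp [zetaI]

theorem zetaI_insert {k : Fin n} {J : Finset (Fin n)} (h : ∀ j ∈ J, k < j) :
    zetaI m (insert k J) = zeta m k * zetaI m J := by
  rw [zetaI, Finset.sort_insert _ (fun j hj => (h j hj).le) (fun hk => lt_irrefl _ (h k hk))]
  simp [zetaI]

theorem zetaI_singleton (k : Fin n) : zetaI m {k} = zeta m k := by simp [zetaI]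

/-- Transposing two neighbours changes the sign, so only the multiset of factors matters for
membership in a span. -/
theorem list_prod_perm {l l' : List (Fin n)} (h : l.Perm l') :
    (l.map (zeta m)).prod = (l'.map (zeta m)).prod ∨
      (l.map (zeta m)).prod = -(l'.map (zeta m)).prod := by
  induction h with
  | nil => simp
  | cons x _ ih =>
    rcases ih with ih | ih
    · left; simp [ih]
    · right; simp [ih]
  | swap x y l =>
    right
    simp only [List.map_cons, List.prod_cons, ← mul_assoc]
    rw [zeta_mul_zeta, neg_mul]
  | trans _ _ ih₁ ih₂ =>
    rcases ih₁ with h1 | h1 <;> rcases ih₂ with h2 | h2 <;> simp [h1, h2]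

theorem list_prod_mem (l : List (Fin n)) :
    (l.map (zeta m)).prod ∈ Submodule.span ℂ (Set.range (zetaI m : Finset (Fin n) → SAlg m n)) := by
  by_cases hl : l.Nodup
  · have hp : l.Perm (l.toFinset.sort (fun i j => i ≤ j)) :=
      List.perm_of_nodup_nodup_toFinset_eq hl (Finset.sort_nodup _ _) (by simp)
    have hm : zetaI m l.toFinset ∈
        Submodule.span ℂ (Set.range (zetaI m : Finset (Fin n) → SAlg m n)) :=
      Submodule.subset_span ⟨_, rfl⟩
    rcases list_prod_perm (m := m) hp with h | h
    · rw [h]; exact hm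
    · rw [h]; exact neg_mem hm
  -- A repeated factor can be moved next to its copy at the cost of a sign, and then `ζ_x ζ_x = 0`.
  · obtain ⟨x, hx⟩ := List.exists_duplicate_iff_not_nodup.2 hl
    have hsub := List.duplicate_iff_sublist.1 hx
    obtain ⟨l', hl'⟩ := hsub.exists_perm_append
    have h0 : (([x, x] ++ l').map (zeta m)).prod = 0 := by
      simp [← mul_assoc, zeta_mul_self]
    rcases list_prod_perm (m := m) hl' with h | h <;> rw [h, h0]
    · exact zero_mem _
    · rw [neg_zero]; exact zero_mem _

theorem zeta_mul_zetaI_mem (k : Fin n) (J : Finset (Fin n)) :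
    zeta m k * zetaI m J ∈
      Submodule.span ℂ (Set.range (zetaI m : Finset (Fin n) → SAlg m n)) := by
  have := list_prod_mem (m := m) (k :: J.sort (fun i j => i ≤ j))
  simpa [zetaI] using this

/-- The inclusion of the Grassmann algebra as the coefficients of `t^0`. -/
def grassIncl : Grass n →ₗ[ℂ] SAlg m n where
  toFun x := AddMonoidAlgebra.single 0 x
  map_add' := AddMonoidAlgebra.single_add _
  map_smul' c x := by simp

theorem grassIncl_mem (x : Grass n) :
    (grassIncl x : SAlg m n) ∈
      Submodule.span ℂ (Set.range (zetaI m : Finset (Fin n) → SAlg m n)) := by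
  induction x using CliffordAlgebra.left_induction with
  | algebraMap r =>
    have : (grassIncl (algebraMap ℂ (Grass n) r) : SAlg m n) = r • zetaI m ∅ := by
      rw [zetaI_empty, Algebra.algebraMap_eq_smul_one, map_smul]; rfl
    rw [this]
    exact Submodule.smul_mem _ _ (Submodule.subset_span ⟨_, rfl⟩)
  | add x y hx hy => rw [map_add]; exact add_mem hx hy
  | ι_mul x v h =>
    have hv : (grassIncl (CliffordAlgebra.ι _ v * x) : SAlg m n) =
        ∑ k, v k • (zeta m k * grassIncl x) := by
      have : v = ∑ k, v k • (Pi.single k 1 : Fin n → ℂ) := by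
        ext j; simp [Finset.sum_apply, Pi.single_apply]
      conv_lhs => rw [this]
      rw [map_sum, Finset.sum_mul, map_sum]
      refine Finset.sum_congr rfl fun k _ => ?_
      rw [map_smul, smul_mul_assoc, map_smul]
      congr 1
      simp [grassIncl, zeta, AddMonoidAlgebra.single_mul_single, ExteriorAlgebra.ι]
    rw [hv]
    refine Submodule.sum_mem _ fun k _ => Submodule.smul_mem _ _ ?_
    generalize (grassIncl x : SAlg m n) = z at h ⊢
    induction h using Submodule.span_induction with
    | mem y hy => obtain ⟨J, rfl⟩ := hy; exact zeta_mul_zetaI_mem k J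
    | zero => rw [mul_zero]; exact zero_mem _
    | add y z _ _ hy hz => rw [mul_add]; exact add_mem hy hz
    | smul c y _ hy => rw [mul_smul_comm]; exact Submodule.smul_mem _ _ hy

/-- The monomials `t^r ζ_J` span `SAlg m n`. -/
theorem mem_of_monomials (W : Submodule ℂ (SAlg m n))
    (h : ∀ r J, tpow n r * zetaI m J ∈ W) (a : SAlg m n) : a ∈ W := by
  induction a using AddMonoidAlgebra.induction_linear with
  | zero => exact zero_mem _
  | add x y hx hy => exact add_mem hx hy
  | single r x =>
    have h1 : (AddMonoidAlgebra.single r x : SAlg m n) = tpow n r * grassIncl x := by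
      simp [tpow, grassIncl, AddMonoidAlgebra.single_mul_single]
    rw [h1]
    have h2 := grassIncl_mem (m := m) x
    generalize (grassIncl x : SAlg m n) = z at h2 ⊢
    induction h2 using Submodule.span_induction with
    | mem y hy => obtain ⟨J, rfl⟩ := hy; exact h r J
    | zero => rw [mul_zero]; exact zero_mem _
    | add y z _ _ hy hz => rw [mul_add]; exact add_mem hy hz
    | smul c y _ hy => rw [mul_smul_comm]; exact Submodule.smul_mem _ _ hy

theorem zetaI_mem_of_left_mul (W : Submodule ℂ (SAlg m n)) (h1 : (1 : SAlg m n) ∈ W)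
    (hz : ∀ k, ∀ a ∈ W, zeta m k * a ∈ W) (J : Finset (Fin n)) : zetaI m J ∈ W := by
  induction J using Finset.induction_on_min with
  | empty => rwa [zetaI_empty]
  | insert k J hk ih => rw [zetaI_insert hk]; exact hz _ _ ih

theorem tpow_mul_mem (W : Submodule ℂ (SAlg m n))
    (hp : ∀ i, ∀ a ∈ W, tpow n (Pi.single i 1) * a ∈ W)
    (hq : ∀ i, ∀ a ∈ W, tpow n (-Pi.single i 1) * a ∈ W) (r : Fin m → ℤ) :
    ∀ a ∈ W, tpow n r * a ∈ W := by
  have h1 : ∀ (i : Fin m) (c : ℕ), ∀ a ∈ W, tpow n (Pi.single i (c : ℤ)) * a ∈ W ∧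
      tpow n (-Pi.single i (c : ℤ)) * a ∈ W := by
    intro i c
    induction c with
    | zero => intro a ha; simpa [tpow_zero] using ha
    | succ c ih =>
      intro a ha
      have e : (Pi.single i ((c + 1 : ℕ) : ℤ) : Fin m → ℤ) = Pi.single i 1 + Pi.single i (c : ℤ) := by
        rw [← Pi.single_add]; push_cast; rw [add_comm]
      rw [e, neg_add, tpow_add, tpow_add, mul_assoc, mul_assoc]
      exact ⟨hp _ _ (ih a ha).1, hq _ _ (ih a ha).2⟩
  have h2 : ∀ (i : Fin m) (c : ℤ), ∀ a ∈ W, tpow n (Pi.single i c) * a ∈ W := by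
    intro i c a ha
    obtain ⟨c, rfl | rfl⟩ := c.eq_nat_or_neg
    · exact (h1 i c a ha).1
    · rw [Pi.single_neg]; exact (h1 i c a ha).2
  have h3 : ∀ s : Finset (Fin m), ∀ a ∈ W, tpow n (∑ i ∈ s, Pi.single i (r i)) * a ∈ W := by
    intro s
    induction s using Finset.induction_on with
    | empty => intro a ha; simpa [tpow_zero] using ha
    | insert i s hi ih =>
      intro a ha
      rw [Finset.sum_insert hi, tpow_add, mul_assoc]
      exact h2 _ _ _ (ih a ha)
  have := h3 Finset.univ
  rwa [Finset.univ_sum_single] at this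

/-- A subspace which contains `1` and is stable under multiplication by the generators is
everything. -/
theorem mem_of_generators (W : Submodule ℂ (SAlg m n)) (h1 : (1 : SAlg m n) ∈ W)
    (hz : ∀ k, ∀ a ∈ W, zeta m k * a ∈ W)
    (hp : ∀ i, ∀ a ∈ W, tpow n (Pi.single i 1) * a ∈ W)
    (hq : ∀ i, ∀ a ∈ W, tpow n (-Pi.single i 1) * a ∈ W) (a : SAlg m n) : a ∈ W :=
  mem_of_monomials W (fun r J => tpow_mul_mem W hp hq r _ (zetaI_mem_of_left_mul W h1 hz J)) a

/-! ### The augmentation -/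

/-- The augmentation `t_i ↦ 1`, `ζ_k ↦ 0`. -/
def aug : SAlg m n →ₗ[ℂ] ℂ :=
  (Finsupp.lsum ℂ fun _ : Fin m → ℤ => (ExteriorAlgebra.algebraMapInv :
    Grass n →ₐ[ℂ] ℂ).toLinearMap) ∘ₗ (AddMonoidAlgebra.coeffLinearEquiv ℂ).toLinearMap

theorem aug_single (r : Fin m → ℤ) (x : Grass n) :
    aug (AddMonoidAlgebra.single r x) = ExteriorAlgebra.algebraMapInv x := by
  simp [aug]

theorem aug_mul (a b : SAlg m n) : aug (a * b) = aug a * aug b := by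
  induction a using AddMonoidAlgebra.induction_linear with
  | zero => simp
  | add x y hx hy => rw [add_mul, map_add, hx, hy, map_add, add_mul]
  | single r x =>
    induction b using AddMonoidAlgebra.induction_linear with
    | zero => simp
    | add x y hx hy => rw [mul_add, map_add, hx, hy, map_add, mul_add]
    | single s y => rw [AddMonoidAlgebra.single_mul_single, aug_single, aug_single, aug_single, map_mul]

@[simp] theorem aug_tpow (r : Fin m → ℤ) : aug (tpow n r) = 1 := by
  rw [tpow, aug_single, map_one]

@[simp] theorem aug_one : aug (1 : SAlg m n) = 1 := aug_tpow 0

@[simp] theorem aug_zeta (k : Fin n) : aug (zeta m k) = 0 := by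
  rw [zeta, aug_single]
  simp [ExteriorAlgebra.algebraMapInv]

theorem aug_zetaI {J : Finset (Fin n)} (hJ : J ≠ ∅) : aug (zetaI m J) = 0 := by
  induction J using Finset.induction_on_min with
  | empty => exact absurd rfl hJ
  | insert k J hk _ => rw [zetaI_insert hk, aug_mul, aug_zeta, zero_mul]

theorem parityAut_tpow (r : Fin m → ℤ) : parityAut m n (tpow n r) = tpow n r := by
  simp [tpow]

theorem parityAut_zeta (k : Fin n) : parityAut m n (zeta m k) = -zeta m k := by
  simp [zeta, ExteriorAlgebra.ι, AddMonoidAlgebra.single_neg]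

theorem aug_parityAut (a : SAlg m n) : aug (parityAut m n a) = aug a := by
  have : ∀ a, a ∈ LinearMap.ker (aug ∘ₗ (parityAut m n).toLinearMap - aug) := by
    refine mem_of_generators _ ?_ ?_ ?_ ?_
    · simp
    · intro k a _
      simp [aug_mul, parityAut_zeta]
    · intro i a ha
      simpa [aug_mul, parityAut_tpow] using ha
    · intro i a ha
      simpa [aug_mul, parityAut_tpow] using ha
  have h := this a
  simpa [sub_eq_zero] using h

theorem tpow_mem_par (r : Fin m → ℤ) : tpow n r ∈ par m n 0 := by
  rw [mem_par, parityAut_tpow]; simp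

theorem zeta_mem_par (k : Fin n) : zeta m k ∈ par m n 1 := by
  rw [mem_par, parityAut_zeta]; simp

theorem par_induction {P : SAlg m n → Prop} (hadd : ∀ a b, P a → P b → P (a + b))
    (h : ∀ p, ∀ a ∈ par m n p, P a) (a : SAlg m n) : P a := by
  obtain ⟨a₀, ha₀, a₁, ha₁, rfl⟩ := Submodule.mem_sup.1
    (show a ∈ par m n 0 ⊔ par m n 1 by rw [sup_eq_top]; trivial)
  exact hadd _ _ (h 0 _ ha₀) (h 1 _ ha₁)

/-! ### Twists and the derivations `∂_α` -/

theorem twist_zero : (twist 0 : Module.End ℂ (SAlg m n)) = 1 := by simp [twist]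

theorem twist_one : (twist 1 : Module.End ℂ (SAlg m n)) = (parityAut m n).toLinearMap := by
  simp [twist, ZMod.val_one]

theorem twist_of_mem {p q : ZMod 2} {a : SAlg m n} (ha : a ∈ par m n q) :
    twist p a = sgn p q • a := by
  rcases zmod_two_cases p with rfl | rfl
  · simp [twist_zero]
  · rw [twist_one]; exact mem_par.1 ha

theorem aug_twist (p : ZMod 2) (a : SAlg m n) : aug (twist p a) = aug a := by
  rcases zmod_two_cases p with rfl | rfl
  · simp [twist_zero]
  · rw [twist_one]; exact aug_parityAut a

/-- The superderivation `∂_α` of `SAlg m n`; it is zero for `α = 0`. -/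
def dop (α : Idx m n) : Module.End ℂ (SAlg m n) := (del α).1.2

theorem dop_mem (α : Idx m n) : dop α ∈ superDer (par m n) (idxPar α) := by
  rcases α with α | k
  · refine Fin.cases ?_ (fun i => ?_) α
    · exact zero_mem _
    · exact dt_mem i
  · exact dz_mem k

theorem dop_zero : (dop (Sum.inl 0) : Module.End ℂ (SAlg m n)) = 0 := rfl

theorem dop_succ (i : Fin m) : (dop (Sum.inl i.succ) : Module.End ℂ (SAlg m n)) = dt n i := rfl

theorem dop_inr (k : Fin n) : (dop (Sum.inr k) : Module.End ℂ (SAlg m n)) = dz m k := rfl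

theorem dop_mem_par (α : Idx m n) {q : ZMod 2} {a : SAlg m n} (ha : a ∈ par m n q) :
    dop α a ∈ par m n (idxPar α + q) := (dop_mem α).1 q a ha

theorem dop_mul_of_mem (α : Idx m n) {q : ZMod 2} {a : SAlg m n} (ha : a ∈ par m n q)
    (b : SAlg m n) : dop α (a * b) = dop α a * b + sgn (idxPar α) q • (a * dop α b) :=
  (dop_mem α).2 q a ha b

theorem dop_mul (α : Idx m n) (a b : SAlg m n) :
    dop α (a * b) = dop α a * b + twist (idxPar α) a * dop α b := by
  induction a using par_induction with
  | hadd x y hx hy =>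
    rw [add_mul, map_add, hx, hy, map_add, map_add, add_mul, add_mul]; abel
  | h p a ha => rw [dop_mul_of_mem α ha, twist_of_mem ha, smul_mul_assoc]

theorem dop_one (α : Idx m n) : dop α (1 : SAlg m n) = 0 := by
  have h := dop_mul_of_mem α (isSupercommutative_par (m := m) (n := n)).one_mem 1
  simpa using h

theorem dop_succ_tpow (i : Fin m) (r : Fin m → ℤ) :
    dop (Sum.inl i.succ) (tpow n r) = (r i : ℂ) • tpow n r := by
  rw [dop_succ]; simp [dt, tpow]

theorem dop_inr_tpow (k : Fin n) (r : Fin m → ℤ) : dop (Sum.inr k) (tpow n r) = 0 := by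
  rw [dop_inr]; simp [dz, tpow, grassD]

theorem dop_inl_zeta (i : Fin (m + 1)) (k : Fin n) : dop (Sum.inl i) (zeta m k) = 0 := by
  refine Fin.cases ?_ (fun i => ?_) i
  · rw [dop_zero]; rfl
  · rw [dop_succ]; simp [dt, zeta]

theorem dop_inr_zeta (k l : Fin n) :
    dop (Sum.inr k) (zeta m l) = if k = l then 1 else 0 := by
  rw [dop_inr]
  simp only [dz, zeta, coeffMap_single, grassD]
  rw [ExteriorAlgebra.ι, CliffordAlgebra.contractLeft_ι]
  by_cases h : k = l
  · subst h; simp; rfl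
  · simp [h]

theorem parityAut_dop_inl (i : Fin (m + 1)) (a : SAlg m n) :
    parityAut m n (dop (Sum.inl i) a) = dop (Sum.inl i) (parityAut m n a) := by
  refine Fin.cases ?_ (fun i => ?_) i
  · rw [dop_zero]; simp
  · rw [dop_succ]; exact parityAut_dt i a

theorem dop_comm (α β : Idx m n) (a : SAlg m n) :
    dop α (dop β a) = sgn (idxPar α) (idxPar β) • dop β (dop α a) := by
  rcases α with α | k <;> rcases β with β | l
  · refine Fin.cases ?_ (fun i => ?_) α
    · simp [dop_zero]
    · refine Fin.cases ?_ (fun j => ?_) β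
      · simp [dop_zero]
      · induction a using AddMonoidAlgebra.induction_linear with
        | zero => simp
        | add x y hx hy => simp only [map_add, hx, hy, smul_add]
        | single r x => simp [dop_succ, dt, idxPar, smul_smul, mul_comm]
  · refine Fin.cases ?_ (fun i => ?_) α
    · simp [dop_zero]
    · induction a using AddMonoidAlgebra.induction_linear with
      | zero => simp
      | add x y hx hy => simp only [map_add, hx, hy, smul_add]
      | single r x => simp [dop_succ, dop_inr, dt, dz, idxPar]
  · refine Fin.cases ?_ (fun i => ?_) β
    · simp [dop_zero]
    · induction a using AddMonoidAlgebra.induction_linear with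
      | zero => simp
      | add x y hx hy => simp only [map_add, hx, hy, smul_add]
      | single r x => simp [dop_succ, dop_inr, dt, dz, idxPar]
  · induction a using AddMonoidAlgebra.induction_linear with
    | zero => simp
    | add x y hx hy => simp only [map_add, hx, hy, smul_add]
    | single r x =>
      simp only [dop_inr, dz, coeffMap_single, idxPar, Sum.elim_inr, sgn_one_one, grassD]
      rw [CliffordAlgebra.contractLeft_comm]
      simp [AddMonoidAlgebra.single_neg]

/-! ### The elements `a ∂_α` of `𝔤` -/

/-- The component of `∂_α` in `A`; it is `1` for `α = 0` and `0` otherwise. -/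
def delA (α : Idx m n) : SAlg m n := (del α).1.1

theorem delA_zero : delA (Sum.inl 0 : Idx m n) = 1 := rfl

theorem delA_succ (i : Fin m) : delA (Sum.inl i.succ : Idx m n) = 0 := rfl

theorem delA_inr (k : Fin n) : delA (Sum.inr k : Idx m n) = 0 := rfl

theorem delA_of_ne {α : Idx m n} (h : α ≠ Sum.inl 0) : delA α = 0 := by
  rcases α with α | k
  · revert h
    refine Fin.cases (fun h => absurd rfl h) (fun i _ => rfl) α
  · rfl

theorem dop_mul_delA (α β : Idx m n) (b : SAlg m n) :
    dop α (b * delA β) = dop α b * delA β := by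
  by_cases h : β = Sum.inl 0
  · subst h; simp [delA_zero]
  · simp [delA_of_ne h]

/-- The element `a ∂_α` of `𝔤`, as a linear function of `a`. -/
def dd (α : Idx m n) : SAlg m n →ₗ[ℂ] QPg m n where
  toFun a := lmul a (del α)
  map_add' a b := by
    refine Subtype.ext (Prod.ext (add_mul _ _ _) (LinearMap.ext fun c => ?_))
    exact add_mul _ _ _
  map_smul' c a := by
    refine Subtype.ext (Prod.ext (smul_mul_assoc _ _ _) (LinearMap.ext fun d => ?_))
    exact smul_mul_assoc _ _ _

theorem lmul_del (a : SAlg m n) (α : Idx m n) : lmul a (del α) = dd α a := rfl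

theorem dd_one (α : Idx m n) : dd α (1 : SAlg m n) = del α := by
  refine Subtype.ext (Prod.ext (one_mul _) (LinearMap.ext fun c => one_mul _))

theorem qact_dd (α : Idx m n) (a c : SAlg m n) : qact (par m n) (dd α a) c = a * dop α c := rfl

theorem proj_dd (α : Idx m n) (a : SAlg m n) : proj (par m n) (dd α a) = a * delA α := rfl

theorem del_mem (α : Idx m n) : (del α : QPg m n).1 ∈ qpHom (par m n) (idxPar α) := by
  refine ⟨?_, dop_mem α⟩
  rcases α with α | k
  · refine Fin.cases ?_ (fun i => zero_mem _) α
    exact isSupercommutative_par.one_mem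
  · exact zero_mem _

theorem dd_mem {p : ZMod 2} {a : SAlg m n} (α : Idx m n) (ha : a ∈ par m n p) :
    (dd α a).1 ∈ qpHom (par m n) (p + idxPar α) :=
  smul_mem_qpHom ha (del_mem α)

theorem par_comm {p q : ZMod 2} {a b : SAlg m n} (ha : a ∈ par m n p) (hb : b ∈ par m n q) :
    a * b = sgn p q • (b * a) := isSupercommutative_par.mul_comm ha hb

/-- The second order terms `a b ∂_α ∂_β` cancel because both the coefficients and the coordinate
derivations supercommute. -/
theorem bracket_dd {p q : ZMod 2} {a b : SAlg m n} (α β : Idx m n) (ha : a ∈ par m n p)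
    (hb : b ∈ par m n q) :
    (bracket (par m n) (dd_mem α ha) (dd_mem β hb) : QPg m n) =
      dd β (a * dop α b) + dd α (-(sgn (p + idxPar α) (q + idxPar β) • (b * dop β a))) := by
  refine Subtype.ext (Prod.ext ?_ (LinearMap.ext fun c => ?_))
  · change a * dop α (b * delA β) - sgn (p + idxPar α) (q + idxPar β) • (b * dop β (a * delA α)) =
      a * dop α b * delA β + -(sgn (p + idxPar α) (q + idxPar β) • (b * dop β a)) * delA α
    rw [dop_mul_delA, dop_mul_delA, mul_assoc, neg_mul, smul_mul_assoc, mul_assoc, sub_eq_add_neg]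
  · change a * dop α (b * dop β c) - sgn (p + idxPar α) (q + idxPar β) • (b * dop β (a * dop α c)) =
      a * dop α b * dop β c + -(sgn (p + idxPar α) (q + idxPar β) • (b * dop β a)) * dop α c
    rw [dop_mul_of_mem α hb, dop_mul_of_mem β ha, dop_comm α β c]
    simp only [mul_add, smul_add, mul_smul_comm, smul_smul, ← mul_assoc, neg_mul, smul_mul_assoc]
    rw [par_comm ha hb, smul_mul_assoc, smul_smul, sgn_add_left, sgn_add_right, sgn_add_right]
    have e : sgn p q * sgn p (idxPar β) * (sgn (idxPar α) q * sgn (idxPar α) (idxPar β)) *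
        sgn (idxPar β) p = sgn (idxPar α) q * sgn (idxPar α) (idxPar β) * sgn p q := by
      rw [sgn_comm (idxPar β) p]
      linear_combination (sgn p q * (sgn (idxPar α) q * sgn (idxPar α) (idxPar β))) *
        sgn_mul_self p (idxPar β)
    rw [e]
    abel

/-- The value on `t_i⁻¹` is forced by the Leibniz rule for `t_i t_i⁻¹ = 1`; the kernel is then
stable under multiplication by all generators. -/
theorem dop_eq_zero_of_generators {p : ZMod 2} {D : Module.End ℂ (SAlg m n)}
    (hD : D ∈ superDer (par m n) p) (ht : ∀ i, D (tpow n (Pi.single i 1)) = 0)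
    (hz : ∀ k, D (zeta m k) = 0) : D = 0 := by
  have h1 : D 1 = 0 := by
    have h := hD.2 0 1 isSupercommutative_par.one_mem 1
    simpa using h
  have ht' : ∀ i, D (tpow n (-Pi.single i 1)) = 0 := by
    intro i
    have h := hD.2 0 _ (tpow_mem_par (Pi.single i 1)) (tpow n (-Pi.single i 1))
    rw [tpow_mul_neg, h1, ht, zero_mul, zero_add, sgn_zero_right, one_smul] at h
    have h2 := congrArg (fun x => tpow n (-Pi.single i 1) * x) h.symm
    simpa [← mul_assoc, tpow_neg_mul] using h2
  refine LinearMap.ext fun a => ?_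
  have : a ∈ LinearMap.ker D := by
    refine mem_of_generators _ ?_ ?_ ?_ ?_ a
    · exact h1
    · intro k a ha
      rw [LinearMap.mem_ker] at *
      rw [hD.2 1 _ (zeta_mem_par k), hz, ha]; simp
    · intro i a ha
      rw [LinearMap.mem_ker] at *
      rw [hD.2 0 _ (tpow_mem_par _), ht, ha]; simp
    · intro i a ha
      rw [LinearMap.mem_ker] at *
      rw [hD.2 0 _ (tpow_mem_par _), ht', ha]; simp
  exact this

theorem sum_idx {V : Type*} [AddCommMonoid V] (f : Idx m n → V) :
    ∑ α, f α = f (Sum.inl 0) + ∑ i : Fin m, f (Sum.inl i.succ) + ∑ k, f (Sum.inr k) := by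
  rw [Fintype.sum_sum_type, Fin.sum_univ_succ]

theorem coord_zero (x : QPg m n) : coord (Sum.inl 0) x = x.1.1 := rfl

theorem coord_succ (i : Fin m) (x : QPg m n) : coord (Sum.inl i.succ) x =
    x.1.2 (tpow n (Pi.single i 1)) * tpow n (-Pi.single i 1) := rfl

theorem coord_inr (k : Fin n) (x : QPg m n) : coord (Sum.inr k) x = x.1.2 (zeta m k) := rfl

theorem sum_dd_coord_snd_tpow (x : QPg m n) (i : Fin m) :
    (∑ α, dd α (coord α x) : QPg m n).1.2 (tpow n (Pi.single i 1)) =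
      x.1.2 (tpow n (Pi.single i 1)) := by
  have e : ∀ s : Finset (Idx m n), ∀ c, (∑ α ∈ s, dd α (coord α x) : QPg m n).1.2 c =
      ∑ α ∈ s, coord α x * dop α c := by
    intro s c
    induction s using Finset.induction_on with
    | empty => simp
    | insert a s ha ih => rw [Finset.sum_insert ha, Finset.sum_insert ha, ← ih]; rfl
  rw [e, sum_idx]
  simp only [dop_zero, dop_succ_tpow, dop_inr_tpow, coord_succ, Pi.single_apply]
  simp [mul_assoc, tpow_neg_mul]

theorem sum_dd_coord_snd_zeta (x : QPg m n) (k : Fin n) :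
    (∑ α, dd α (coord α x) : QPg m n).1.2 (zeta m k) = x.1.2 (zeta m k) := by
  have e : ∀ s : Finset (Idx m n), ∀ c, (∑ α ∈ s, dd α (coord α x) : QPg m n).1.2 c =
      ∑ α ∈ s, coord α x * dop α c := by
    intro s c
    induction s using Finset.induction_on with
    | empty => simp
    | insert a s ha ih => rw [Finset.sum_insert ha, Finset.sum_insert ha, ← ih]; rfl
  rw [e, sum_idx]
  simp [dop_inl_zeta, dop_inr_zeta, coord_inr]

theorem sum_dd_coord_fst (x : QPg m n) : (∑ α, dd α (coord α x) : QPg m n).1.1 = x.1.1 := by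
  have e : ∀ s : Finset (Idx m n), (∑ α ∈ s, dd α (coord α x) : QPg m n).1.1 =
      ∑ α ∈ s, coord α x * delA α := by
    intro s
    induction s using Finset.induction_on with
    | empty => simp
    | insert a s ha ih => rw [Finset.sum_insert ha, Finset.sum_insert ha, ← ih]; rfl
  rw [e, sum_idx]
  simp [delA_succ, delA_inr, delA_zero, coord_zero]

theorem coord_mem {p : ZMod 2} {x : QPg m n} (hx : x.1 ∈ qpHom (par m n) p) (α : Idx m n) :
    coord α x ∈ par m n (p + idxPar α) := by
  rcases α with α | k
  · refine Fin.cases ?_ (fun i => ?_) α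
    · rw [coord_zero]; simpa [idxPar] using hx.1
    · rw [coord_succ]
      have h := isSupercommutative_par.mul_mem (hx.2.1 0 _ (tpow_mem_par (Pi.single i 1)))
        (tpow_mem_par (-Pi.single i 1))
      simpa [idxPar] using h
  · rw [coord_inr]
    exact hx.2.1 1 _ (zeta_mem_par k)

/-- Every element of `𝔤` is the sum of the elements `a ∂_α` given by its coordinates. -/
theorem sum_dd_coord (x : QPg m n) : ∑ α, dd α (coord α x) = x := by
  have key : ∀ p, ∀ x : QPg m n, x.1 ∈ qpHom (par m n) p → ∑ α, dd α (coord α x) = x := by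
    intro p x hx
    have hs : (∑ α, dd α (coord α x) : QPg m n).1 ∈ qpHom (par m n) p := by
      rw [Submodule.coe_sum]
      refine Submodule.sum_mem _ fun α _ => ?_
      have h := dd_mem α (coord_mem hx α)
      have e : p + idxPar α + idxPar α = p := by
        rw [add_assoc, CharTwo.add_self_eq_zero, add_zero]
      rwa [e] at h
    -- Both derivations are homogeneous of parity `p`, so their difference is a superderivation, and
    -- it kills the generators.
    have h0 := dop_eq_zero_of_generators (sub_mem hs.2 hx.2)
      (fun i => sub_eq_zero.2 (sum_dd_coord_snd_tpow x i))
      (fun k => sub_eq_zero.2 (sum_dd_coord_snd_zeta x k))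
    exact Subtype.ext (Prod.ext (sum_dd_coord_fst x) (sub_eq_zero.1 h0))
  obtain ⟨y, hy, z, hz, h⟩ := Submodule.mem_sup.1 x.2
  have hx : x = ⟨y, qpHom_le _ _ hy⟩ + ⟨z, qpHom_le _ _ hz⟩ := Subtype.ext h.symm
  rw [hx]
  simp only [map_add, Finset.sum_add_distrib]
  rw [key 0 _ hy, key 1 _ hz]

theorem torus_inl (i : Fin (m + 1)) : (torus (Sum.inl i) : QPg m n) = dd (Sum.inl i) 1 :=
  (dd_one (Sum.inl i)).symm

theorem torus_inr (k : Fin n) : (torus (Sum.inr k) : QPg m n) = dd (Sum.inr k) (zeta m k) := rfl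

/-! ### The defining relations of quasi-Poisson modules on the elements `a ∂_α` -/

section Relations

variable {M : Type*} [AddCommGroup M] [Module ℂ M] {𝓜 : ZMod 2 → Submodule ℂ M}
  {S : QPData (par m n) M}

theorem IsQPModule.φ_mul (_ : IsQPModule 𝓜 S) (a b : SAlg m n) (v : M) :
    S.φ (a * b) v = S.φ a (S.φ b v) := by rw [map_mul]; rfl

theorem IsQPModule.φ_one (_ : IsQPModule 𝓜 S) (v : M) : S.φ 1 v = v := by rw [map_one]; rfl

theorem IsQPModule.φ_tpow_neg (h : IsQPModule 𝓜 S) (r : Fin m → ℤ) (v : M) :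
    S.φ (tpow n (-r)) (S.φ (tpow n r) v) = v := by
  rw [← h.φ_mul, tpow_neg_mul, h.φ_one]

theorem IsQPModule.φ_tpow_neg' (h : IsQPModule 𝓜 S) (r : Fin m → ℤ) (v : M) :
    S.φ (tpow n r) (S.φ (tpow n (-r)) v) = v := by
  rw [← h.φ_mul, tpow_mul_neg, h.φ_one]

theorem IsQPModule.ψ_φ_apply (h : IsQPModule 𝓜 S) {p q : ZMod 2} {a b : SAlg m n} (α : Idx m n)
    (ha : a ∈ par m n p) (hb : b ∈ par m n q) (v : M) :
    S.ψ (dd α a) (S.φ b v) = S.φ (a * dop α b) v +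
      sgn (p + idxPar α) q • S.φ b (S.ψ (dd α a) v) := by
  have h1 := congrArg (fun T => T v) (h.ψ_φ _ _ _ (dd_mem α ha) _ hb)
  simp only [scomm, LinearMap.sub_apply, Module.End.mul_apply, LinearMap.smul_apply, qact_dd] at h1
  rw [← h1]; abel

theorem IsQPModule.ψ_del_φ (h : IsQPModule 𝓜 S) (α : Idx m n) (b : SAlg m n) (v : M) :
    S.ψ (del α) (S.φ b v) = S.φ (dop α b) v + S.φ (twist (idxPar α) b) (S.ψ (del α) v) := by
  induction b using par_induction with
  | hadd x y hx hy => simp only [map_add, LinearMap.add_apply, hx, hy]; abel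
  | h p a ha =>
    rw [← dd_one, h.ψ_φ_apply α isSupercommutative_par.one_mem ha, twist_of_mem ha]
    simp

theorem IsQPModule.φhat_dd (h : IsQPModule 𝓜 S) (α : Idx m n) (a : SAlg m n) (v : M) :
    S.φhat (dd α a) v = S.φ a (S.φhat (del α) v) := by
  rw [← lmul_del, h.φhat_lmul]; rfl

theorem IsQPModule.φhat_del_φ (h : IsQPModule 𝓜 S) (α : Idx m n) (b : SAlg m n) (v : M) :
    S.φhat (del α) (S.φ b v) = S.φ (twist (idxPar α) b) (S.φhat (del α) v) := by
  induction b using par_induction with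
  | hadd x y hx hy => simp only [map_add, LinearMap.add_apply, hx, hy]
  | h p a ha =>
    have h1 := congrArg (fun T => T v) (h.φhat_φ _ _ _ (del_mem α) _ ha)
    simp only [scomm, LinearMap.sub_apply, Module.End.mul_apply, LinearMap.smul_apply,
      LinearMap.zero_apply, sub_eq_zero] at h1
    rw [h1, twist_of_mem ha, map_smul]; rfl

theorem IsQPModule.ψ_ψ (h : IsQPModule 𝓜 S) {p q : ZMod 2} {a b : SAlg m n} (α β : Idx m n)
    (ha : a ∈ par m n p) (hb : b ∈ par m n q) (v : M) :
    S.ψ (dd α a) (S.ψ (dd β b) v) =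
      sgn (p + idxPar α) (q + idxPar β) • S.ψ (dd β b) (S.ψ (dd α a) v) +
      (S.ψ (dd β (a * dop α b)) v -
        sgn (p + idxPar α) (q + idxPar β) • S.ψ (dd α (b * dop β a)) v) := by
  have h1 := congrArg (fun T => T v) (h.ψ_bracket _ _ _ _ (dd_mem α ha) (dd_mem β hb))
  rw [bracket_dd α β ha hb, map_add, map_neg, map_neg, map_smul, map_smul] at h1
  simp only [scomm, LinearMap.sub_apply, Module.End.mul_apply, LinearMap.smul_apply,
    LinearMap.add_apply, LinearMap.neg_apply] at h1
  rw [sub_eq_iff_eq_add] at h1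
  rw [h1]; abel

theorem IsQPModule.ψ_del_ψ (h : IsQPModule 𝓜 S) {q : ZMod 2} {b : SAlg m n} (α β : Idx m n)
    (hb : b ∈ par m n q) (v : M) :
    S.ψ (del α) (S.ψ (dd β b) v) =
      sgn (idxPar α) (q + idxPar β) • S.ψ (dd β b) (S.ψ (del α) v) + S.ψ (dd β (dop α b)) v := by
  rw [← dd_one, h.ψ_ψ α β isSupercommutative_par.one_mem hb]
  simp [dop_one]

theorem IsQPModule.φhat_φhat_del (h : IsQPModule 𝓜 S) (α β : Idx m n) (v : M) :
    S.φhat (del α) (S.φhat (del β) v) =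
      sgn (idxPar α) (idxPar β) • S.φhat (del β) (S.φhat (del α) v) +
      (S.φ (delA β) (S.φhat (del α) v) - S.φ (delA α) (S.φhat (del β) v)) := by
  have h1 := congrArg (fun T => T v) (h.φhat_φhat _ _ _ _ (del_mem α) (del_mem β))
  -- The sign may be dropped: `delA β` is nonzero only for the even index `0`.
  have e : sgn (idxPar α) (idxPar β) • S.φ (delA β) (S.φhat (del α) v) =
      S.φ (delA β) (S.φhat (del α) v) := by
    by_cases hβ : β = Sum.inl 0
    · subst hβ; simp [idxPar]
    · simp [delA_of_ne hβ]
  simp only [scomm, LinearMap.sub_apply, Module.End.mul_apply, LinearMap.smul_apply, rmul,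
    map_smul, h.φhat_lmul] at h1
  have h2 := sub_eq_iff_eq_add.1 (h1.trans (congrArg₂ (· - ·) e rfl))
  rw [h2, add_comm]; rfl

theorem IsQPModule.φhat_del_ψ (h : IsQPModule 𝓜 S) {q : ZMod 2} {b : SAlg m n} (α β : Idx m n)
    (hb : b ∈ par m n q) (v : M) :
    S.φhat (del α) (S.ψ (dd β b) v) =
      sgn (idxPar α) (q + idxPar β) • S.ψ (dd β b) (S.φhat (del α) v) +
      (S.φ (dop α b) (S.φhat (del β) v) +
        sgn (idxPar α) q • (S.ψ (dd α (b * delA β)) v - S.φ (b * delA β) (S.ψ (del α) v))) := by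
  have h1 := congrArg (fun T => T v) (h.φhat_ψ _ _ _ _ (del_mem α) (dd_mem β hb))
  have e0 : bracket (par m n) (del_mem α) (dd_mem β hb) = dd β (dop α b) := by
    have h2 := bracket_dd α β (isSupercommutative_par (m := m) (n := n)).one_mem hb
    rw [dop_one, mul_zero, smul_zero, neg_zero, map_zero, add_zero, one_mul] at h2
    rw [← h2]
    apply Subtype.ext
    simp only [bracket, dd_one, zero_add]
  -- The factor `delA β` vanishes unless `β` is the even index `0`, so the parity of `β` does not
  -- contribute to the sign.
  have e : ∀ w : SAlg m n → M, w 0 = 0 →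
      sgn (idxPar α) (q + idxPar β) • w (b * delA β) = sgn (idxPar α) q • w (b * delA β) := by
    intro w hw
    by_cases hβ : β = Sum.inl 0
    · subst hβ; simp [idxPar]
    · simp [delA_of_ne hβ, hw]
  simp only [scomm, LinearMap.sub_apply, LinearMap.add_apply, Module.End.mul_apply,
    LinearMap.smul_apply, rmul, map_smul, e0, proj_dd, lmul_del, h.φhat_dd] at h1
  rw [e (fun x => S.ψ (dd α x) v) (by simp), e (fun x => S.φ x (S.ψ (del α) v)) (by simp)] at h1
  rw [sub_eq_iff_eq_add] at h1
  rw [h1, smul_sub]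
  abel

end Relations

/-! ### Weight spaces of families of operators -/

section WeightSpaces

variable {κ V : Type*} [AddCommGroup V] [Module ℂ V]

theorem mem_weightSpace {T : κ → Module.End ℂ V} {l : κ → ℂ} {v : V} :
    v ∈ weightSpace T l ↔ ∀ k, T k v = l k • v := by
  simp [weightSpace]

variable {ι : Type*} {T : κ → Module.End ℂ V} {l : ι → κ → ℂ}

/-- Applying `T k - l j k` to the sum removes the `j`-th term and rescales the others. For each
remaining `i` a `k` is chosen for which its own factor is nonzero. -/
theorem mem_of_sum_mem (hl : Function.Injective l) {W : Submodule ℂ V}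
    (hW : ∀ k, ∀ v ∈ W, T k v ∈ W) (s : Finset ι) :
    ∀ v : ι → V, (∀ i ∈ s, v i ∈ weightSpace T (l i)) → ∑ i ∈ s, v i ∈ W → ∀ i ∈ s, v i ∈ W := by
  classical
  induction s using Finset.induction_on with
  | empty => simp
  | insert j s hj ih =>
    intro v hv hs
    have h1 : ∀ i ∈ s, v i ∈ W := by
      intro i hi
      have hne : l i ≠ l j := fun h => hj (hl h ▸ hi)
      obtain ⟨k, hk⟩ := Function.ne_iff.1 hne
      have h2 := ih (fun i => (l i k - l j k) • v i)
        (fun i hi => Submodule.smul_mem _ _ (hv i (Finset.mem_insert_of_mem hi))) (by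
          have h3 := sub_mem (hW k _ hs) (W.smul_mem (l j k) hs)
          rw [map_sum, Finset.smul_sum, ← Finset.sum_sub_distrib, Finset.sum_insert hj,
            mem_weightSpace.1 (hv j (Finset.mem_insert_self _ _)) k, sub_self, zero_add] at h3
          refine (congrArg (· ∈ W) (Finset.sum_congr rfl fun i hi => ?_)).mp h3
          rw [mem_weightSpace.1 (hv i (Finset.mem_insert_of_mem hi)) k, sub_smul]) i hi
      exact (Submodule.smul_mem_iff _ (sub_ne_zero.2 hk)).1 h2
    intro i hi
    rcases Finset.mem_insert.1 hi with rfl | hi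
    · rw [Finset.sum_insert hj] at hs
      have := sub_mem hs (Submodule.sum_mem _ h1)
      rwa [add_sub_cancel_right] at this
    · exact h1 i hi

theorem inf_iSup_weight_le (hl : Function.Injective l) {W : Submodule ℂ V}
    (hW : ∀ k, ∀ v ∈ W, T k v ∈ W) {P : ι → Submodule ℂ V} (hP : ∀ i, P i ≤ weightSpace T (l i)) :
    W ⊓ ⨆ i, P i ≤ ⨆ i, W ⊓ P i := by
  rintro v ⟨hv, hv'⟩
  obtain ⟨f, hf, rfl⟩ := (Submodule.mem_iSup_iff_exists_finsupp _ _).1 hv'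
  have h := mem_of_sum_mem hl hW f.support f (fun i _ => hP i (hf i)) hv
  exact Submodule.sum_mem _ fun i hi => Submodule.mem_iSup_of_mem i ⟨h i hi, hf i⟩

theorem mem_of_mem_iSup_weight (hl : Function.Injective l) {P : ι → Submodule ℂ V}
    (hP : ∀ i, P i ≤ weightSpace T (l i)) {j : ι} {v : V} (hv : v ∈ weightSpace T (l j))
    (hv' : v ∈ ⨆ i, P i) : v ∈ P j := by
  classical
  obtain ⟨f, hf, hs⟩ := (Submodule.mem_iSup_iff_exists_finsupp _ _).1 hv'
  -- With `W = ⊥` the lemma says that weight vectors of distinct weights are independent; it is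
  -- applied to the vanishing sum `∑ f i - v`.
  have h := mem_of_sum_mem (T := T) (W := ⊥) hl (fun k v hv => by simp_all)
    (insert j f.support) (fun i => f i - if i = j then v else 0) (by
      intro i _
      refine sub_mem (hP i (hf i)) ?_
      split_ifs with h
      · rwa [h]
      · exact zero_mem _) (by
      rw [Finset.sum_sub_distrib, Finset.sum_ite_eq' (insert j f.support) j (fun _ => v),
        if_pos (Finset.mem_insert_self _ _)]
      have : ∑ x ∈ insert j f.support, f x = v := by
        rw [← hs, Finsupp.sum]
        refine (Finset.sum_subset (Finset.subset_insert _ _) fun x _ hx => ?_).symm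
        exact Finsupp.notMem_support_iff.1 hx
      rw [this, sub_self]; exact zero_mem _) j (Finset.mem_insert_self _ _)
  rw [if_pos rfl, Submodule.mem_bot, sub_eq_zero] at h
  rw [← h]; exact hf j

theorem weightSpace_disjoint {l l' : κ → ℂ} (h : l ≠ l') {v : V} (hv : v ∈ weightSpace T l)
    (hv' : v ∈ weightSpace T l') : v = 0 := by
  obtain ⟨k, hk⟩ := Function.ne_iff.1 h
  have h1 := (mem_weightSpace.1 hv k).symm.trans (mem_weightSpace.1 hv' k)
  rw [← sub_eq_zero, ← sub_smul] at h1
  exact (smul_eq_zero.1 h1).resolve_left (sub_ne_zero.2 hk)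

end WeightSpaces

/-! ### Clifford operators -/

section Clifford

variable {n : ℕ} {V : Type*} [AddCommGroup V] [Module ℂ V] {D E : Fin n → Module.End ℂ V}

theorem eq_zero_of_eq_neg {v : V} (h : v = -v) : v = 0 := by
  have h2 : (2 : ℂ) • v = 0 := by
    rw [two_smul]; nth_rewrite 1 [h]; exact neg_add_cancel v
  exact (smul_eq_zero.1 h2).resolve_left two_ne_zero

/-- A subspace stable under anticommuting operators `D k` and not contained in the stable subspace
`Z` contains a vector outside `Z` which all `D k` map into `Z`. -/
theorem exists_annihilated (hD : ∀ k l v, D k (D l v) = -D l (D k v)) {K Z : Submodule ℂ V}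
    (hK : ∀ k, ∀ v ∈ K, D k v ∈ K) (hZ : ∀ k, ∀ v ∈ Z, D k v ∈ Z) (h : ¬ K ≤ Z) :
    ∃ v ∈ K, v ∉ Z ∧ ∀ k, D k v ∈ Z := by
  have key : ∀ s : Finset (Fin n), ∃ v ∈ K, v ∉ Z ∧ ∀ k ∈ s, D k v ∈ Z := by
    intro s
    induction s using Finset.induction_on with
    | empty =>
      obtain ⟨v, hv, hv'⟩ := SetLike.not_le_iff_exists.1 h
      exact ⟨v, hv, hv', by simp⟩
    | insert j s hj ih =>
      obtain ⟨v, hv, hv', hs⟩ := ih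
      by_cases hjv : D j v ∈ Z
      · exact ⟨v, hv, hv', Finset.forall_mem_insert _ _ _ |>.2 ⟨hjv, hs⟩⟩
      -- Replacing `v` by `D j v` keeps the earlier conditions by anticommutation and gains the new
      -- one from `D j ^ 2 = 0`.
      · refine ⟨D j v, hK j v hv, hjv, Finset.forall_mem_insert _ _ _ |>.2 ⟨?_, fun k hk => ?_⟩⟩
        · have h2 : D j (D j v) = 0 := eq_zero_of_eq_neg (hD j j v)
          rw [h2]; exact zero_mem _
        · rw [hD]; exact neg_mem (hZ j _ (hs k hk))
  obtain ⟨v, hv, hv', hs⟩ := key Finset.univ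
  exact ⟨v, hv, hv', fun k => hs k (Finset.mem_univ k)⟩

/-- The projection onto the joint kernel of the `D k`, modulo a stable subspace. -/
theorem exists_kernel_mod (hD : ∀ k l v, D k (D l v) = -D l (D k v))
    (hDE : ∀ k l v, D k (E l v) = (if k = l then v else 0) - E l (D k v))
    {K Z : Submodule ℂ V} (hKD : ∀ k, ∀ v ∈ K, D k v ∈ K) (hKE : ∀ k, ∀ v ∈ K, E k v ∈ K)
    (hZD : ∀ k, ∀ v ∈ Z, D k v ∈ Z) (hZE : ∀ k, ∀ v ∈ Z, E k v ∈ Z) {v : V} (hv : v ∈ K)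
    (hvZ : ∀ k, D k v ∈ Z) : ∃ w ∈ K, w - v ∈ Z ∧ ∀ k, D k w = 0 := by
  have key : ∀ s : Finset (Fin n), ∃ w ∈ K, w - v ∈ Z ∧ ∀ k ∈ s, D k w = 0 := by
    intro s
    induction s using Finset.induction_on with
    | empty => exact ⟨v, hv, by simp, by simp⟩
    | insert j s hj ih =>
      obtain ⟨w, hw, hwv, hs⟩ := ih
      -- `D j E j = 1 - E j D j` projects onto the kernel of `D j`. It moves `w` only inside `Z`,
      -- since `D j w ∈ Z`, and it preserves the kernels already reached.
      refine ⟨D j (E j w), hKD _ _ (hKE _ _ hw), ?_,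
        Finset.forall_mem_insert _ _ _ |>.2 ⟨eq_zero_of_eq_neg (hD j j _), fun k hk => ?_⟩⟩
      · have h1 : D j w ∈ Z := by
          have := add_mem (hZD j _ hwv) (hvZ j)
          rwa [map_sub, sub_add_cancel] at this
        rw [hDE, if_pos rfl]
        have := sub_mem hwv (hZE j _ h1)
        convert this using 1
        abel
      · have hkj : k ≠ j := fun h => hj (h ▸ hk)
        rw [hD, hDE, if_neg hkj, hs k hk]; simp
  obtain ⟨w, hw, hwv, hs⟩ := key Finset.univ
  exact ⟨w, hw, hwv, fun k => hs k (Finset.mem_univ k)⟩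

end Clifford

/-! ### Weights of `SAlg m n` -/

/-- The coefficient `c` with `torus γ = c ∂_γ`. -/
def torusCoeff : Idx m n → SAlg m n := Sum.elim (fun _ => 1) (zeta m)

theorem torus_eq (γ : Idx m n) : torus γ = dd γ (torusCoeff γ) := by
  rcases γ with i | k
  · exact torus_inl i
  · exact torus_inr k

theorem torusCoeff_mem (γ : Idx m n) : torusCoeff γ ∈ par m n (idxPar γ) := by
  rcases γ with i | k
  · exact isSupercommutative_par.one_mem
  · exact zeta_mem_par k

theorem idxPar_add_self (γ : Idx m n) : idxPar γ + idxPar γ = 0 := CharTwo.add_self_eq_zero _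

/-- The weight with components `r` for `d_i` and `w` for `ζ_k ∂_k`. -/
def wtc (r : Fin m → ℤ) (w : Fin n → ℤ) : Idx m n → ℂ :=
  Sum.elim (Fin.cons 0 fun i => (r i : ℂ)) (fun k => (w k : ℂ))

theorem wtc_add (r r' : Fin m → ℤ) (w w' : Fin n → ℤ) :
    wtc (r + r') (w + w') = wtc r w + wtc r' w' := by
  ext γ
  rcases γ with i | k
  · refine Fin.cases ?_ (fun i => ?_) i <;> simp [wtc]
  · simp [wtc]

theorem wtc_injective : Function.Injective fun g : (Fin m → ℤ) × (Fin n → ℤ) => wtc g.1 g.2 := by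
  rintro ⟨r, w⟩ ⟨r', w'⟩ h
  refine Prod.ext (funext fun i => ?_) (funext fun k => ?_)
  · simpa [wtc] using congrFun h (Sum.inl i.succ)
  · simpa [wtc] using congrFun h (Sum.inr k)

/-- The parity of the weight `w`. -/
def wpar (w : Fin n → ℤ) : ZMod 2 := ∑ k, (w k : ZMod 2)

theorem wpar_add (w w' : Fin n → ℤ) : wpar (w + w') = wpar w + wpar w' := by
  simp [wpar, Finset.sum_add_distrib]

theorem wpar_sub (w w' : Fin n → ℤ) : wpar (w - w') = wpar w + wpar w' := by
  rw [← CharTwo.sub_eq_add]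
  simp [wpar, Finset.sum_sub_distrib]

theorem wpar_single (k : Fin n) : wpar (Pi.single k 1 : Fin n → ℤ) = 1 := by
  simp [wpar, Pi.single_apply]

/-- The weight space of `SAlg m n`. -/
def awt (r : Fin m → ℤ) (w : Fin n → ℤ) : Submodule ℂ (SAlg m n) :=
  par m n (wpar w) ⊓ ⨅ γ, LinearMap.ker
    (LinearMap.mulLeft ℂ (torusCoeff γ) ∘ₗ dop γ - wtc r w γ • LinearMap.id)

theorem mem_awt {r : Fin m → ℤ} {w : Fin n → ℤ} {a : SAlg m n} : a ∈ awt r w ↔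
    a ∈ par m n (wpar w) ∧ ∀ γ, torusCoeff γ * dop γ a = wtc r w γ • a := by
  simp [awt, sub_eq_zero]

theorem awt_mul {r r' : Fin m → ℤ} {w w' : Fin n → ℤ} {a b : SAlg m n} (ha : a ∈ awt r w)
    (hb : b ∈ awt r' w') : a * b ∈ awt (r + r') (w + w') := by
  rw [mem_awt] at *
  refine ⟨?_, fun γ => ?_⟩
  · rw [wpar_add]; exact isSupercommutative_par.mul_mem ha.1 hb.1
  · rw [dop_mul_of_mem γ ha.1, mul_add, ← mul_assoc, ha.2, mul_smul_comm, ← mul_assoc,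
      par_comm (torusCoeff_mem γ) ha.1, smul_mul_assoc, smul_mul_assoc, smul_smul, sgn_mul_self, one_smul,
      mul_assoc, hb.2, wtc_add, Pi.add_apply, add_smul, mul_smul_comm]

theorem tpow_mem_awt (r : Fin m → ℤ) : tpow n r ∈ awt r 0 := by
  rw [mem_awt]
  refine ⟨by simpa [wpar] using tpow_mem_par r, fun γ => ?_⟩
  rcases γ with i | k
  · refine Fin.cases ?_ (fun i => ?_) i
    · simp [dop_zero, wtc]
    · rw [dop_succ_tpow]; simp [torusCoeff, wtc]
  · rw [dop_inr_tpow]; simp [wtc]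

theorem one_mem_awt : (1 : SAlg m n) ∈ awt 0 0 := tpow_mem_awt 0

theorem zeta_mem_awt (k : Fin n) : zeta m k ∈ awt 0 (Pi.single k 1) := by
  rw [mem_awt]
  refine ⟨by rw [wpar_single]; exact zeta_mem_par k, fun γ => ?_⟩
  rcases γ with i | l
  · rw [dop_inl_zeta, mul_zero]
    refine Fin.cases ?_ (fun i => ?_) i <;> simp [wtc]
  · rw [dop_inr_zeta]
    by_cases h : l = k
    · subst h; simp [torusCoeff, wtc]
    · simp [h, wtc]

/-- The weight of `ζ_J`. -/
def zwt (J : Finset (Fin n)) : Fin n → ℤ := fun k => if k ∈ J then 1 else 0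

theorem zetaI_mem_awt (J : Finset (Fin n)) : zetaI m J ∈ awt 0 (zwt J) := by
  induction J using Finset.induction_on_min with
  | empty => rw [zetaI_empty]; exact one_mem_awt
  | insert k J hk ih =>
    rw [zetaI_insert hk]
    have h := awt_mul (zeta_mem_awt k) ih
    have e : (Pi.single k 1 : Fin n → ℤ) + zwt J = zwt (insert k J) := by
      ext l
      have hkJ : k ∉ J := fun h => lt_irrefl _ (hk k h)
      by_cases hl : l = k
      · subst hl; simp [zwt, hkJ]
      · simp [zwt, hl]
    rwa [e, add_zero] at h

theorem monomial_mem_awt (r : Fin m → ℤ) (J : Finset (Fin n)) :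
    tpow n r * zetaI m J ∈ awt r (zwt J) := by
  have h := awt_mul (tpow_mem_awt r) (zetaI_mem_awt (m := m) J)
  simpa using h

/-- Minus the weight of `∂_α`. -/
def dwt : Idx m n → Fin n → ℤ := Sum.elim (fun _ => 0) (fun k => Pi.single k 1)

theorem wpar_dwt (α : Idx m n) : wpar (dwt α) = idxPar α := by
  rcases α with i | k
  · simp [dwt, wpar, idxPar]
  · exact wpar_single k

theorem dop_torusCoeff (α γ : Idx m n) :
    dop α (torusCoeff γ) = if α = γ then algebraMap ℂ _ (wtc (0 : Fin m → ℤ) (dwt α) γ) else 0 := by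
  rcases γ with i | k
  · have : wtc (0 : Fin m → ℤ) (dwt α) (Sum.inl i) = 0 := by
      refine Fin.cases ?_ (fun i => ?_) i <;> simp [wtc]
    simp only [torusCoeff, Sum.elim_inl, dop_one, this, map_zero, ite_self]
  · rcases α with i | l
    · simp [torusCoeff, dop_inl_zeta]
    · simp only [torusCoeff, Sum.elim_inr, dop_inr_zeta, Sum.inr.injEq]
      by_cases h : l = k
      · subst h; simp [wtc, dwt]; rfl
      · simp [h]

theorem wtc_dwt_of_ne {α γ : Idx m n} (h : α ≠ γ) : wtc (0 : Fin m → ℤ) (dwt α) γ = 0 := by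
  rcases γ with i | k
  · refine Fin.cases ?_ (fun i => ?_) i <;> simp [wtc]
  · rcases α with i | l
    · simp [wtc, dwt]
    · have : k ≠ l := fun h' => h (by rw [h'])
      simp [wtc, dwt, this]

/-! ### Weights of quasi-Poisson modules -/

section Weights

variable {M : Type*} [AddCommGroup M] [Module ℂ M] {𝓜 : ZMod 2 → Submodule ℂ M}
  {S : QPData (par m n) M}

/-- The weight spaces `M^l`. -/
def QPData.wt (S : QPData (par m n) M) (l : Idx m n → ℂ) : Submodule ℂ M :=
  weightSpace (fun α => S.ψ (torus α)) l

theorem QPData.mem_wt {l : Idx m n → ℂ} {v : M} :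
    v ∈ S.wt l ↔ ∀ γ, S.ψ (torus γ) v = l γ • v := mem_weightSpace

theorem IsQPModule.φ_wt (h : IsQPModule 𝓜 S) {r : Fin m → ℤ} {w : Fin n → ℤ} {a : SAlg m n}
    (ha : a ∈ awt r w) {l : Idx m n → ℂ} {v : M} (hv : v ∈ S.wt l) :
    S.φ a v ∈ S.wt (l + wtc r w) := by
  rw [QPData.mem_wt] at *
  intro γ
  rw [mem_awt] at ha
  rw [torus_eq, h.ψ_φ_apply γ (torusCoeff_mem γ) ha.1, ha.2, idxPar_add_self, sgn_zero_left,
    one_smul, ← torus_eq, hv, map_smul, map_smul, Pi.add_apply, add_smul, add_comm]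
  rfl

theorem IsQPModule.ψ_wt (h : IsQPModule 𝓜 S) {r : Fin m → ℤ} {w : Fin n → ℤ} {a : SAlg m n}
    (ha : a ∈ awt r w) (α : Idx m n) {l : Idx m n → ℂ} {v : M} (hv : v ∈ S.wt l) :
    S.ψ (dd α a) v ∈ S.wt (l + wtc r (w - dwt α)) := by
  rw [QPData.mem_wt] at *
  intro γ
  rw [mem_awt] at ha
  have e0 : wtc r (w - dwt α) + wtc 0 (dwt α) = wtc r w := by
    rw [← wtc_add, add_zero, sub_add_cancel]
  have e1 := congrFun e0 γ
  rw [Pi.add_apply] at e1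
  have e : a * dop α (torusCoeff γ) = if α = γ then wtc (0 : Fin m → ℤ) (dwt α) γ • a else 0 := by
    rw [dop_torusCoeff]
    split_ifs
    · rw [Algebra.algebraMap_eq_smul_one, mul_smul_comm, mul_one]
    · rw [mul_zero]
  rw [torus_eq, h.ψ_ψ γ α (torusCoeff_mem γ) ha.1, ha.2, idxPar_add_self, sgn_zero_left,
    one_smul, one_smul, ← torus_eq, hv, e, Pi.add_apply, add_smul, map_smul, map_smul, map_smul,
    ← e1, add_smul, LinearMap.add_apply, LinearMap.smul_apply, LinearMap.smul_apply]
  split_ifs with hαγ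
  · subst hαγ
    rw [map_smul, map_smul, LinearMap.smul_apply]
    abel
  · rw [wtc_dwt_of_ne hαγ]
    simp

theorem IsQPModule.φhat_wt (h : IsQPModule 𝓜 S) (α : Idx m n) {l : Idx m n → ℂ} {v : M}
    (hv : v ∈ S.wt l) : S.φhat (del α) v ∈ S.wt (l + wtc 0 (-dwt α)) := by
  rw [QPData.mem_wt] at *
  intro γ
  have e : wtc (0 : Fin m → ℤ) (-dwt α) γ = -wtc (0 : Fin m → ℤ) (dwt α) γ := by
    rw [eq_neg_iff_add_eq_zero]
    have := congrFun (wtc_add (0 : Fin m → ℤ) 0 (-dwt α) (dwt α)) γ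
    rw [Pi.add_apply] at this
    rw [← this]
    rcases γ with i | k
    · refine Fin.cases ?_ (fun i => ?_) i <;> simp [wtc]
    · simp [wtc]
  have h1 := h.φhat_del_ψ α γ (torusCoeff_mem γ) v
  rw [idxPar_add_self, sgn_zero_right, one_smul, ← torus_eq, hv, map_smul] at h1
  -- The correction terms occur only for `γ = 0`, where the coefficient is `1` and they cancel.
  have h2 : S.ψ (dd α (torusCoeff γ * delA γ)) v -
      S.φ (torusCoeff γ * delA γ) (S.ψ (del α) v) = 0 := by
    by_cases hγ : γ = Sum.inl 0
    · subst hγ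
      rw [delA_zero]
      simp only [torusCoeff, Sum.elim_inl, mul_one, dd_one, h.φ_one, sub_self]
    · simp [delA_of_ne hγ]
  rw [h2, smul_zero, add_zero, dop_torusCoeff] at h1
  rw [Pi.add_apply, add_smul, e, neg_smul, h1]
  split_ifs with hαγ
  · subst hαγ
    rw [Algebra.algebraMap_eq_smul_one, map_smul, map_one]
    simp
  · rw [wtc_dwt_of_ne hαγ]; simp

theorem IsQPModule.isCompl (h : IsQPModule 𝓜 S) : IsCompl (𝓜 0) (𝓜 1) :=
  h.isInternal.isCompl (i := 0) (j := 1) (by decide) (by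
    ext p
    simpa using zmod_two_cases p)

theorem IsQPModule.isCompl' (h : IsQPModule 𝓜 S) (p : ZMod 2) : IsCompl (𝓜 p) (𝓜 (p + 1)) := by
  rcases zmod_two_cases p with rfl | rfl
  · exact h.isCompl
  · exact h.isCompl.symm

theorem IsQPModule.torus_parity (h : IsQPModule 𝓜 S) (γ : Idx m n) {p : ZMod 2} {v : M}
    (hv : v ∈ 𝓜 p) : S.ψ (torus γ) v ∈ 𝓜 p := by
  have h1 := h.ψ_parity _ p _ (dd_mem γ (torusCoeff_mem γ)) v hv
  rwa [idxPar_add_self, zero_add, ← torus_eq] at h1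

/-- A nonzero weight space contains a nonzero homogeneous vector. -/
theorem IsQPModule.exists_homogeneous (h : IsQPModule 𝓜 S) {l : Idx m n → ℂ}
    (hl : S.wt l ≠ ⊥) : ∃ p, S.wt l ⊓ 𝓜 p ≠ ⊥ := by
  obtain ⟨v, hv, hv0⟩ := Submodule.exists_mem_ne_zero_of_ne_bot hl
  obtain ⟨v₀, h₀, v₁, h₁, rfl⟩ := Submodule.mem_sup.1
    (show v ∈ 𝓜 0 ⊔ 𝓜 1 by rw [h.isCompl.sup_eq_top]; trivial)
  -- Torus operators are even, so the failures of `v₀` and `v₁` to be weight vectors have different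
  -- parities; their sum is zero, hence both vanish.
  have key : v₀ ∈ S.wt l := by
    rw [QPData.mem_wt] at *
    intro γ
    have h2 := hv γ
    rw [map_add, smul_add, ← sub_eq_zero] at h2
    have h3 : S.ψ (torus γ) v₀ - l γ • v₀ = -(S.ψ (torus γ) v₁ - l γ • v₁) := by
      rw [← sub_eq_zero, ← h2]; abel
    have h4 : S.ψ (torus γ) v₀ - l γ • v₀ ∈ 𝓜 0 :=
      sub_mem (h.torus_parity γ h₀) (Submodule.smul_mem _ _ h₀)
    have h5 : S.ψ (torus γ) v₀ - l γ • v₀ ∈ 𝓜 1 := by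
      rw [h3]
      exact neg_mem (sub_mem (h.torus_parity γ h₁) (Submodule.smul_mem _ _ h₁))
    exact sub_eq_zero.1 (Submodule.disjoint_def.1 h.isCompl.disjoint _ h4 h5)
  by_cases hz : v₀ = 0
  · subst hz
    rw [zero_add] at hv hv0
    exact ⟨1, fun hb => hv0 ((Submodule.mem_bot ℂ).1 (hb ▸ ⟨hv, h₁⟩))⟩
  · exact ⟨0, fun hb => hz ((Submodule.mem_bot ℂ).1 (hb ▸ ⟨key, h₀⟩))⟩

/-- The homogeneous weight spaces whose weights differ from `l` by integers, with matching
parities. -/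
def QPData.pieces (S : QPData (par m n) M) (𝓜 : ZMod 2 → Submodule ℂ M) (l : Idx m n → ℂ)
    (p : ZMod 2) (g : (Fin m → ℤ) × (Fin n → ℤ)) : Submodule ℂ M :=
  S.wt (l + wtc g.1 g.2) ⊓ 𝓜 (p + wpar g.2)

theorem iSup_stable {ι : Type*} {P : ι → Submodule ℂ M} {T : Module.End ℂ M}
    (h : ∀ i, ∀ v ∈ P i, T v ∈ ⨆ i, P i) : ∀ v ∈ ⨆ i, P i, T v ∈ ⨆ i, P i := by
  intro v hv
  have : ⨆ i, P i ≤ (⨆ i, P i).comap T := iSup_le h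
  exact this hv

theorem φ_stable_of_monomials {W : Submodule ℂ M}
    (h : ∀ r J, ∀ v ∈ W, S.φ (tpow n r * zetaI m J) v ∈ W) (a : SAlg m n) :
    ∀ v ∈ W, S.φ a v ∈ W := by
  intro v hv
  exact mem_of_monomials (W.comap ((LinearMap.applyₗ v).comp S.φ.toLinearMap))
    (fun r J => h r J v hv) a

theorem ψ_stable_of_monomials {W : Submodule ℂ M} {v : M}
    (h : ∀ α r J, S.ψ (dd α (tpow n r * zetaI m J)) v ∈ W) (x : QPg m n) : S.ψ x v ∈ W := by
  rw [← sum_dd_coord x, map_sum, LinearMap.sum_apply]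
  refine Submodule.sum_mem _ fun α _ => ?_
  exact mem_of_monomials (W.comap ((LinearMap.applyₗ v).comp (S.ψ ∘ₗ dd α)))
    (fun r J => h α r J) _

theorem IsQPModule.φhat_stable_of_del (h : IsQPModule 𝓜 S) {W : Submodule ℂ M}
    (hφ : ∀ a, ∀ v ∈ W, S.φ a v ∈ W) {v : M} (hv : ∀ α, S.φhat (del α) v ∈ W) (x : QPg m n) :
    S.φhat x v ∈ W := by
  rw [← sum_dd_coord x, map_sum, LinearMap.sum_apply]
  refine Submodule.sum_mem _ fun α _ => ?_
  rw [h.φhat_dd]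
  exact hφ _ _ (hv α)

/-- Each `t^r ζ_J` and each `∂_α` shifts the weight by integers and the parity by the parity of the
shift. The pieces therefore span a nonzero invariant sub-superspace, which is all of `M`. In
particular the weight of a vector determines its parity. -/
theorem IsQPModule.iSup_pieces (h : IsQPModule 𝓜 S) (hs : S.IsSimple 𝓜) {l : Idx m n → ℂ}
    {p : ZMod 2} (hl : S.wt l ⊓ 𝓜 p ≠ ⊥) : ⨆ g, S.pieces 𝓜 l p g = ⊤ := by
  have hφ : ∀ a, ∀ v ∈ ⨆ g, S.pieces 𝓜 l p g, S.φ a v ∈ ⨆ g, S.pieces 𝓜 l p g := by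
    refine φ_stable_of_monomials fun r J => iSup_stable fun g v hv => ?_
    refine Submodule.mem_iSup_of_mem (r + g.1, zwt J + g.2) ⟨?_, ?_⟩
    · have h1 := h.φ_wt (monomial_mem_awt r J) hv.1
      rwa [add_assoc, ← wtc_add, add_comm g.1, add_comm g.2] at h1
    · have h1 := h.φ_parity _ _ _ (mem_awt.1 (monomial_mem_awt r J)).1 v hv.2
      rwa [add_left_comm, ← wpar_add] at h1
  refine (hs.eq_bot_or_eq_top _ ?_ hφ ?_ ?_).resolve_left ?_
  · refine iSup_le fun g => ?_
    have h1 : S.pieces 𝓜 l p g ≤ (⨆ g, S.pieces 𝓜 l p g) ⊓ 𝓜 (p + wpar g.2) :=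
      le_inf (le_iSup _ g) inf_le_right
    rcases zmod_two_cases (p + wpar g.2) with h2 | h2 <;> rw [h2] at h1
    · exact h1.trans le_sup_left
    · exact h1.trans le_sup_right
  · intro x
    refine iSup_stable fun g v hv => ψ_stable_of_monomials (fun α r J => ?_) x
    refine Submodule.mem_iSup_of_mem (g.1 + r, g.2 + (zwt J - dwt α)) ⟨?_, ?_⟩
    · have h1 := h.ψ_wt (monomial_mem_awt r J) α hv.1
      rwa [add_assoc, ← wtc_add] at h1
    · have h1 := h.ψ_parity _ _ _ (dd_mem α (mem_awt.1 (monomial_mem_awt r J)).1) v hv.2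
      rwa [← wpar_dwt, ← wpar_sub, add_left_comm, ← wpar_add, add_comm _ g.2] at h1
  · intro x
    refine iSup_stable fun g v hv => h.φhat_stable_of_del hφ (fun α => ?_) x
    refine Submodule.mem_iSup_of_mem (g.1 + 0, g.2 + -dwt α) ⟨?_, ?_⟩
    · have h1 := h.φhat_wt α hv.1
      rwa [add_assoc, ← wtc_add] at h1
    · have h1 := h.φhat_parity _ _ _ (del_mem α) v hv.2
      rwa [← wpar_dwt, add_left_comm, add_comm (wpar (dwt α)), ← wpar_sub, sub_eq_add_neg] at h1
  · intro hb
    apply hl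
    rw [eq_bot_iff, ← hb]
    refine le_iSup_of_le (0, 0) ?_
    simp only [QPData.pieces]
    rw [show wtc (0 : Fin m → ℤ) (0 : Fin n → ℤ) = 0 from ?_]
    · simp [wpar]
    · ext γ
      rcases γ with i | k
      · refine Fin.cases ?_ (fun i => ?_) i <;> simp [wtc]
      · simp [wtc]

end Weights

section Structure

variable {M : Type*} [AddCommGroup M] [Module ℂ M] {𝓜 : ZMod 2 → Submodule ℂ M}
  {S : QPData (par m n) M} {μ : Fin (m + 1) → ℂ}

/-! ### Simple quasi-Poisson modules with a weight vector -/

/-- A simple quasi-Poisson module with a homogeneous weight vector whose weight restricts to `μ`. -/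
structure IsBased (𝓜 : ZMod 2 → Submodule ℂ M) (S : QPData (par m n) M)
    (μ : Fin (m + 1) → ℂ) : Prop where
  qp : IsQPModule 𝓜 S
  simple : S.IsSimple 𝓜
  exists_wt : ∃ (l : Idx m n → ℂ) (p : ZMod 2), (∀ i, l (Sum.inl i) = μ i) ∧ S.wt l ⊓ 𝓜 p ≠ ⊥

/-- The joint eigenspace of the operators `ψ_1`, `ψ_{d_i}`. -/
def QPData.ewt (S : QPData (par m n) M) (ν : Fin (m + 1) → ℂ) : Submodule ℂ M :=
  weightSpace (fun i => S.ψ (del (Sum.inl i))) ν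

theorem QPData.mem_ewt {ν : Fin (m + 1) → ℂ} {v : M} :
    v ∈ S.ewt ν ↔ ∀ i, S.ψ (del (Sum.inl i)) v = ν i • v := mem_weightSpace

/-- The restriction of `wtc` to `d_0, …, d_m`. -/
def etc (r : Fin m → ℤ) : Fin (m + 1) → ℂ := Fin.cons 0 fun i => (r i : ℂ)

theorem etc_injective (ν : Fin (m + 1) → ℂ) :
    Function.Injective fun r : Fin m → ℤ => ν + etc r := by
  intro r r' h
  have h1 := add_left_cancel h
  funext i
  simpa [etc] using congrFun h1 i.succ

theorem etc_zero : etc (0 : Fin m → ℤ) = 0 := by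
  ext i
  refine Fin.cases ?_ (fun i => ?_) i <;> simp [etc]

theorem etc_neg (r : Fin m → ℤ) : etc r + etc (-r) = 0 := by
  ext i
  refine Fin.cases ?_ (fun i => ?_) i <;> simp [etc]

theorem wt_le_ewt {l : Idx m n → ℂ} {ν : Fin (m + 1) → ℂ} (h : ∀ i, l (Sum.inl i) = ν i) :
    S.wt l ≤ S.ewt ν := by
  intro v hv
  rw [QPData.mem_ewt]
  intro i
  rw [← h]
  exact QPData.mem_wt.1 hv (Sum.inl i)

theorem pieces_le_ewt {l : Idx m n → ℂ} {p : ZMod 2} (h : ∀ i, l (Sum.inl i) = μ i)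
    (g : (Fin m → ℤ) × (Fin n → ℤ)) : S.pieces 𝓜 l p g ≤ S.ewt (μ + etc g.1) := by
  refine inf_le_left.trans (wt_le_ewt fun i => ?_)
  simp [wtc, etc, h]

theorem pieces_le_wt {l : Idx m n → ℂ} {p : ZMod 2}
    (g : (Fin m → ℤ) × (Fin n → ℤ)) : S.pieces 𝓜 l p g ≤ S.wt (l + wtc g.1 g.2) := inf_le_left

theorem add_wtc_injective (l : Idx m n → ℂ) :
    Function.Injective fun g : (Fin m → ℤ) × (Fin n → ℤ) => l + wtc g.1 g.2 :=
  (add_right_injective l).comp wtc_injective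

/-- `M` is the sum of pieces with pairwise distinct weights, so a torus-stable subspace is cut out
by its intersections with them. As the pieces are homogeneous, this replaces every later check of
homogeneity. -/
theorem IsBased.le_iSup (hb : IsBased 𝓜 S μ) {Z : Submodule ℂ M}
    (hZ : ∀ γ, ∀ v ∈ Z, S.ψ (torus γ) v ∈ Z) : ∃ (l : Idx m n → ℂ) (p : ZMod 2),
      (∀ i, l (Sum.inl i) = μ i) ∧ Z ≤ ⨆ g, Z ⊓ S.pieces 𝓜 l p g := by
  obtain ⟨l, p, hl, hne⟩ := hb.exists_wt
  refine ⟨l, p, hl, ?_⟩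
  have h := inf_iSup_weight_le (T := fun α => S.ψ (torus α)) (add_wtc_injective l) hZ
    (P := S.pieces 𝓜 l p) pieces_le_wt
  rwa [hb.qp.iSup_pieces hb.simple hne, inf_top_eq] at h

/-- A subspace stable under the torus is a sub-superspace. -/
theorem IsBased.isSubsuperspace (hb : IsBased 𝓜 S μ) {Z : Submodule ℂ M}
    (hZ : ∀ γ, ∀ v ∈ Z, S.ψ (torus γ) v ∈ Z) : IsSubsuperspace 𝓜 Z := by
  obtain ⟨l, p, -, h⟩ := hb.le_iSup hZ
  refine h.trans (iSup_le fun g => ?_)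
  have h1 : Z ⊓ S.pieces 𝓜 l p g ≤ Z ⊓ 𝓜 (p + wpar g.2) :=
    inf_le_inf_left _ inf_le_right
  rcases zmod_two_cases (p + wpar g.2) with h2 | h2 <;> rw [h2] at h1
  · exact h1.trans le_sup_left
  · exact h1.trans le_sup_right

/-- A stable subspace, homogeneous or not, is trivial. -/
theorem IsBased.eq_top (hb : IsBased 𝓜 S μ) {Z : Submodule ℂ M} (h0 : Z ≠ ⊥)
    (hφ : ∀ a, ∀ v ∈ Z, S.φ a v ∈ Z) (hψ : ∀ x, ∀ v ∈ Z, S.ψ x v ∈ Z)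
    (hφhat : ∀ α, ∀ v ∈ Z, S.φhat (del α) v ∈ Z) : Z = ⊤ :=
  (hb.simple.eq_bot_or_eq_top Z (hb.isSubsuperspace fun _ => hψ _) hφ hψ
    (fun x _ hv => hb.qp.φhat_stable_of_del hφ (fun α => hφhat α _ hv) x)).resolve_left h0

theorem IsQPModule.ψ_del_comm (h : IsQPModule 𝓜 S) (α β : Idx m n) (v : M) :
    S.ψ (del α) (S.ψ (del β) v) =
      sgn (idxPar α) (idxPar β) • S.ψ (del β) (S.ψ (del α) v) := by
  have h1 := h.ψ_del_ψ α β isSupercommutative_par.one_mem v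
  rwa [dop_one, map_zero, map_zero, LinearMap.zero_apply, add_zero, dd_one, zero_add] at h1

theorem IsQPModule.ψ_torus_del (h : IsQPModule 𝓜 S) (i : Fin (m + 1)) (γ : Idx m n) (v : M) :
    S.ψ (del (Sum.inl i)) (S.ψ (torus γ) v) = S.ψ (torus γ) (S.ψ (del (Sum.inl i)) v) := by
  have h1 := h.ψ_del_ψ (Sum.inl i) γ (torusCoeff_mem γ) v
  have h2 : dop (Sum.inl i) (torusCoeff γ) = 0 := by
    rcases γ with j | k
    · exact dop_one _
    · exact dop_inl_zeta i k
  rw [h2, map_zero, map_zero, LinearMap.zero_apply, add_zero, ← torus_eq] at h1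
  simpa [idxPar] using h1

theorem IsQPModule.ewt_torus (h : IsQPModule 𝓜 S) {ν : Fin (m + 1) → ℂ} (γ : Idx m n) {v : M}
    (hv : v ∈ S.ewt ν) : S.ψ (torus γ) v ∈ S.ewt ν := by
  rw [QPData.mem_ewt] at *
  intro i
  rw [h.ψ_torus_del, hv, map_smul]

/-- The eigenspace of the smaller torus is stable under the full torus and so decomposes along the
pieces; a piece whose weight does not restrict to `μ` meets it in zero. -/
theorem IsBased.block_eq (hb : IsBased 𝓜 S μ) : S.block μ = S.ewt μ := by
  refine le_antisymm (iSup₂_le fun l hl => wt_le_ewt hl) ?_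
  obtain ⟨l, p, -, h⟩ := hb.le_iSup (Z := S.ewt μ) fun γ v hv => hb.qp.ewt_torus γ hv
  refine h.trans (iSup_le fun g => ?_)
  by_cases hg : ∀ i, (l + wtc g.1 g.2) (Sum.inl i) = μ i
  · exact inf_le_right.trans (inf_le_left.trans (le_iSup₂_of_le _ hg le_rfl))
  · rintro v ⟨hv, hv'⟩
    have h0 := weightSpace_disjoint (T := fun i => S.ψ (del (Sum.inl i)))
      (l := fun i => (l + wtc g.1 g.2) (Sum.inl i)) (l' := μ) (fun he => hg (congrFun he))
      (wt_le_ewt (fun i => rfl) hv'.1) hv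
    rw [h0]; exact zero_mem _

theorem IsBased.iSup_ewt (hb : IsBased 𝓜 S μ) : ⨆ r, S.ewt (μ + etc r) = ⊤ := by
  obtain ⟨l, p, hl, hne⟩ := hb.exists_wt
  rw [eq_top_iff, ← hb.qp.iSup_pieces hb.simple hne]
  exact iSup_le fun g => le_iSup_of_le g.1 (pieces_le_ewt hl g)

theorem IsQPModule.φ_ewt (h : IsQPModule 𝓜 S) {r : Fin m → ℤ} {w : Fin n → ℤ} {a : SAlg m n}
    (ha : a ∈ awt r w) {ν : Fin (m + 1) → ℂ} {v : M} (hv : v ∈ S.ewt ν) :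
    S.φ a v ∈ S.ewt (ν + etc r) := by
  rw [QPData.mem_ewt] at *
  rw [mem_awt] at ha
  intro i
  have h1 := ha.2 (Sum.inl i)
  have h2 : dop (Sum.inl i) a = etc r i • a := by
    rw [torusCoeff, Sum.elim_inl, one_mul] at h1
    exact h1
  rw [h.ψ_del_φ, h2, hv, idxPar, Sum.elim_inl, twist_zero]
  simp [add_smul, add_comm]

theorem IsQPModule.φ_ewt_zero (h : IsQPModule 𝓜 S) {w : Fin n → ℤ} {a : SAlg m n}
    (ha : a ∈ awt 0 w) {ν : Fin (m + 1) → ℂ} {v : M} (hv : v ∈ S.ewt ν) :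
    S.φ a v ∈ S.ewt ν := by
  have h1 := h.φ_ewt ha hv
  rwa [etc_zero, add_zero] at h1

theorem IsQPModule.ψ_ewt (h : IsQPModule 𝓜 S) {r : Fin m → ℤ} {w : Fin n → ℤ} {a : SAlg m n}
    (ha : a ∈ awt r w) (α : Idx m n) {ν : Fin (m + 1) → ℂ} {v : M} (hv : v ∈ S.ewt ν) :
    S.ψ (dd α a) v ∈ S.ewt (ν + etc r) := by
  rw [QPData.mem_ewt] at *
  rw [mem_awt] at ha
  intro i
  have h1 := ha.2 (Sum.inl i)
  have h2 : dop (Sum.inl i) a = etc r i • a := by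
    rw [torusCoeff, Sum.elim_inl, one_mul] at h1
    exact h1
  rw [h.ψ_del_ψ (Sum.inl i) α ha.1, h2, hv, idxPar, Sum.elim_inl, sgn_zero_left, one_smul,
    map_smul, map_smul, map_smul, Pi.add_apply, add_smul]
  rfl

theorem IsQPModule.ψ_del_ewt (h : IsQPModule 𝓜 S) (α : Idx m n) {ν : Fin (m + 1) → ℂ} {v : M}
    (hv : v ∈ S.ewt ν) : S.ψ (del α) v ∈ S.ewt ν := by
  have h1 := h.ψ_ewt one_mem_awt α hv
  rwa [etc_zero, add_zero, dd_one] at h1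

theorem IsQPModule.φhat_del_ewt (h : IsQPModule 𝓜 S) (α : Idx m n) {ν : Fin (m + 1) → ℂ} {v : M}
    (hv : v ∈ S.ewt ν) : S.φhat (del α) v ∈ S.ewt ν := by
  rw [QPData.mem_ewt] at *
  intro i
  have h1 := h.φhat_del_ψ α (Sum.inl i) isSupercommutative_par.one_mem v
  have h2 : S.ψ (dd α (1 * delA (Sum.inl i))) v - S.φ (1 * delA (Sum.inl i)) (S.ψ (del α) v) = 0 := by
    by_cases hγ : (Sum.inl i : Idx m n) = Sum.inl 0
    · rw [hγ, delA_zero, mul_one, dd_one, h.φ_one, sub_self]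
    · simp [delA_of_ne hγ]
  rw [h2, dop_one, dd_one, hv, map_smul] at h1
  simpa [idxPar] using h1.symm

theorem IsQPModule.dz_anticomm (h : IsQPModule 𝓜 S) (k l : Fin n) (v : M) :
    S.ψ (del (Sum.inr k)) (S.ψ (del (Sum.inr l)) v) =
      -S.ψ (del (Sum.inr l)) (S.ψ (del (Sum.inr k)) v) := by
  rw [h.ψ_del_comm]; simp [idxPar]

/-- With `dz_anticomm` these are the Clifford relations required by `exists_kernel_mod`, for `D k =
ψ_{∂_k}` and `E k = φ_{ζ_k}`. -/
theorem IsQPModule.dz_zeta (h : IsQPModule 𝓜 S) (k l : Fin n) (v : M) :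
    S.ψ (del (Sum.inr k)) (S.φ (zeta m l) v) =
      (if k = l then v else 0) - S.φ (zeta m l) (S.ψ (del (Sum.inr k)) v) := by
  rw [h.ψ_del_φ, dop_inr_zeta, idxPar, Sum.elim_inr, twist_of_mem (zeta_mem_par l)]
  split_ifs
  · simp [sub_eq_add_neg]
  · simp

/-! ### The subspace `Ω` -/

/-- The scalars by which the `ψ_{∂_α}` act on `Ω`. -/
def rho (μ : Fin (m + 1) → ℂ) : Idx m n → ℂ := Sum.elim μ fun _ => 0

/-- The subspace `Ω`, as a joint eigenspace. -/
def QPData.om (S : QPData (par m n) M) (μ : Fin (m + 1) → ℂ) : Submodule ℂ M :=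
  weightSpace (fun α => S.ψ (del α)) (rho μ)

theorem QPData.mem_om {u : M} : u ∈ S.om μ ↔ ∀ α, S.ψ (del α) u = rho μ α • u := mem_weightSpace

theorem QPData.ψ_del_om (u : S.om μ) (α : Idx m n) : S.ψ (del α) (u : M) = rho μ α • (u : M) :=
  QPData.mem_om.1 u.2 α

theorem QPData.ψ_dz_om (u : S.om μ) (k : Fin n) : S.ψ (del (Sum.inr k)) (u : M) = 0 := by
  rw [QPData.ψ_del_om]; simp [rho]

theorem QPData.mem_om_iff {u : M} :
    u ∈ S.om μ ↔ u ∈ S.ewt μ ∧ ∀ k, S.ψ (del (Sum.inr k)) u = 0 := by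
  rw [QPData.mem_om, QPData.mem_ewt, Sum.forall]
  simp [rho]

theorem QPData.om_le_ewt : S.om μ ≤ S.ewt μ := fun _ hu => (QPData.mem_om_iff.1 hu).1

theorem IsBased.omega_eq (hb : IsBased 𝓜 S μ) : S.omega (S.block μ) = S.om μ := by
  ext u
  rw [QPData.mem_om_iff, hb.block_eq]
  simp [QPData.omega]

/-- The map `a ⊗ u ↦ φ_a u`. -/
def QPData.theta (S : QPData (par m n) M) (μ : Fin (m + 1) → ℂ) : SAlg m n ⊗[ℂ] S.om μ →ₗ[ℂ] M :=
  TensorProduct.lift (S.φ.toLinearMap.compl₂ (S.om μ).subtype)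

@[simp] theorem QPData.theta_tmul (a : SAlg m n) (u : S.om μ) :
    S.theta μ (a ⊗ₜ u) = S.φ a u := by simp [QPData.theta]

/-- The subspace generated by `U ≤ Ω` under the operators `φ_a`. -/
def QPData.gen (S : QPData (par m n) M) {μ : Fin (m + 1) → ℂ} (U : Submodule ℂ (S.om μ)) :
    Submodule ℂ M :=
  Submodule.map₂ (S.φ.toLinearMap.compl₂ (S.om μ).subtype) ⊤ U

theorem QPData.mem_gen {U : Submodule ℂ (S.om μ)} {u : S.om μ} (hu : u ∈ U) (a : SAlg m n) :
    S.φ a u ∈ S.gen U :=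
  Submodule.apply_mem_map₂ (S.φ.toLinearMap.compl₂ (S.om μ).subtype) (Submodule.mem_top (x := a)) hu

theorem QPData.gen_le {U : Submodule ℂ (S.om μ)} {W : Submodule ℂ M}
    (h : ∀ a, ∀ u ∈ U, S.φ a (u : M) ∈ W) : S.gen U ≤ W :=
  Submodule.map₂_le.2 fun a _ u hu => h a u hu

theorem QPData.gen_stable {U : Submodule ℂ (S.om μ)} {T : Module.End ℂ M}
    (h : ∀ a, ∀ u ∈ U, T (S.φ a (u : M)) ∈ S.gen U) : ∀ v ∈ S.gen U, T v ∈ S.gen U :=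
  fun _ hv => (QPData.gen_le (W := (S.gen U).comap T) h) hv

theorem IsQPModule.φ_gen (hq : IsQPModule 𝓜 S) {U : Submodule ℂ (S.om μ)} (a : SAlg m n) :
    ∀ v ∈ S.gen U, S.φ a v ∈ S.gen U :=
  QPData.gen_stable fun b u hu => by rw [← hq.φ_mul]; exact QPData.mem_gen hu _

theorem IsQPModule.ψ_del_φ_om (hq : IsQPModule 𝓜 S) (u : S.om μ) (a : SAlg m n) (k : Fin n) :
    S.ψ (del (Sum.inr k)) (S.φ a u) = S.φ (dop (Sum.inr k) a) u := by
  rw [hq.ψ_del_φ, QPData.ψ_dz_om, map_zero, add_zero]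

theorem IsQPModule.dz_gen (hq : IsQPModule 𝓜 S) {U : Submodule ℂ (S.om μ)} (k : Fin n) :
    ∀ v ∈ S.gen U, S.ψ (del (Sum.inr k)) v ∈ S.gen U :=
  QPData.gen_stable fun b u hu => by rw [hq.ψ_del_φ_om]; exact QPData.mem_gen hu _

/-- If the block were larger than `φ_A Ω`, it would contain a vector outside `φ_A Ω` whose
`∂_k`-derivatives all lie in `φ_A Ω`. The Clifford projection changes it by an element of `φ_A Ω`
into a vector of `Ω`, a contradiction. -/
theorem IsBased.ewt_le_gen (hb : IsBased 𝓜 S μ) : S.ewt μ ≤ S.gen (⊤ : Submodule ℂ (S.om μ)) := by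
  by_contra hne
  obtain ⟨v, hv, hvZ, hD⟩ := exists_annihilated (D := fun k => S.ψ (del (Sum.inr k)))
    hb.qp.dz_anticomm (fun k v hv => hb.qp.ψ_del_ewt _ hv) hb.qp.dz_gen hne
  obtain ⟨w, hw, hwv, hw0⟩ := exists_kernel_mod (E := fun k => S.φ (zeta m k))
    hb.qp.dz_anticomm hb.qp.dz_zeta (fun k v hv => hb.qp.ψ_del_ewt _ hv)
    (fun k v hv => hb.qp.φ_ewt_zero (zeta_mem_awt k) hv) hb.qp.dz_gen
    (fun k => hb.qp.φ_gen _) hv hD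
  apply hvZ
  have h1 : w ∈ S.gen (⊤ : Submodule ℂ (S.om μ)) := by
    have := QPData.mem_gen (S := S) (U := ⊤) (u := ⟨w, QPData.mem_om_iff.2 ⟨hw, hw0⟩⟩)
      Submodule.mem_top 1
    rwa [hb.qp.φ_one] at this
  have := sub_mem h1 hwv
  rwa [sub_sub_cancel] at this

/-- The invertible operators `φ_{t^r}` carry the block of `μ` to all the others, so the previous
lemma suffices. -/
theorem IsBased.gen_top (hb : IsBased 𝓜 S μ) : S.gen (⊤ : Submodule ℂ (S.om μ)) = ⊤ := by
  rw [eq_top_iff, ← hb.iSup_ewt]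
  refine iSup_le fun r v hv => ?_
  have h1 := hb.qp.φ_ewt (tpow_mem_awt (-r)) hv
  rw [add_assoc, etc_neg, add_zero] at h1
  have h2 := hb.qp.φ_gen (tpow n r) _ (hb.ewt_le_gen h1)
  rwa [hb.qp.φ_tpow_neg'] at h2

theorem IsBased.theta_surjective (hb : IsBased 𝓜 S μ) : Function.Surjective (S.theta μ) := by
  rw [← LinearMap.range_eq_top, eq_top_iff, ← hb.gen_top]
  exact QPData.gen_le fun a u _ => ⟨a ⊗ₜ u, QPData.theta_tmul a u⟩

/-! ### Injectivity of `A ⊗ Ω → M` -/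

section Injective

variable {V : Type*} [AddCommGroup V] [Module ℂ V]

theorem zeta_dop_monomial (k : Fin n) (r : Fin m → ℤ) (J : Finset (Fin n)) :
    zeta m k * dop (Sum.inr k) (tpow n r * zetaI m J) =
      if k ∈ J then tpow n r * zetaI m J else 0 := by
  have h := (mem_awt.1 (monomial_mem_awt r J)).2 (Sum.inr k)
  have h' : zeta m k * dop (Sum.inr k) (tpow n r * zetaI m J) =
    wtc r (zwt J) (Sum.inr k) • (tpow n r * zetaI m J) := h
  rw [h']
  by_cases hk : k ∈ J <;> simp [wtc, zwt, hk]

theorem dop_zeta_mul (k : Fin n) (a : SAlg m n) :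
    dop (Sum.inr k) (zeta m k * a) = a - zeta m k * dop (Sum.inr k) a := by
  rw [dop_mul_of_mem _ (zeta_mem_par k), dop_inr_zeta, if_pos rfl, one_mul]
  simp [idxPar, sub_eq_add_neg]

/-- A tensor killed by all `∂_k ⊗ 1` has only terms `t^r ⊗ v`. -/
theorem mem_iSup_tpow_of_dop_eq_zero {z : SAlg m n ⊗[ℂ] V}
    (hz : ∀ k, TensorProduct.map (dop (Sum.inr k)) LinearMap.id z = 0) :
    z ∈ ⨆ r, LinearMap.range (TensorProduct.mk ℂ (SAlg m n) V (tpow n r)) := by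
  have key : ∀ s : Finset (Fin n),
      z ∈ Submodule.span ℂ {x : SAlg m n ⊗[ℂ] V | ∃ r J v, Disjoint J s ∧
        x = (tpow n r * zetaI m J) ⊗ₜ v} := by
    intro s
    induction s using Finset.induction_on with
    | empty =>
      have h : z ∈ (⊤ : Submodule ℂ _) := trivial
      rw [← TensorProduct.span_tmul_eq_top] at h
      refine Submodule.span_le.2 ?_ h
      rintro _ ⟨a, v, rfl⟩
      exact mem_of_monomials (Submodule.comap ((TensorProduct.mk ℂ (SAlg m n) V).flip v)
        (Submodule.span ℂ {x : SAlg m n ⊗[ℂ] V | ∃ r J v, Disjoint J ∅ ∧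
        x = (tpow n r * zetaI m J) ⊗ₜ v}))
        (fun r J => Submodule.subset_span ⟨r, J, v, Finset.disjoint_empty_right _, rfl⟩) a
    | insert j s hj ih =>
      -- The operator `∂_j ζ_j` is the projection onto monomials without `ζ_j`. It fixes `z`,
      -- because `z` is killed by `∂_j`.
      let T : Module.End ℂ (SAlg m n ⊗[ℂ] V) := TensorProduct.map
        (dop (Sum.inr j) ∘ₗ LinearMap.mulLeft ℂ (zeta m j)) LinearMap.id
      have hT : T z = z := by
        have h1 : T = LinearMap.id - TensorProduct.map (LinearMap.mulLeft ℂ (zeta m j))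
            LinearMap.id ∘ₗ TensorProduct.map (dop (Sum.inr j)) LinearMap.id := by
          refine TensorProduct.ext' fun a v => ?_
          simp [T, dop_zeta_mul, TensorProduct.sub_tmul]
        rw [h1, LinearMap.sub_apply, LinearMap.comp_apply, hz, map_zero, sub_zero]
        rfl
      rw [← hT]
      refine (Submodule.span_le (p := (Submodule.span ℂ _).comap T)).2 ?_ ih
      rintro _ ⟨r, J, v, hJ, rfl⟩
      change T _ ∈ Submodule.span ℂ _
      simp only [T, TensorProduct.map_tmul, LinearMap.comp_apply, LinearMap.mulLeft_apply,
        LinearMap.id_apply, dop_zeta_mul, zeta_dop_monomial]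
      split_ifs with hjJ
      · rw [sub_self, TensorProduct.zero_tmul]; exact zero_mem _
      · rw [sub_zero]
        exact Submodule.subset_span ⟨r, J, v, Finset.disjoint_insert_right.2 ⟨hjJ, hJ⟩, rfl⟩
  refine Submodule.span_le.2 ?_ (key Finset.univ)
  rintro _ ⟨r, J, v, hJ, rfl⟩
  have : J = ∅ := Finset.eq_empty_of_forall_notMem fun x hx => Finset.disjoint_left.1 hJ hx (Finset.mem_univ x)
  subst this
  rw [zetaI_empty, mul_one]
  exact Submodule.mem_iSup_of_mem r ⟨v, rfl⟩

end Injective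

theorem IsQPModule.theta_dop (hq : IsQPModule 𝓜 S) (k : Fin n) (z : SAlg m n ⊗[ℂ] S.om μ) :
    S.theta μ (TensorProduct.map (dop (Sum.inr k)) LinearMap.id z) =
      S.ψ (del (Sum.inr k)) (S.theta μ z) := by
  induction z using TensorProduct.induction_on with
  | zero => simp
  | tmul a u => simp [hq.ψ_del_φ_om]
  | add x y hx hy => rw [map_add, map_add, hx, hy, map_add, map_add]

/-- The kernel is stable under the `∂_k`, so if nonzero it contains a nonzero tensor killed by all
of them, that is, a sum of terms `t^r ⊗ u_r`. The images `φ_{t^r} u_r` have distinct weights, hence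
vanish separately, and `φ_{t^r}` is invertible. -/
theorem IsQPModule.theta_injective (hq : IsQPModule 𝓜 S) : Function.Injective (S.theta μ) := by
  rw [← LinearMap.ker_eq_bot]
  by_contra hne
  have hne' : ¬ LinearMap.ker (S.theta μ) ≤ ⊥ := fun h => hne (le_bot_iff.1 h)
  obtain ⟨z, hz, hz0, hD⟩ := exists_annihilated
    (D := fun k => TensorProduct.map (dop (Sum.inr k)) (LinearMap.id : S.om μ →ₗ[ℂ] S.om μ))
    (fun k l z => by
      rw [← LinearMap.comp_apply, ← LinearMap.comp_apply, ← TensorProduct.map_comp,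
        ← TensorProduct.map_comp]
      have h1 : (dop (Sum.inr k) : Module.End ℂ (SAlg m n)) ∘ₗ dop (Sum.inr l) =
          -(dop (Sum.inr l) ∘ₗ dop (Sum.inr k)) := by
        refine LinearMap.ext fun a => ?_
        rw [LinearMap.comp_apply, dop_comm]; simp [idxPar]
      rw [h1, ← neg_one_smul ℂ, TensorProduct.map_smul_left]
      simp)
    (fun k z hz => by
      rw [LinearMap.mem_ker] at *
      rw [hq.theta_dop, hz, map_zero]) (fun k z hz => by
      rw [Submodule.mem_bot] at *; rw [hz, map_zero]) hne'
  apply hz0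
  obtain ⟨f, hf, rfl⟩ := (Submodule.mem_iSup_iff_exists_finsupp _ _).1
    (mem_iSup_tpow_of_dop_eq_zero fun k => (Submodule.mem_bot ℂ).1 (hD k))
  refine Submodule.sum_mem _ fun r hr => ?_
  have h1 := mem_of_sum_mem (T := fun i => S.ψ (del (Sum.inl i))) (W := ⊥) (etc_injective μ)
    (fun k v hv => by simp_all) f.support (fun r => S.theta μ (f r)) (by
      intro r _
      obtain ⟨u, hu⟩ := hf r
      rw [← hu]
      rw [TensorProduct.mk_apply, QPData.theta_tmul]
      exact hq.φ_ewt (tpow_mem_awt r) (QPData.om_le_ewt u.2)) (by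
      rw [← map_sum]; exact hz) r hr
  obtain ⟨u, hu⟩ := hf r
  rw [← hu, TensorProduct.mk_apply, QPData.theta_tmul, Submodule.mem_bot] at h1
  have h2 : (u : M) = 0 := by rw [← hq.φ_tpow_neg r (u : M), h1, map_zero]
  have h3 : u = 0 := Subtype.ext h2
  rw [← hu, h3, map_zero]
  exact zero_mem _

/-- The isomorphism `A ⊗ Ω ≃ M`. -/
def IsBased.thetaEquiv (hb : IsBased 𝓜 S μ) : (SAlg m n ⊗[ℂ] S.om μ) ≃ₗ[ℂ] M :=
  LinearEquiv.ofBijective (S.theta μ) ⟨hb.qp.theta_injective, hb.theta_surjective⟩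

theorem IsBased.thetaEquiv_apply (hb : IsBased 𝓜 S μ) (z : SAlg m n ⊗[ℂ] S.om μ) :
    hb.thetaEquiv z = S.theta μ z := rfl

/-- The evaluation `M → Ω`, `φ_a u ↦ ε(a) u`. -/
def IsBased.ev (hb : IsBased 𝓜 S μ) : M →ₗ[ℂ] S.om μ :=
  TensorProduct.lift ((LinearMap.lsmul ℂ (S.om μ)).comp aug) ∘ₗ hb.thetaEquiv.symm.toLinearMap

theorem IsBased.ev_φ_om (hb : IsBased 𝓜 S μ) (a : SAlg m n) (u : S.om μ) :
    hb.ev (S.φ a u) = aug a • u := by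
  have h : hb.thetaEquiv.symm (S.φ a u) = a ⊗ₜ u := by
    rw [LinearEquiv.symm_apply_eq, hb.thetaEquiv_apply, QPData.theta_tmul]
  simp [IsBased.ev, h]

theorem IsBased.ev_coe (hb : IsBased 𝓜 S μ) (u : S.om μ) : hb.ev u = u := by
  have h := hb.ev_φ_om 1 u
  rwa [hb.qp.φ_one, aug_one, one_smul] at h

theorem IsBased.ev_of_mem (hb : IsBased 𝓜 S μ) {v : M} (hv : v ∈ S.om μ) : (hb.ev v : M) = v :=
  congrArg Subtype.val (hb.ev_coe ⟨v, hv⟩)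

/-- Linear maps on `M` which agree on all `φ_a u` with `u ∈ Ω` are equal. -/
theorem IsBased.ext (hb : IsBased 𝓜 S μ) {V : Type*} [AddCommGroup V] [Module ℂ V]
    {f g : M →ₗ[ℂ] V} (h : ∀ a, ∀ u : S.om μ, f (S.φ a u) = g (S.φ a u)) : f = g := by
  refine LinearMap.ext fun v => ?_
  have h1 : S.gen (⊤ : Submodule ℂ (S.om μ)) ≤ LinearMap.ker (f - g) :=
    QPData.gen_le fun a u _ => by
      rw [LinearMap.mem_ker, LinearMap.sub_apply, h, sub_self]
  rw [hb.gen_top] at h1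
  have h2 := h1 (Submodule.mem_top (x := v))
  rwa [LinearMap.mem_ker, LinearMap.sub_apply, sub_eq_zero] at h2

/-- Evaluation is `A`-linear when `A` acts on the fibre through the augmentation. -/
theorem IsBased.ev_φ (hb : IsBased 𝓜 S μ) (a : SAlg m n) (v : M) :
    hb.ev (S.φ a v) = aug a • hb.ev v := by
  have h : hb.ev ∘ₗ S.φ a = aug a • hb.ev := hb.ext fun b u => by
    simp only [LinearMap.comp_apply, LinearMap.smul_apply]
    rw [← hb.qp.φ_mul, hb.ev_φ_om, hb.ev_φ_om, aug_mul, smul_smul]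
  exact LinearMap.congr_fun h v

theorem IsBased.ev_gen (hb : IsBased 𝓜 S μ) {U : Submodule ℂ (S.om μ)} {v : M}
    (hv : v ∈ S.gen U) : hb.ev v ∈ U :=
  (QPData.gen_le (W := U.comap hb.ev) fun a u hu => by
    change hb.ev _ ∈ U
    rw [hb.ev_φ_om]; exact U.smul_mem _ hu) hv

/-- Membership in `φ_A U` is detected by evaluation, modulo the derivatives `∂_k`. -/
theorem IsBased.mem_gen_of_ev (hb : IsBased 𝓜 S μ) {U : Submodule ℂ (S.om μ)} {r : Fin m → ℤ}
    {v : M} (hv : v ∈ S.ewt (μ + etc r)) (hD : ∀ k, S.ψ (del (Sum.inr k)) v ∈ S.gen U)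
    (he : hb.ev v ∈ U) : v ∈ S.gen U := by
  obtain ⟨w, hw, hwv, hw0⟩ := exists_kernel_mod (E := fun k => S.φ (zeta m k))
    hb.qp.dz_anticomm hb.qp.dz_zeta (fun k v hv => hb.qp.ψ_del_ewt _ hv)
    (fun k v hv => hb.qp.φ_ewt_zero (zeta_mem_awt k) hv) hb.qp.dz_gen
    (fun k => hb.qp.φ_gen _) hv hD
  have h1 := hb.qp.φ_ewt (tpow_mem_awt (-r)) hw
  rw [add_assoc, etc_neg, add_zero] at h1
  have h2 : S.φ (tpow n (-r)) w ∈ S.om μ := by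
    refine QPData.mem_om_iff.2 ⟨h1, fun k => ?_⟩
    rw [hb.qp.ψ_del_φ, hw0, dop_inr_tpow]; simp
  have h3 : hb.ev w ∈ U := by
    have := add_mem (hb.ev_gen hwv) he
    rwa [map_sub, sub_add_cancel] at this
  -- Since `aug (t^{-r}) = 1`, the evaluation of `w` is the vector `φ_{t^{-r}} w` of `Ω`.
  have h4 : hb.ev w = ⟨_, h2⟩ := by
    have := hb.ev_coe ⟨_, h2⟩
    rw [← this]
    simp [hb.ev_φ]
  rw [h4] at h3
  have h5 := QPData.mem_gen h3 (tpow n r)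
  rw [hb.qp.φ_tpow_neg'] at h5
  have := sub_mem h5 hwv
  rwa [sub_sub_cancel] at this

/-- A linear family of vectors, compatible with the derivations `∂_k`, lies in `φ_A U` as soon as
its evaluations lie in `U`. -/
theorem IsBased.family_mem_gen (hb : IsBased 𝓜 S μ) {U : Submodule ℂ (S.om μ)}
    (f : SAlg m n →ₗ[ℂ] M) (hf : ∀ k a, S.ψ (del (Sum.inr k)) (f a) = f (dop (Sum.inr k) a))
    (hw : ∀ r J, f (tpow n r * zetaI m J) ∈ S.ewt (μ + etc r)) (he : ∀ a, hb.ev (f a) ∈ U)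
    (a : SAlg m n) : f a ∈ S.gen U := by
  -- The image under `f` of the `t`-degree `r` part of `A`, intersected with the matching
  -- eigenspace, is stable under the `ψ_{∂_k}`. If it were not inside `φ_A U`, it would contain a
  -- vector outside whose derivatives are all inside, against `mem_gen_of_ev`.
  have key : ∀ r, (⨅ i, LinearMap.ker (dop (Sum.inl i) - etc r i • LinearMap.id :
      Module.End ℂ (SAlg m n))).map f ⊓ S.ewt (μ + etc r) ≤ S.gen U := by
    intro r
    by_contra hne
    obtain ⟨v, hv, hvZ, hD⟩ := exists_annihilated (D := fun k => S.ψ (del (Sum.inr k)))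
      hb.qp.dz_anticomm (fun k v hv => by
        refine ⟨?_, hb.qp.ψ_del_ewt _ hv.2⟩
        obtain ⟨b, hb', rfl⟩ := hv.1
        rw [hf]
        refine ⟨_, ?_, rfl⟩
        simp only [SetLike.mem_coe, Submodule.mem_iInf, LinearMap.mem_ker, LinearMap.sub_apply,
          LinearMap.smul_apply, LinearMap.id_apply, sub_eq_zero] at hb' ⊢
        intro i
        rw [dop_comm, hb', map_smul]
        simp [idxPar]) hb.qp.dz_gen hne
    apply hvZ
    refine hb.mem_gen_of_ev hv.2 hD ?_
    obtain ⟨b, -, rfl⟩ := hv.1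
    exact he b
  refine mem_of_monomials ((S.gen U).comap f) (fun r J => key r ⟨⟨_, ?_, rfl⟩, hw r J⟩) a
  simp only [SetLike.mem_coe, Submodule.mem_iInf, LinearMap.mem_ker, LinearMap.sub_apply,
    LinearMap.smul_apply, LinearMap.id_apply, sub_eq_zero]
  intro i
  have h1 := (mem_awt.1 (monomial_mem_awt r J)).2 (Sum.inl i)
  rw [torusCoeff, Sum.elim_inl, one_mul] at h1
  exact h1

end Structure

/-! ### The augmentation ideal -/

theorem aug_of_odd {a : SAlg m n} (ha : a ∈ par m n 1) : aug a = 0 := by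
  have h := aug_parityAut a
  rw [mem_par.1 ha, map_smul, sgn_one_one, neg_one_smul] at h
  exact eq_zero_of_eq_neg h.symm

/-- The sign can differ from `1` only on odd elements, where the augmentation is zero. After
evaluation, Koszul signs caused by moving past `b` disappear. -/
theorem aug_smul_sgn {q : ZMod 2} {b : SAlg m n} (hb : b ∈ par m n q) (p : ZMod 2) :
    sgn p q * aug b = aug b := by
  rcases zmod_two_cases q with rfl | rfl
  · simp
  · simp [aug_of_odd hb]

/-- Odd elements have augmentation zero, so the augmentation ideal contains the homogeneous
components of its elements. -/
theorem augIdeal_induction {P : SAlg m n → Prop} (hadd : ∀ a b, P a → P b → P (a + b))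
    (h : ∀ p, ∀ a ∈ par m n p, aug a = 0 → P a) (a : SAlg m n) (ha : aug a = 0) : P a := by
  obtain ⟨a₀, ha₀, a₁, ha₁, rfl⟩ := Submodule.mem_sup.1
    (show a ∈ par m n 0 ⊔ par m n 1 by rw [sup_eq_top]; trivial)
  rw [map_add, aug_of_odd ha₁, add_zero] at ha
  exact hadd _ _ (h 0 _ ha₀ ha) (h 1 _ ha₁ (aug_of_odd ha₁))

section Fibre

variable {M : Type*} [AddCommGroup M] [Module ℂ M] {𝓜 : ZMod 2 → Submodule ℂ M}
  {S : QPData (par m n) M} {μ : Fin (m + 1) → ℂ}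

/-! ### Operators on `Ω` -/

/-- The operator `u ↦ ev (ψ_x u)` on `Ω`. -/
def IsBased.X (hb : IsBased 𝓜 S μ) : QPg m n →ₗ[ℂ] Module.End ℂ (S.om μ) where
  toFun x := hb.ev ∘ₗ S.ψ x ∘ₗ (S.om μ).subtype
  map_add' x y := by ext u; simp
  map_smul' c x := by ext u; simp

theorem IsBased.X_apply (hb : IsBased 𝓜 S μ) (x : QPg m n) (u : S.om μ) :
    hb.X x u = hb.ev (S.ψ x u) := rfl

/-- `φ̂_{∂_α}` supercommutes with `ψ_{∂_k}`: the coefficient of `∂_k` is the constant `1` and `∂_k`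
has no component in `A`. -/
theorem IsQPModule.φhat_om (hq : IsQPModule 𝓜 S) (α : Idx m n) {u : M} (hu : u ∈ S.om μ) :
    S.φhat (del α) u ∈ S.om μ := by
  rw [QPData.mem_om_iff] at *
  refine ⟨hq.φhat_del_ewt α hu.1, fun k => ?_⟩
  have h := hq.φhat_del_ψ α (Sum.inr k) isSupercommutative_par.one_mem u
  rw [dd_one, hu.2, map_zero, dop_one, delA_inr, mul_zero, map_zero, map_zero, map_zero] at h
  simp only [LinearMap.zero_apply, sub_zero, smul_zero, add_zero] at h
  have h2 := congrArg (fun x => sgn (idxPar α) (0 + idxPar (Sum.inr k : Idx m n)) • x) h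
  simp only [smul_zero, smul_smul, sgn_mul_self, one_smul] at h2
  exact h2.symm

/-- The operator `-φ̂_{∂_α}` on `Ω`. -/
def IsBased.hop (hb : IsBased 𝓜 S μ) (α : Idx m n) : Module.End ℂ (S.om μ) :=
  -(hb.ev ∘ₗ S.φhat (del α) ∘ₗ (S.om μ).subtype)

theorem IsBased.hop_apply (hb : IsBased 𝓜 S μ) (α : Idx m n) (u : S.om μ) :
    hb.hop α u = -hb.ev (S.φhat (del α) u) := rfl

theorem IsBased.coe_hop (hb : IsBased 𝓜 S μ) (α : Idx m n) (u : S.om μ) :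
    (hb.hop α u : M) = -S.φhat (del α) u := by
  rw [hb.hop_apply, Submodule.coe_neg, hb.ev_of_mem (hb.qp.φhat_om α u.2)]

theorem IsBased.ev_φhat (hb : IsBased 𝓜 S μ) (α : Idx m n) (v : M) :
    hb.ev (S.φhat (del α) v) = -hb.hop α (hb.ev v) := by
  have h : hb.ev ∘ₗ S.φhat (del α) = -(hb.hop α ∘ₗ hb.ev) := hb.ext fun b u => by
    simp only [LinearMap.comp_apply, LinearMap.neg_apply]
    rw [hb.qp.φhat_del_φ, hb.ev_φ, hb.ev_φ_om, aug_twist, map_smul, hb.hop_apply, smul_neg, neg_neg]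
  exact LinearMap.congr_fun h v

/-- In `ψ_{a ∂_α} φ_b u = φ_{a ∂_α(b)} u ± φ_b ψ_{a ∂_α} u` the first term dies under evaluation
because `aug a = 0`. A vector field vanishing at the point therefore acts on the fibre. -/
theorem IsBased.ev_ψ (hb : IsBased 𝓜 S μ) (α : Idx m n) {a : SAlg m n} (ha : aug a = 0) (v : M) :
    hb.ev (S.ψ (dd α a) v) = hb.X (dd α a) (hb.ev v) := by
  refine augIdeal_induction (P := fun a => hb.ev (S.ψ (dd α a) v) = hb.X (dd α a) (hb.ev v))
    (fun a b ha hb' => ?_) (fun p a hp ha => ?_) a ha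
  · simp only [map_add, LinearMap.add_apply, ha, hb']
  · have h : hb.ev ∘ₗ S.ψ (dd α a) = hb.X (dd α a) ∘ₗ hb.ev := hb.ext fun b u => by
      simp only [LinearMap.comp_apply]
      induction b using par_induction with
      | hadd x y hx hy => simp only [map_add, LinearMap.add_apply, hx, hy]
      | h q b hq =>
        rw [hb.qp.ψ_φ_apply α hp hq, map_add, map_smul, hb.ev_φ, hb.ev_φ, hb.ev_φ_om, aug_mul, ha,
          zero_mul, zero_smul, zero_add, smul_smul, aug_smul_sgn hq, map_smul]
        rfl
    exact LinearMap.congr_fun h v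

/-- By `ev_ψ`, evaluating a product of two such operators gives the product of the induced ones, so
the bracket relation for `ψ` descends to `Ω`. -/
theorem IsBased.X_X (hb : IsBased 𝓜 S μ) {p q : ZMod 2} {a b : SAlg m n} (α β : Idx m n)
    (ha : a ∈ par m n p) (hb' : b ∈ par m n q) (ha0 : aug a = 0) (hb0 : aug b = 0) (u : S.om μ) :
    hb.X (dd α a) (hb.X (dd β b) u) =
      sgn (p + idxPar α) (q + idxPar β) • hb.X (dd β b) (hb.X (dd α a) u) +
      (hb.X (dd β (a * dop α b)) u -
        sgn (p + idxPar α) (q + idxPar β) • hb.X (dd α (b * dop β a)) u) := by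
  rw [hb.X_apply (dd β b), hb.X_apply (dd α a) u, ← hb.ev_ψ α ha0, ← hb.ev_ψ β hb0,
    hb.qp.ψ_ψ α β ha hb', map_add, map_sub, map_smul, map_smul]
  rfl

theorem IsBased.hop_X (hb : IsBased 𝓜 S μ) {q : ZMod 2} {b : SAlg m n} (α β : Idx m n)
    (hb' : b ∈ par m n q) (hb0 : aug b = 0) (u : S.om μ) :
    hb.hop α (hb.X (dd β b) u) =
      sgn (idxPar α) (q + idxPar β) • hb.X (dd β b) (hb.hop α u) +
      (aug (dop α b) • hb.hop β u - sgn (idxPar α) q • hb.X (dd α (b * delA β)) u) := by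
  have h := congrArg hb.ev (hb.qp.φhat_del_ψ α β hb' (u : M))
  rw [hb.ev_φhat, ← hb.X_apply] at h
  rw [neg_eq_iff_eq_neg.1 h]
  simp only [map_add, map_sub, map_smul, hb.ev_φ, hb.ev_ψ β hb0, hb.ev_φhat, hb.ev_coe,
    aug_mul, hb0, zero_mul, zero_smul, sub_zero, ← hb.X_apply, map_neg]
  simp only [smul_neg, neg_add, neg_neg]
  abel

theorem IsBased.hop_hop (hb : IsBased 𝓜 S μ) (α β : Idx m n) (u : S.om μ) :
    hb.hop α (hb.hop β u) = sgn (idxPar α) (idxPar β) • hb.hop β (hb.hop α u) +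
      (aug (delA α) • hb.hop β u - aug (delA β) • hb.hop α u) := by
  have h := congrArg hb.ev (hb.qp.φhat_φhat_del α β (u : M))
  simp only [map_add, map_sub, map_smul, hb.ev_φ, hb.ev_φhat, hb.ev_coe, map_neg, neg_neg,
    smul_neg] at h
  rw [h]
  abel

/-- Subspaces of `Ω` stable under the operators `X (a ∂_0)`, `ε(a) = 0`, and `-φ̂_{∂_α}`. -/
structure IsBased.IsStable (hb : IsBased 𝓜 S μ) (U : Submodule ℂ (S.om μ)) : Prop where
  X_mem : ∀ b, aug b = 0 → ∀ u ∈ U, hb.X (dd (Sum.inl 0) b) u ∈ U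
  hop_mem : ∀ α, ∀ u ∈ U, hb.hop α u ∈ U

/-- The commutator of `φ̂_{∂_α}` with `ψ_{b ∂_0}` contains `ψ_{b ∂_α}`, because `π(∂_0) = 1`;
`hop_X` is solved for this term. It reduces all directions `∂_α` to `∂_0`. -/
theorem IsBased.X_eq_hop (hb : IsBased 𝓜 S μ) {q : ZMod 2} {b : SAlg m n} (α : Idx m n)
    (hb' : b ∈ par m n q) (hb0 : aug b = 0) (u : S.om μ) :
    hb.X (dd α b) u = hb.X (dd (Sum.inl 0) b) (hb.hop α u) +
      sgn (idxPar α) q • (aug (dop α b) • hb.hop (Sum.inl 0) u -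
        hb.hop α (hb.X (dd (Sum.inl 0) b) u)) := by
  have e : idxPar (Sum.inl 0 : Idx m n) = 0 := rfl
  rw [hb.hop_X α (Sum.inl 0) hb' hb0, delA_zero, mul_one, e, add_zero]
  simp only [smul_sub, smul_add, smul_smul, sgn_mul_self, one_smul]
  abel

theorem IsBased.IsStable.X_mem' {hb : IsBased 𝓜 S μ} {U : Submodule ℂ (S.om μ)}
    (hU : hb.IsStable U) (α : Idx m n) {b : SAlg m n} (hb0 : aug b = 0) :
    ∀ u ∈ U, hb.X (dd α b) u ∈ U := by
  refine augIdeal_induction (P := fun b => ∀ u ∈ U, hb.X (dd α b) u ∈ U)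
    (fun a b ha hb' u hu => ?_) (fun p b hp hb0 u hu => ?_) b hb0
  · rw [map_add, map_add, LinearMap.add_apply]
    exact add_mem (ha u hu) (hb' u hu)
  · rw [hb.X_eq_hop α hp hb0]
    exact add_mem (hU.X_mem b hb0 _ (hU.hop_mem α u hu)) (U.smul_mem _
      (sub_mem (U.smul_mem _ (hU.hop_mem _ u hu)) (hU.hop_mem α _ (hU.X_mem b hb0 u hu))))

theorem IsBased.X_dd (hb : IsBased 𝓜 S μ) (α : Idx m n) (a : SAlg m n) (u : S.om μ) :
    hb.X (dd α a) u = aug a • rho μ α • u + hb.X (dd α (a - aug a • 1)) u := by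
  rw [map_sub, map_smul, map_sub, map_smul, dd_one, LinearMap.sub_apply, LinearMap.smul_apply,
    hb.X_apply (del α), QPData.ψ_del_om, map_smul, hb.ev_coe]
  abel

theorem IsQPModule.ψ_dz_ψ_om (hq : IsQPModule 𝓜 S) (α : Idx m n) (u : S.om μ) (k : Fin n)
    (a : SAlg m n) : S.ψ (del (Sum.inr k)) (S.ψ (dd α a) u) =
      S.ψ (dd α (dop (Sum.inr k) a)) u := by
  induction a using par_induction with
  | hadd x y hx hy => simp only [map_add, LinearMap.add_apply, hx, hy]
  | h p a ha => rw [hq.ψ_del_ψ _ _ ha, QPData.ψ_dz_om, map_zero, smul_zero, zero_add]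

/-- The family `a ↦ ψ_{a ∂_α} u` is compatible with the `∂_k` because they kill `u`, and its
evaluations stay in `U`: the constant part of `a` acts by a scalar, the rest by `X`. -/
theorem IsBased.IsStable.ψ_mem_gen {hb : IsBased 𝓜 S μ} {U : Submodule ℂ (S.om μ)}
    (hU : hb.IsStable U) (α : Idx m n) (a : SAlg m n) {u : S.om μ} (hu : u ∈ U) :
    S.ψ (dd α a) u ∈ S.gen U := by
  refine hb.family_mem_gen ((LinearMap.applyₗ (u : M)).comp (S.ψ ∘ₗ dd α)) (fun k a => ?_)
    (fun r J => ?_) (fun a => ?_) a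
  · exact hb.qp.ψ_dz_ψ_om α u k a
  · exact hb.qp.ψ_ewt (monomial_mem_awt r J) α (QPData.om_le_ewt u.2)
  · change hb.X (dd α a) u ∈ U
    rw [hb.X_dd]
    refine add_mem (U.smul_mem _ (U.smul_mem _ hu)) (hU.X_mem' α ?_ u hu)
    simp

/-- `φ_A U` is a submodule: by the Leibniz rule for `ψ_x φ_b u` it is enough to control `ψ_x u`,
which is the previous lemma. Simplicity of `M` then applies, whether or not `U` is homogeneous. -/
theorem IsBased.IsStable.gen_eq_top {hb : IsBased 𝓜 S μ} {U : Submodule ℂ (S.om μ)}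
    (hU : hb.IsStable U) (h0 : U ≠ ⊥) : S.gen U = ⊤ := by
  refine hb.eq_top ?_ (fun a => hb.qp.φ_gen a) (fun x v hv => ?_) (fun α => ?_)
  · obtain ⟨u, hu, hu0⟩ := Submodule.exists_mem_ne_zero_of_ne_bot h0
    intro h
    have h1 := QPData.mem_gen hu 1
    rw [h, hb.qp.φ_one, Submodule.mem_bot] at h1
    exact hu0 (Subtype.ext h1)
  · refine ψ_stable_of_monomials (fun α r J => ?_) x
    revert v
    refine QPData.gen_stable fun b u hu => ?_
    induction b using par_induction with
    | hadd x y hx hy => rw [map_add, LinearMap.add_apply, map_add]; exact add_mem hx hy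
    | h q b hq =>
      rw [hb.qp.ψ_φ_apply α (mem_awt.1 (monomial_mem_awt r J)).1 hq]
      exact add_mem (QPData.mem_gen hu _) (Submodule.smul_mem _ _
        (hb.qp.φ_gen _ _ (hU.ψ_mem_gen α _ hu)))
  · refine QPData.gen_stable fun b u hu => ?_
    rw [hb.qp.φhat_del_φ, ← neg_neg (S.φhat (del α) _), ← hb.coe_hop, map_neg]
    exact neg_mem (QPData.mem_gen (hU.hop_mem α u hu) _)

/-- Stable subspaces of `Ω` are trivial. -/
theorem IsBased.IsStable.eq_top {hb : IsBased 𝓜 S μ} {U : Submodule ℂ (S.om μ)}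
    (hU : hb.IsStable U) (h0 : U ≠ ⊥) : U = ⊤ := by
  refine eq_top_iff.2 fun u _ => ?_
  have h := hb.ev_gen (U := U) (v := (u : M)) (by rw [hU.gen_eq_top h0]; trivial)
  rwa [hb.ev_coe] at h

theorem IsBased.nontrivial_om (hb : IsBased 𝓜 S μ) : Nontrivial (S.om μ) := by
  have := hb.simple.nontrivial
  by_contra h
  have h1 : Subsingleton (S.om μ) := not_nontrivial_iff_subsingleton.1 h
  have h2 : S.gen (⊤ : Submodule ℂ (S.om μ)) ≤ ⊥ := QPData.gen_le fun a u _ => by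
    rw [Subsingleton.elim u 0]; simp
  rw [hb.gen_top] at h2
  exact bot_ne_top (le_bot_iff.1 h2).symm

/-! ### The action of `𝒯` -/

/-- The alternating sum `∑ (-1)^(|I| + τ(I, J \ I)) φ_{ζ_I} P(ζ_{J \ I})`. -/
def QPData.alt (S : QPData (par m n) M) (P : SAlg m n →ₗ[ℂ] M) (J : Finset (Fin n)) : M :=
  ∑ I ∈ J.powerset, (-1 : ℂ) ^ (I.card + tau I (J \ I)) • S.φ (zetaI m I) (P (zetaI m (J \ I)))

theorem zetaI_mem_par (J : Finset (Fin n)) : zetaI m J ∈ par m n (J.card : ZMod 2) := by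
  have h := (mem_awt.1 (zetaI_mem_awt (m := m) J)).1
  have e : wpar (zwt J) = (J.card : ZMod 2) := by
    simp [wpar, zwt]
  rwa [e] at h

theorem sgn_one_natCast (c : ℕ) : sgn 1 (c : ZMod 2) = (-1) ^ c := by
  induction c with
  | zero => simp
  | succ c ih => rw [Nat.cast_succ, sgn_add_right, ih, sgn_one_one, pow_succ]

theorem parityAut_zetaI (J : Finset (Fin n)) :
    parityAut m n (zetaI m J) = (-1 : ℂ) ^ J.card • zetaI m J := by
  rw [mem_par.1 (zetaI_mem_par J), sgn_one_natCast]

theorem zeta_mul_zetaI (k : Fin n) (J : Finset (Fin n)) :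
    zeta m k * zetaI m J = (-1 : ℂ) ^ J.card • (zetaI m J * zeta m k) := by
  rw [par_comm (zeta_mem_par k) (zetaI_mem_par J), sgn_one_natCast]

/-- The shifted family `a ↦ P(ζ_k ā) - φ_{ζ_k} P(ā)`. -/
def QPData.shift (S : QPData (par m n) M) (P : SAlg m n →ₗ[ℂ] M) (k : Fin n) : SAlg m n →ₗ[ℂ] M :=
  (P ∘ₗ LinearMap.mulLeft ℂ (zeta m k) - S.φ (zeta m k) ∘ₗ P) ∘ₗ (parityAut m n).toLinearMap

theorem QPData.shift_apply (P : SAlg m n →ₗ[ℂ] M) (k : Fin n) (a : SAlg m n) :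
    S.shift P k a = P (zeta m k * parityAut m n a) - S.φ (zeta m k) (P (parityAut m n a)) := rfl

theorem tau_insert_right {I K : Finset (Fin n)} {k : Fin n} (hk : k ∉ K) (hI : ∀ i ∈ I, k < i) :
    tau I (insert k K) = I.card + tau I K := by
  rw [tau, Finset.sum_insert hk, Finset.filter_true_of_mem hI]; rfl

theorem tau_insert_left {I K : Finset (Fin n)} {k : Fin n} (hK : ∀ j ∈ K, k < j) :
    tau (insert k I) K = tau I K := by
  refine Finset.sum_congr rfl fun j hj => ?_
  rw [Finset.filter_insert, if_neg (hK j hj).not_gt]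

/-- Subsets of `insert k J` come in pairs `I`, `insert k I`. For `k` smaller than all of `J` each
pair contributes one term of the shifted family, up to a common sign, so the alternating sum is an
iterated shift. -/
theorem IsQPModule.alt_insert (hq : IsQPModule 𝓜 S) (P : SAlg m n →ₗ[ℂ] M) {k : Fin n}
    {J : Finset (Fin n)} (hk : ∀ j ∈ J, k < j) :
    S.alt P (insert k J) = (-1 : ℂ) ^ J.card • S.alt (S.shift P k) J := by
  have hkJ : k ∉ J := fun h => lt_irrefl _ (hk k h)
  rw [QPData.alt, Finset.sum_powerset_insert hkJ, ← Finset.sum_add_distrib, QPData.alt,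
    Finset.smul_sum]
  refine Finset.sum_congr rfl fun I hI => ?_
  rw [Finset.mem_powerset] at hI
  have hkI : k ∉ I := fun h => hkJ (hI h)
  have e1 : insert k J \ I = insert k (J \ I) := Finset.insert_sdiff_of_notMem _ hkI
  have e2 : insert k J \ insert k I = J \ I := by
    rw [Finset.insert_sdiff_insert, Finset.sdiff_insert_of_notMem hkJ]
  have hK : ∀ j ∈ J \ I, k < j := fun j hj => hk j (Finset.mem_sdiff.1 hj).1
  rw [e1, e2, tau_insert_right (fun h => hkJ (Finset.mem_sdiff.1 h).1) fun i hi => hk i (hI hi),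
    tau_insert_left hK, Finset.card_insert_of_notMem hkI, zetaI_insert hK,
    zetaI_insert fun i hi => hk i (hI hi), zeta_mul_zetaI k I, map_smul, LinearMap.smul_apply,
    hq.φ_mul, QPData.shift_apply, parityAut_zetaI, mul_smul_comm, map_smul, map_smul, map_smul,
    ← smul_sub, map_smul, map_sub, smul_smul, smul_smul, smul_smul, smul_sub,
    ← Finset.card_sdiff_add_card_eq_card hI]
  have h1 : ∀ c : ℕ, ((-1 : ℂ) ^ c) * (-1) ^ c = 1 := fun c => by
    rw [← mul_pow]; simp
  have s1 : (-1 : ℂ) ^ (I.card + (I.card + tau I (J \ I))) =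
      (-1) ^ ((J \ I).card + I.card) * ((-1) ^ (I.card + tau I (J \ I)) * (-1) ^ (J \ I).card) := by
    simp only [pow_add]
    linear_combination (-(-1 : ℂ) ^ I.card * (-1) ^ I.card * (-1) ^ tau I (J \ I)) *
      h1 (J \ I).card
  have s2 : (-1 : ℂ) ^ (I.card + 1 + tau I (J \ I)) * (-1) ^ I.card =
      -((-1) ^ ((J \ I).card + I.card) *
        ((-1) ^ (I.card + tau I (J \ I)) * (-1) ^ (J \ I).card)) := by
    simp only [pow_add]
    linear_combination ((-1 : ℂ) ^ I.card * (-1) ^ I.card * (-1) ^ tau I (J \ I)) *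
      h1 (J \ I).card
  rw [s1, s2, neg_smul, sub_eq_add_neg]
  simp only [mul_assoc]

/-- The shift preserves compatibility with the `∂_l`: the two contributions of `∂_l ζ_k` cancel, and
the parity automorphism in its definition absorbs the remaining sign. After all shifts the sum is a
value at `1`, whose derivative is zero. -/
theorem IsQPModule.dz_alt (hq : IsQPModule 𝓜 S) (J : Finset (Fin n)) :
    ∀ P : SAlg m n →ₗ[ℂ] M,
      (∀ k a, S.ψ (del (Sum.inr k)) (P a) = P (dop (Sum.inr k) a)) →
      ∀ k, S.ψ (del (Sum.inr k)) (S.alt P J) = 0 := by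
  induction J using Finset.induction_on_min with
  | empty =>
    intro P hP k
    have h0 : tau (∅ : Finset (Fin n)) ∅ = 0 := rfl
    simp [QPData.alt, zetaI_empty, hP, dop_one]
  | insert j J hj ih =>
    intro P hP k
    rw [hq.alt_insert P hj, map_smul, ih, smul_zero]
    intro l a
    have e : dop (Sum.inr l) (parityAut m n a) = -parityAut m n (dop (Sum.inr l) a) := by
      rw [dop_inr, parityAut_dz, neg_neg]
    rw [QPData.shift_apply, QPData.shift_apply, map_sub, hP, hq.dz_zeta, hP,
      dop_mul_of_mem _ (zeta_mem_par j), dop_inr_zeta, e]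
    split_ifs <;> simp [idxPar]

theorem IsQPModule.alt_mem_om (hq : IsQPModule 𝓜 S) {J : Finset (Fin n)} {P : SAlg m n →ₗ[ℂ] M}
    (hP : ∀ k a, S.ψ (del (Sum.inr k)) (P a) = P (dop (Sum.inr k) a))
    (hw : ∀ K, P (zetaI m K) ∈ S.ewt μ) : S.alt P J ∈ S.om μ := by
  refine QPData.mem_om_iff.2 ⟨?_, hq.dz_alt J P hP⟩
  exact Submodule.sum_mem _ fun I _ => Submodule.smul_mem _ _
    (hq.φ_ewt_zero (zetaI_mem_awt I) (hw _))

/-- Only `I = ∅` survives, since every other `ζ_I` has augmentation zero. -/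
theorem IsBased.ev_alt (hb : IsBased 𝓜 S μ) (J : Finset (Fin n)) (P : SAlg m n →ₗ[ℂ] M) :
    hb.ev (S.alt P J) = hb.ev (P (zetaI m J)) := by
  rw [QPData.alt, map_sum, Finset.sum_eq_single ∅]
  · simp [zetaI_empty, tau]
  · intro I _ hI
    rw [map_smul, hb.ev_φ, aug_zetaI hI, zero_smul, smul_zero]
  · intro h; exact absurd (Finset.empty_mem_powerset _) h

/-- The family `a ↦ φ_{t^{-r}} (ψ_{t^r a ∂_α} u - c φ̂_{t^r a ∂_α} u)`. -/
def QPData.tfam (S : QPData (par m n) M) (r : Fin m → ℤ) (c : ℂ) (α : Idx m n) (u : M) :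
    SAlg m n →ₗ[ℂ] M :=
  S.φ (tpow n (-r)) ∘ₗ (LinearMap.applyₗ u).comp ((S.ψ - c • S.φhat) ∘ₗ dd α) ∘ₗ
    LinearMap.mulLeft ℂ (tpow n r)

theorem QPData.tfam_apply (r : Fin m → ℤ) (c : ℂ) (α : Idx m n) (u : M) (a : SAlg m n) :
    S.tfam r c α u a = S.φ (tpow n (-r)) (S.ψ (dd α (tpow n r * a)) u -
      c • S.φhat (dd α (tpow n r * a)) u) := rfl

theorem dop_inr_tpow_mul (k : Fin n) (r : Fin m → ℤ) (a : SAlg m n) :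
    dop (Sum.inr k) (tpow n r * a) = tpow n r * dop (Sum.inr k) a := by
  rw [dop_mul_of_mem _ (tpow_mem_par r), dop_inr_tpow, zero_mul, zero_add, sgn_zero_right, one_smul]

theorem IsQPModule.dz_tfam (hq : IsQPModule 𝓜 S) (r : Fin m → ℤ) (c : ℂ) (α : Idx m n)
    (u : S.om μ) (k : Fin n) (a : SAlg m n) :
    S.ψ (del (Sum.inr k)) (S.tfam r c α u a) = S.tfam r c α u (dop (Sum.inr k) a) := by
  rw [QPData.tfam_apply, QPData.tfam_apply, hq.ψ_del_φ, dop_inr_tpow, map_zero,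
    LinearMap.zero_apply, zero_add, twist_of_mem (tpow_mem_par _), sgn_zero_right, one_smul,
    map_sub, map_smul, hq.ψ_dz_ψ_om, hq.φhat_dd, hq.φhat_dd,
    hq.ψ_del_φ_om (⟨_, hq.φhat_om α u.2⟩ : S.om μ), dop_inr_tpow_mul]

theorem IsQPModule.tfam_ewt (hq : IsQPModule 𝓜 S) (r : Fin m → ℤ) (c : ℂ) (α : Idx m n)
    (u : S.om μ) (K : Finset (Fin n)) : S.tfam r c α u (zetaI m K) ∈ S.ewt μ := by
  have hu := QPData.om_le_ewt u.2
  have h1 := sub_mem (hq.ψ_ewt (monomial_mem_awt r K) α hu)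
    (Submodule.smul_mem _ c (hq.φ_ewt (monomial_mem_awt r K) (hq.φhat_del_ewt α hu)))
  have h2 := hq.φ_ewt (tpow_mem_awt (-r)) h1
  rw [add_assoc, etc_neg, add_zero] at h2
  rwa [QPData.tfam_apply, hq.φhat_dd]

/-- The alternating sum lies in `Ω` and hence equals its own evaluation, which has a single term. -/
theorem IsBased.coe_ev_alt_tfam (hb : IsBased 𝓜 S μ) (r : Fin m → ℤ) (c : ℂ) (α : Idx m n)
    (u : S.om μ) (J : Finset (Fin n)) :
    S.alt (S.tfam r c α u) J = (hb.X (dd α (tpow n r * zetaI m J)) u +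
      (c * aug (zetaI m J)) • hb.hop α u : S.om μ) := by
  rw [← hb.ev_of_mem (hb.qp.alt_mem_om (hb.qp.dz_tfam r c α u) (hb.qp.tfam_ewt r c α u)),
    hb.ev_alt, QPData.tfam_apply, hb.ev_φ, aug_tpow, one_smul, map_sub, map_smul, hb.qp.φhat_dd,
    hb.ev_φ, aug_mul, aug_tpow, one_mul, hb.ev_φhat, hb.ev_coe, smul_neg, smul_neg, sub_neg_eq_add,
    smul_smul]
  rfl

theorem alt_empty (P : SAlg m n →ₗ[ℂ] M) : S.alt P ∅ = P 1 := by
  rw [QPData.alt, Finset.powerset_empty, Finset.sum_singleton, zetaI_empty, Finset.sdiff_empty,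
    zetaI_empty, map_one]
  simp [tau]

theorem loopMul_single (i j : ℤ) (a : SAlg m n) (v : M) :
    loopMul S (Finsupp.single i a) (Finsupp.single j v) = Finsupp.single (i + j) (S.φ a v) := by
  rw [loopMul, Finsupp.lsum_single]
  change Finsupp.lsum ℂ (fun s => Finsupp.lsingle (i + s) ∘ₗ S.φ a) (Finsupp.single j v) = _
  rw [Finsupp.lsum_single]; rfl

theorem loopLie_single (i : ℤ) (x : QPg m n) (v : M) :
    loopLie S (Finsupp.single i x) (Finsupp.single 0 v) =
      Finsupp.single i (S.ψ x v - (i : ℂ) • S.φhat x v) := by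
  rw [loopLie, Finsupp.lsum_single]
  change Finsupp.lsum ℂ (fun s : ℤ => Finsupp.lsingle (i + s) ∘ₗ
    (S.ψ x - (i : ℂ) • S.φhat x + (s : ℂ) • S.φ (proj (par m n) x))) (Finsupp.single 0 v) = _
  rw [Finsupp.lsum_single]
  simp

theorem smashAct_tmul (r : Fin (m + 1) → ℤ) (I K : Finset (Fin n)) (α : Idx m n) (u : M) :
    smashAct S (bigMono (-r) I ⊗ₜ bigDer r K α) (Finsupp.single 0 u) =
      Finsupp.single 0 (S.φ (zetaI m I) (S.tfam (Fin.tail r) (r 0 : ℂ) α u (zetaI m K))) := by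
  have e : Fin.tail (-r) = -Fin.tail r := rfl
  have h : S.φ (tpow n (-Fin.tail r) * zetaI m I) =
      S.φ (zetaI m I) * S.φ (tpow n (-Fin.tail r)) := by
    rw [← map_mul, tpow_comm]
  have e2 : smashAct S (bigMono (-r) I ⊗ₜ bigDer r K α) =
      loopMul S (bigMono (-r) I) * loopLie S (bigDer r K α) := by
    rw [smashAct, TensorProduct.lift.tmul]; rfl
  rw [e2, Module.End.mul_apply, bigDer, loopLie_single, bigMono, loopMul_single, e, h, lmul_del,
    Pi.neg_apply, neg_add_cancel]
  rfl

set_option maxHeartbeats 400000 in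
/-- The action of `X_{r,J,∂_α}` on `Ω`. -/
theorem IsBased.smashAct_Xelt (hb : IsBased 𝓜 S μ) (r : Fin (m + 1) → ℤ) (J : Finset (Fin n))
    (α : Idx m n) (u : S.om μ) :
    smashAct S (Xelt r J α) (Finsupp.single 0 (u : M)) =
      Finsupp.single 0 (if J = ∅ then hb.X (dd α (tpow n (Fin.tail r) - 1)) u + (r 0 : ℂ) • hb.hop α u
        else hb.X (dd α (tpow n (Fin.tail r) * zetaI m J)) u : S.om μ).1 := by
  by_cases hJ : J = ∅
  · subst hJ
    have h1 := smashAct_tmul (S := S) r ∅ ∅ α (u : M)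
    have h2 := smashAct_tmul (S := S) (0 : Fin (m + 1) → ℤ) ∅ ∅ α (u : M)
    have h3 := hb.coe_ev_alt_tfam (Fin.tail r) (r 0) α u ∅
    rw [alt_empty, zetaI_empty, mul_one, aug_one, mul_one] at h3
    have e0 : Fin.tail (0 : Fin (m + 1) → ℤ) = 0 := rfl
    rw [neg_zero, zetaI_empty, map_one, QPData.tfam_apply, e0, neg_zero, tpow_zero, hb.qp.φ_one,
      mul_one, dd_one, Pi.zero_apply, Int.cast_zero, zero_smul, sub_zero] at h2
    rw [zetaI_empty, hb.qp.φ_one, h3] at h1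
    rw [Xelt, if_pos rfl, if_pos rfl, map_sub, LinearMap.sub_apply, h1, h2, ← Finsupp.single_sub]
    congr 1
    have h4 : ((hb.X (del α) u : S.om μ) : M) = S.ψ (del α) (u : M) := by
      rw [hb.X_apply, QPData.ψ_del_om, map_smul, hb.ev_coe]; rfl
    rw [map_sub, map_sub, dd_one, LinearMap.sub_apply, Submodule.coe_add, Submodule.coe_add,
      Submodule.coe_sub, h4]
    simp only [Module.End.one_apply]
    abel
  · have h3 := hb.coe_ev_alt_tfam (Fin.tail r) (r 0) α u J
    rw [aug_zetaI hJ, mul_zero, zero_smul, add_zero] at h3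
    rw [Xelt, if_neg hJ, if_neg hJ, map_sum, LinearMap.sum_apply, ← h3, QPData.alt,
      Finsupp.single_finsetSum]
    refine Finset.sum_congr rfl fun I _ => ?_
    rw [map_smul, LinearMap.smul_apply, smashAct_tmul, Finsupp.smul_single]

/-- The elements with `r_0 = 0` and direction `∂_0` give `X (b ∂_0)` for `b` in the augmentation
ideal; the element with `t^r = t_0` and `J = ∅` gives `-φ̂_{∂_α}` alone. -/
theorem IsBased.isStable_comap (hb : IsBased 𝓜 S μ) {U : Submodule ℂ M}
    (hT : S.IsTInvariant U) : hb.IsStable (U.comap (S.om μ).subtype) := by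
  have key : ∀ (r : Fin (m + 1) → ℤ) (J : Finset (Fin n)) (α : Idx m n), (J ≠ ∅ ∨ r ≠ 0) → ∀ u : S.om μ, (u : M) ∈ U →
      (if J = ∅ then hb.X (dd α (tpow n (Fin.tail r) - 1)) u + (r 0 : ℂ) • hb.hop α u
        else hb.X (dd α (tpow n (Fin.tail r) * zetaI m J)) u : S.om μ).1 ∈ U := by
    intro r J α h u hu
    obtain ⟨w, hw, he⟩ := hT (Xelt r J α) (Submodule.subset_span ⟨r, J, α, h, rfl⟩) u hu
    rw [hb.smashAct_Xelt] at he
    rwa [Finsupp.single_injective 0 he]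
  refine ⟨fun b hb0 u hu => ?_, fun α u hu => ?_⟩
  · change (u : M) ∈ U at hu
    change ((hb.X (dd (Sum.inl 0) b) u : S.om μ) : M) ∈ U
    -- The map `b ↦ b - aug b` projects onto the augmentation ideal, so the claim can be tested on
    -- monomials.
    have h := mem_of_monomials (U.comap ((S.om μ).subtype ∘ₗ (LinearMap.applyₗ u).comp
      (hb.X ∘ₗ dd (Sum.inl 0)) ∘ₗ (LinearMap.id - aug.smulRight 1))) (fun r J => ?_) b
    · simpa [hb0] using h
    · by_cases hJ : J = ∅
      · subst hJ
        by_cases hr : r = 0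
        · subst hr; simp [zetaI_empty, tpow_zero]
        -- The choice `r_0 = 0` suppresses the term with `φ̂`.
        · have h1 := key (Fin.cons 0 r) ∅ (Sum.inl 0) (Or.inr fun h0 => hr (by
            funext i; exact congrFun h0 i.succ)) u hu
          simpa [zetaI_empty] using h1
      · have h1 := key (Fin.cons 0 r) J (Sum.inl 0) (Or.inl hJ) u hu
        simpa [hJ, aug_mul, aug_zetaI hJ] using h1
  -- For `r = (1, 0, …, 0)` the coefficient `t^{r'} - 1` is zero and `r_0 = 1`.
  · have h1 := key (Fin.cons 1 0) ∅ α (Or.inr fun h0 => by simpa using congrFun h0 0) u hu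
    simpa [tpow_zero] using h1

theorem IsBased.isTInvariant (hb : IsBased 𝓜 S μ) {U : Submodule ℂ (S.om μ)}
    (hU : hb.IsStable U) : S.IsTInvariant (U.map (S.om μ).subtype) := by
  intro x hx u hu
  obtain ⟨u, hu, rfl⟩ := hu
  induction hx using Submodule.span_induction with
  | mem x hx =>
    obtain ⟨r, J, α, -, rfl⟩ := hx
    refine ⟨_, ⟨_, ?_, rfl⟩, hb.smashAct_Xelt r J α u⟩
    split_ifs with hJ
    · exact add_mem (hU.X_mem' α (by simp) u hu) (U.smul_mem _ (hU.hop_mem α u hu))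
    · exact hU.X_mem' α (by rw [aug_mul, aug_zetaI hJ, mul_zero]) u hu
  | zero => exact ⟨0, zero_mem _, by simp⟩
  | add x y _ _ hx hy =>
    obtain ⟨w, hw, hx⟩ := hx
    obtain ⟨w', hw', hy⟩ := hy
    exact ⟨w + w', add_mem hw hw', by rw [map_add, LinearMap.add_apply, hx, hy, Finsupp.single_add]⟩
  | smul c x _ hx =>
    obtain ⟨w, hw, hx⟩ := hx
    exact ⟨c • w, Submodule.smul_mem _ _ hw, by
      rw [map_smul, LinearMap.smul_apply, hx, Finsupp.smul_single]⟩

theorem IsBased.isStable_top (hb : IsBased 𝓜 S μ) : hb.IsStable ⊤ := ⟨fun _ _ _ _ => trivial, fun _ _ _ => trivial⟩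

end Fibre

/-! ### Local coordinates and Euler fields -/

/-- The local coordinates `t_i - 1`, `ζ_k` (and `0` for the index `0`). -/
def uu : Idx m n → SAlg m n :=
  Sum.elim (Fin.cases 0 fun i => tpow n (Pi.single i 1) - 1) (zeta m)

/-- The coefficients of the Euler fields `u_β ∂/∂u_β` with respect to the `∂_β`. -/
def uv : Idx m n → SAlg m n :=
  Sum.elim (Fin.cases 0 fun i => 1 - tpow n (-Pi.single i 1)) (zeta m)

theorem uu_zero : (uu (Sum.inl 0) : SAlg m n) = 0 := rfl

theorem uu_succ (i : Fin m) : (uu (Sum.inl i.succ) : SAlg m n) = tpow n (Pi.single i 1) - 1 := rfl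

theorem uu_inr (k : Fin n) : (uu (Sum.inr k) : SAlg m n) = zeta m k := rfl

theorem uv_zero : (uv (Sum.inl 0) : SAlg m n) = 0 := rfl

theorem uv_succ (i : Fin m) : (uv (Sum.inl i.succ) : SAlg m n) = 1 - tpow n (-Pi.single i 1) := rfl

theorem uv_inr (k : Fin n) : (uv (Sum.inr k) : SAlg m n) = zeta m k := rfl

theorem uu_mem_par (β : Idx m n) : uu β ∈ par m n (idxPar β) := by
  rcases β with i | k
  · refine Fin.cases (zero_mem _) (fun i => ?_) i
    exact sub_mem (tpow_mem_par _) isSupercommutative_par.one_mem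
  · exact zeta_mem_par k

theorem uv_mem_par (β : Idx m n) : uv β ∈ par m n (idxPar β) := by
  rcases β with i | k
  · refine Fin.cases (zero_mem _) (fun i => ?_) i
    exact sub_mem isSupercommutative_par.one_mem (tpow_mem_par _)
  · exact zeta_mem_par k

theorem aug_uu (β : Idx m n) : aug (uu β) = 0 := by
  rcases β with i | k
  · refine Fin.cases (by simp [uu_zero]) (fun i => ?_) i
    simp [uu_succ]
  · exact aug_zeta k

theorem aug_uv (β : Idx m n) : aug (uv β) = 0 := by
  rcases β with i | k
  · refine Fin.cases (by simp [uv_zero]) (fun i => ?_) i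
    simp [uv_succ]
  · exact aug_zeta k

theorem aug_dop_uu {α : Idx m n} (hα : α ≠ Sum.inl 0) (β : Idx m n) :
    aug (dop α (uu β)) = if α = β then 1 else 0 := by
  rcases β with i | k
  · refine Fin.cases ?_ (fun i => ?_) i
    · rw [uu_zero, map_zero, map_zero, if_neg hα]
    · rw [uu_succ, map_sub, dop_one, sub_zero]
      rcases α with j | l
      · revert hα
        refine Fin.cases (fun h => absurd rfl h) (fun j _ => ?_) j
        rw [dop_succ_tpow]
        by_cases h : j = i
        · subst h; simp
        · simp [h]
      · rw [dop_inr_tpow]; simp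
  · rcases α with j | l
    · rw [uu_inr, dop_inl_zeta]; simp
    · rw [uu_inr, dop_inr_zeta]; split_ifs <;> simp_all

theorem aug_dop_uv {α : Idx m n} (hα : α ≠ Sum.inl 0) (β : Idx m n) :
    aug (dop α (uv β)) = if α = β then 1 else 0 := by
  rcases β with i | k
  · refine Fin.cases ?_ (fun i => ?_) i
    · rw [uv_zero, map_zero, map_zero, if_neg hα]
    · rw [uv_succ, map_sub, dop_one, zero_sub]
      rcases α with j | l
      · revert hα
        refine Fin.cases (fun h => absurd rfl h) (fun j _ => ?_) j
        rw [dop_succ_tpow]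
        by_cases h : j = i
        · subst h; simp
        · simp [h]
      · rw [dop_inr_tpow]; simp
  · rcases α with j | l
    · rw [uv_inr, dop_inl_zeta]; simp
    · rw [uv_inr, dop_inr_zeta]; split_ifs <;> simp_all

/-- The Euler field `u_β ∂/∂u_β`. -/
def euler (β : Idx m n) : Module.End ℂ (SAlg m n) := LinearMap.mulLeft ℂ (uv β) ∘ₗ dop β

theorem euler_apply (β : Idx m n) (a : SAlg m n) : euler β a = uv β * dop β a := rfl

/-- The coefficient `uv β` and `∂_β` have the same parity, so the Euler field is even and obeys the
unsigned Leibniz rule. -/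
theorem euler_mul (β : Idx m n) (a b : SAlg m n) :
    euler β (a * b) = euler β a * b + a * euler β b := by
  induction a using par_induction with
  | hadd x y hx hy => rw [add_mul, map_add, hx, hy, map_add, add_mul, add_mul]; abel
  | h p a ha =>
    rw [euler_apply, dop_mul_of_mem β ha, mul_add, mul_smul_comm, ← mul_assoc, ← mul_assoc,
      par_comm (uv_mem_par β) ha, smul_mul_assoc, smul_smul, sgn_mul_self, one_smul, mul_assoc a]
    rfl

theorem euler_one (β : Idx m n) : euler β (1 : SAlg m n) = 0 := by
  rw [euler_apply, dop_one, mul_zero]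

theorem euler_uu (β γ : Idx m n) : euler β (uu γ) = if β = γ then uu γ else 0 := by
  rw [euler_apply]
  rcases γ with i | k
  · refine Fin.cases ?_ (fun i => ?_) i
    · simp [uu_zero]
    · rw [uu_succ, map_sub, dop_one, sub_zero]
      rcases β with j | l
      · refine Fin.cases ?_ (fun j => ?_) j
        · rw [uv_zero, zero_mul, if_neg]
          intro h; simpa using (Sum.inl.inj h).symm
        · rw [dop_succ_tpow, uv_succ]
          by_cases h : j = i
          · subst h; simp [sub_mul, tpow_neg_mul]
          · simp [h]
      · rw [dop_inr_tpow]; simp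
  · rcases β with j | l
    · rw [uu_inr, dop_inl_zeta]; simp
    · rw [uu_inr, dop_inr_zeta, uv_inr]
      by_cases h : l = k <;> simp [h]

theorem euler_pow (β : Idx m n) (k : ℕ) : euler β (uu β ^ k) = (k : ℂ) • uu β ^ k := by
  induction k with
  | zero => simp [euler_one]
  | succ k ih =>
    rw [pow_succ, euler_mul, ih, euler_uu, if_pos rfl, smul_mul_assoc, Nat.cast_succ, add_smul,
      one_smul]

theorem euler_zetaI (i : Fin (m + 1)) (J : Finset (Fin n)) :
    euler (Sum.inl i) (zetaI m J) = 0 := by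
  induction J using Finset.induction_on_min with
  | empty => rw [zetaI_empty, euler_one]
  | insert k J hk ih =>
    rw [zetaI_insert hk, euler_mul, ih, ← uu_inr, euler_uu]; simp

/-- The sum of all Euler fields. -/
def eul : Module.End ℂ (SAlg m n) := ∑ β, euler β

theorem eul_mul (a b : SAlg m n) : eul (a * b) = eul a * b + a * eul b := by
  simp only [eul, LinearMap.sum_apply, euler_mul, Finset.sum_add_distrib, Finset.sum_mul,
    Finset.mul_sum]

theorem eul_uu (γ : Idx m n) : eul (uu γ) = uu γ := by
  simp only [eul, LinearMap.sum_apply, euler_uu, Finset.sum_ite_eq', Finset.mem_univ, if_true]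

/-- The elements which vanish to second order. -/
def secondOrder : Submodule ℂ (SAlg m n) :=
  LinearMap.ker aug ⊓ ⨅ β, LinearMap.ker (aug ∘ₗ dop β)

theorem mem_secondOrder {a : SAlg m n} :
    a ∈ secondOrder ↔ aug a = 0 ∧ ∀ β, aug (dop β a) = 0 := by
  simp [secondOrder]

theorem secondOrder_mul_left (a : SAlg m n) {b : SAlg m n} (hb : b ∈ secondOrder) :
    a * b ∈ secondOrder := by
  rw [mem_secondOrder] at *
  refine ⟨by rw [aug_mul, hb.1, mul_zero], fun β => ?_⟩
  rw [dop_mul, map_add, aug_mul, aug_mul, hb.1, hb.2]; simp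

theorem mul_mem_secondOrder {a b : SAlg m n} (ha : aug a = 0) (hb : aug b = 0) :
    a * b ∈ secondOrder := by
  rw [mem_secondOrder]
  refine ⟨by rw [aug_mul, hb, mul_zero], fun β => ?_⟩
  rw [dop_mul, map_add, aug_mul, aug_mul, aug_twist, ha, hb]; simp

theorem uu_comm (i : Fin m) (a : SAlg m n) :
    uu (Sum.inl i.succ) * a = a * uu (Sum.inl i.succ) := by
  rw [uu_succ, sub_mul, mul_sub, tpow_comm, one_mul, mul_one]

theorem uu_pow_comm (i : Fin m) (k : ℕ) (a : SAlg m n) :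
    uu (Sum.inl i.succ) ^ k * a = a * uu (Sum.inl i.succ) ^ k :=
  (Commute.pow_left (uu_comm i a) k)

/-- The sum of the Euler eigenspaces of degree at least two, within the second order elements. -/
def highDeg : Submodule ℂ (SAlg m n) :=
  ⨆ j : ℕ, Module.End.eigenspace eul ((j : ℂ) + 2) ⊓ secondOrder

/-- The span of the multiples of the `(t_i - 1)^K`. -/
def powIdeal (K : ℕ) : Submodule ℂ (SAlg m n) :=
  ⨆ i : Fin m, LinearMap.range (LinearMap.mulLeft ℂ (uu (Sum.inl i.succ) ^ K : SAlg m n))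

theorem highDeg_le : (highDeg : Submodule ℂ (SAlg m n)) ≤ secondOrder :=
  iSup_le fun _ => inf_le_right

theorem powIdeal_le {K : ℕ} (hK : 2 ≤ K) : (powIdeal K : Submodule ℂ (SAlg m n)) ≤ secondOrder := by
  refine iSup_le fun i => ?_
  rintro _ ⟨a, rfl⟩
  rw [LinearMap.mulLeft_apply, uu_pow_comm]
  refine secondOrder_mul_left _ ?_
  obtain ⟨c, rfl⟩ := Nat.exists_eq_add_of_le hK
  rw [add_comm 2 c, pow_add, pow_two]
  exact secondOrder_mul_left _ (mul_mem_secondOrder (aug_uu _) (aug_uu _))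

theorem uu_mul_highDeg (β : Idx m n) {a : SAlg m n} (ha : a ∈ highDeg) : uu β * a ∈ highDeg := by
  have h : (highDeg : Submodule ℂ (SAlg m n)) ≤ highDeg.comap (LinearMap.mulLeft ℂ (uu β)) := by
    refine iSup_le fun j a ha => ?_
    refine Submodule.mem_iSup_of_mem (j + 1) ⟨?_, secondOrder_mul_left _ ha.2⟩
    have h1 := Module.End.mem_eigenspace_iff.1 ha.1
    refine Module.End.mem_eigenspace_iff.2 ?_
    rw [LinearMap.mulLeft_apply, eul_mul, h1, eul_uu, mul_smul_comm]
    push_cast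
    module
  exact h ha

theorem uu_mul_powIdeal (β : Idx m n) {K : ℕ} {a : SAlg m n} (ha : a ∈ powIdeal K) :
    uu β * a ∈ powIdeal K := by
  have h : (powIdeal K : Submodule ℂ (SAlg m n)) ≤
      (powIdeal K).comap (LinearMap.mulLeft ℂ (uu β)) := by
    refine iSup_le fun i => ?_
    rintro _ ⟨a, rfl⟩
    refine Submodule.mem_iSup_of_mem i ⟨uu β * a, ?_⟩
    simp only [LinearMap.mulLeft_apply]
    rw [← mul_assoc, uu_pow_comm, mul_assoc]
  exact h ha

/-- Polynomials in the local coordinates split into Euler degrees `0`, `1` and at least `2`.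
Inverses `t_i⁻¹` are not polynomials in `t_i - 1`, but become so modulo `(t_i - 1)^K`, which is why
the remainder `powIdeal K` is needed. -/
theorem sup_decomposition (K : ℕ) (a : SAlg m n) :
    a ∈ (ℂ ∙ (1 : SAlg m n)) ⊔ Submodule.span ℂ (Set.range uu) ⊔ (highDeg ⊔ powIdeal K) := by
  set Q : Submodule ℂ (SAlg m n) :=
    (ℂ ∙ (1 : SAlg m n)) ⊔ Submodule.span ℂ (Set.range uu) ⊔ (highDeg ⊔ powIdeal K) with hQ
  have hu : ∀ β, Submodule.span ℂ {(1 : SAlg m n)} ⊔ Submodule.span ℂ (Set.range uu) ⊔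
      (highDeg ⊔ powIdeal K) ≤ Q.comap (LinearMap.mulLeft ℂ (uu β)) := by
    intro β
    refine sup_le (sup_le ?_ ?_) (sup_le ?_ ?_)
    · rw [Submodule.span_le]
      rintro _ rfl
      change uu β * 1 ∈ Q
      rw [mul_one]
      exact Submodule.mem_sup_left (Submodule.mem_sup_right (Submodule.subset_span ⟨β, rfl⟩))
    · rw [Submodule.span_le]
      rintro _ ⟨γ, rfl⟩
      refine Submodule.mem_sup_right (Submodule.mem_sup_left (Submodule.mem_iSup_of_mem 0 ⟨?_,
        mul_mem_secondOrder (aug_uu _) (aug_uu _)⟩))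
      refine Module.End.mem_eigenspace_iff.2 ?_
      rw [LinearMap.mulLeft_apply, eul_mul, eul_uu, eul_uu]
      push_cast
      module
    · exact fun a ha => Submodule.mem_sup_right (Submodule.mem_sup_left (uu_mul_highDeg β ha))
    · exact fun a ha => Submodule.mem_sup_right (Submodule.mem_sup_right (uu_mul_powIdeal β ha))
  have hu' : ∀ β, ∀ a ∈ Q, uu β * a ∈ Q := fun β a ha => hu β ha
  refine mem_of_generators Q ?_ (fun k a ha => hu' (Sum.inr k) a ha) (fun i a ha => ?_)
    (fun i a ha => ?_) a
  · exact Submodule.mem_sup_left (Submodule.mem_sup_left (Submodule.mem_span_singleton_self _))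
  · have h := add_mem (hu' (Sum.inl i.succ) a ha) ha
    rwa [uu_succ, sub_mul, one_mul, sub_add_cancel] at h
  -- With `x = 1 - t_i`, the geometric series gives `t_i⁻¹ = ∑_{j < K} x^j + x^K t_i⁻¹`.
  · set x : SAlg m n := -uu (Sum.inl i.succ) with hx
    have hpow : ∀ j : ℕ, x ^ j * a ∈ Q := by
      intro j
      induction j with
      | zero => simpa using ha
      | succ j ih => rw [pow_succ', mul_assoc, hx, neg_mul]; exact neg_mem (hu' _ _ ih)
    have h1 : x - 1 = -tpow n (Pi.single i 1) := by rw [hx, uu_succ]; abel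
    have h2 := geom_sum_mul x K
    rw [h1] at h2
    have h3 : tpow n (-Pi.single i 1) =
        ∑ j ∈ Finset.range K, x ^ j + x ^ K * tpow n (-Pi.single i 1) := by
      have h4 := congrArg (fun y => y * tpow n (-Pi.single i 1)) h2
      simp only [mul_neg, neg_mul, mul_assoc, tpow_mul_neg, mul_one, sub_mul, one_mul] at h4
      rw [neg_eq_iff_eq_neg.1 h4]; abel
    rw [h3, add_mul, Finset.sum_mul]
    refine add_mem (Submodule.sum_mem _ fun j _ => hpow j) (Submodule.mem_sup_right
      (Submodule.mem_sup_right (Submodule.mem_iSup_of_mem i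
        ⟨(-1) ^ K * (tpow n (-Pi.single i 1) * a), ?_⟩)))
    rw [LinearMap.mulLeft_apply, hx, neg_pow (uu _) K, ← mul_assoc, uu_pow_comm, mul_assoc,
      mul_assoc, mul_assoc]

/-- An element of the augmentation ideal is a linear combination of the local coordinates, an
element of high degree and a multiple of some `(t_i - 1)^K`. -/
theorem exists_decomposition {K : ℕ} (hK : 2 ≤ K) {a : SAlg m n} (ha : aug a = 0) :
    ∃ x ∈ Submodule.span ℂ (Set.range (uu : Idx m n → SAlg m n)), ∃ y ∈ highDeg,
      ∃ z ∈ powIdeal K, a = x + (y + z) := by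
  obtain ⟨b, hb, w, hw, rfl⟩ := Submodule.mem_sup.1 (sup_decomposition K a)
  obtain ⟨c, hc, x, hx, rfl⟩ := Submodule.mem_sup.1 hb
  obtain ⟨y, hy, z, hz, rfl⟩ := Submodule.mem_sup.1 hw
  obtain ⟨c, rfl⟩ := Submodule.mem_span_singleton.1 hc
  have hx0 : aug x = 0 := by
    have : Submodule.span ℂ (Set.range (uu : Idx m n → SAlg m n)) ≤ LinearMap.ker aug :=
      Submodule.span_le.2 (by rintro _ ⟨β, rfl⟩; exact aug_uu β)
    exact this hx
  rw [map_add, map_add, map_add, hx0, (mem_secondOrder.1 (highDeg_le hy)).1,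
    (mem_secondOrder.1 (powIdeal_le hK hz)).1, map_smul, aug_one] at ha
  have hc0 : c = 0 := by simpa using ha
  exact ⟨x, hx, y, hy, z, hz, by rw [hc0, zero_smul, zero_add]⟩

/-- The linear part. -/
def linPart (a : SAlg m n) : SAlg m n := ∑ β, aug (dop β a) • uu β

theorem sub_linPart_mem {a : SAlg m n} (ha : aug a = 0) : a - linPart a ∈ secondOrder := by
  rw [mem_secondOrder]
  refine ⟨?_, fun β => ?_⟩
  · simp [linPart, ha, aug_uu]
  · by_cases hβ : β = Sum.inl 0
    · subst hβ; simp [dop_zero]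
    · simp only [linPart, map_sub, map_sum, map_smul, aug_dop_uu hβ, smul_eq_mul, mul_ite, mul_one,
        mul_zero, Finset.sum_ite_eq, Finset.mem_univ, if_true, sub_self]

/-- The linear term of the decomposition is detected by the values of the `∂_γ` at the point, and
these vanish on a second order element. -/
theorem secondOrder_le {K : ℕ} (hK : 2 ≤ K) :
    (secondOrder : Submodule ℂ (SAlg m n)) ≤ highDeg ⊔ powIdeal K := by
  intro a ha
  obtain ⟨x, hx, y, hy, z, hz, rfl⟩ := exists_decomposition hK (mem_secondOrder.1 ha).1
  have hx2 : x ∈ secondOrder := by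
    have := sub_mem ha (add_mem (highDeg_le hy) (powIdeal_le hK hz))
    rwa [add_sub_cancel_right] at this
  obtain ⟨c, rfl⟩ := (Submodule.mem_span_range_iff_exists_fun ℂ).1 hx
  have h0 : ∑ β, c β • uu β = (0 : SAlg m n) := by
    refine Finset.sum_eq_zero fun γ _ => ?_
    by_cases hγ : γ = Sum.inl 0
    · subst hγ; rw [uu_zero, smul_zero]
    · have h1 := (mem_secondOrder.1 hx2).2 γ
      simp only [map_sum, map_smul, aug_dop_uu hγ, smul_eq_mul, mul_ite, mul_one, mul_zero,
        Finset.sum_ite_eq, Finset.mem_univ, if_true] at h1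
      rw [h1, zero_smul]
  rw [h0, zero_add]
  exact Submodule.add_mem_sup hy hz

/-! ### Weights with respect to the odd variables -/

/-- The elements of weight `w` with respect to the `ζ_k ∂_k`. -/
def awz (w : Fin n → ℤ) : Submodule ℂ (SAlg m n) := ⨆ r, awt r w

theorem awz_mul {w w' : Fin n → ℤ} {a b : SAlg m n} (ha : a ∈ awz w) (hb : b ∈ awz w') :
    a * b ∈ awz (w + w') := by
  have h : (awz w : Submodule ℂ (SAlg m n)) ≤ (awz (w + w')).comap (LinearMap.mulRight ℂ b) := by
    refine iSup_le fun r a ha => ?_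
    have h' : (awz w' : Submodule ℂ (SAlg m n)) ≤ (awz (w + w')).comap (LinearMap.mulLeft ℂ a) :=
      iSup_le fun r' b hb => Submodule.mem_iSup_of_mem (r + r') (awt_mul ha hb)
    exact h' hb
  exact h ha

theorem awz_le_par (w : Fin n → ℤ) : (awz w : Submodule ℂ (SAlg m n)) ≤ par m n (wpar w) :=
  iSup_le fun _ _ ha => (mem_awt.1 ha).1

theorem tpow_mem_awz (r : Fin m → ℤ) : tpow n r ∈ awz 0 := Submodule.mem_iSup_of_mem r (tpow_mem_awt r)

theorem one_mem_awz : (1 : SAlg m n) ∈ awz 0 := tpow_mem_awz 0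

theorem zetaI_mem_awz (J : Finset (Fin n)) : zetaI m J ∈ awz (zwt J) :=
  Submodule.mem_iSup_of_mem 0 (zetaI_mem_awt J)

theorem awz_mul_zero {w : Fin n → ℤ} {a b : SAlg m n} (ha : a ∈ awz 0) (hb : b ∈ awz w) :
    a * b ∈ awz w := by
  have := awz_mul ha hb
  rwa [zero_add] at this

theorem uu_mem_awz (β : Idx m n) : uu β ∈ awz (dwt β) := by
  rcases β with i | k
  · refine Fin.cases (zero_mem _) (fun i => ?_) i
    exact sub_mem (tpow_mem_awz _) one_mem_awz
  · exact Submodule.mem_iSup_of_mem 0 (zeta_mem_awt k)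

theorem uv_mem_awz (β : Idx m n) : uv β ∈ awz (dwt β) := by
  rcases β with i | k
  · refine Fin.cases (zero_mem _) (fun i => ?_) i
    exact sub_mem one_mem_awz (tpow_mem_awz _)
  · exact Submodule.mem_iSup_of_mem 0 (zeta_mem_awt k)

theorem uu_pow_mem_awz (i : Fin m) (k : ℕ) : (uu (Sum.inl i.succ) ^ k : SAlg m n) ∈ awz 0 := by
  induction k with
  | zero => rw [pow_zero]; exact one_mem_awz
  | succ k ih => rw [pow_succ]; exact awz_mul_zero ih (uu_mem_awz (Sum.inl i.succ))

/-- Operators shifting the eigenvalue of the commutator with `E` by more and more vanish between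
finite dimensional spaces. -/
theorem exists_bound_of_commutator {V : Type*} [AddCommGroup V] [Module ℂ V] {W₁ W₂ : Submodule ℂ V}
    [FiniteDimensional ℂ W₁] [FiniteDimensional ℂ W₂] {E : Module.End ℂ V}
    (h₁ : ∀ v ∈ W₁, E v ∈ W₁) (h₂ : ∀ v ∈ W₂, E v ∈ W₂) {P : ℕ → Module.End ℂ V}
    (hP : ∀ k, ∀ v ∈ W₁, P k v ∈ W₂) {c : ℕ → ℂ} (hc : Function.Injective c)
    (hE : ∀ k v, E (P k v) = P k (E v) + c k • P k v) :
    ∃ K, ∀ k, K ≤ k → ∀ v ∈ W₁, P k v = 0 := by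
  -- `T` is the commutator with `E` on the finite dimensional space of maps `W₁ → W₂`. The `P k`
  -- satisfy its eigenvector equation for distinct scalars, so all but finitely many are zero.
  let T : Module.End ℂ (W₁ →ₗ[ℂ] W₂) :=
    { toFun := fun f => (E.restrict h₂) ∘ₗ f - f ∘ₗ (E.restrict h₁)
      map_add' := fun f g => by ext; simp; abel
      map_smul' := fun r f => by ext; simp [smul_sub] }
  let Q : ℕ → (W₁ →ₗ[ℂ] W₂) := fun k => (P k).restrict (hP k)
  have hT : ∀ k, T (Q k) = c k • Q k := fun k => by
    ext v
    change E (P k v) - P k (E v) = c k • P k v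
    rw [hE]; abel
  have hfin : {k | Q k ≠ 0}.Finite := by
    refine Set.Finite.of_finite_image (f := c) (T.finite_hasEigenvalue.subset ?_) hc.injOn
    rintro _ ⟨k, hk, rfl⟩
    exact Module.End.hasEigenvalue_of_hasEigenvector ⟨Module.End.mem_eigenspace_iff.2 (hT k), hk⟩
  obtain ⟨K, hK⟩ := hfin.bddAbove
  refine ⟨K + 1, fun k hk v hv => ?_⟩
  by_contra h
  have h1 : k ≤ K := hK (show Q k ≠ 0 from fun h0 => h (congrArg (fun f => (f ⟨v, hv⟩ : V)) h0))
  omega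

section Fibre

variable {M : Type*} [AddCommGroup M] [Module ℂ M] {𝓜 : ZMod 2 → Submodule ℂ M}
  {S : QPData (par m n) M} {μ : Fin (m + 1) → ℂ}

/-! ### Weights of `Ω` -/

/-- The weight spaces of `Ω` for the operators `ψ_{ζ_k ∂_k}`. -/
def IsBased.owt (hb : IsBased 𝓜 S μ) (l : Fin n → ℂ) : Submodule ℂ (S.om μ) :=
  weightSpace (fun k => hb.X (torus (Sum.inr k))) l

theorem IsBased.mem_owt (hb : IsBased 𝓜 S μ) {l : Fin n → ℂ} {u : S.om μ} :
    u ∈ hb.owt l ↔ ∀ k, hb.X (torus (Sum.inr k)) u = l k • u := mem_weightSpace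

theorem IsQPModule.om_torus (hq : IsQPModule 𝓜 S) (γ : Idx m n) {u : M} (hu : u ∈ S.om μ) :
    S.ψ (torus γ) u ∈ S.om μ := by
  refine QPData.mem_om_iff.2 ⟨hq.ewt_torus γ (QPData.om_le_ewt hu), fun l => ?_⟩
  rw [torus_eq]
  have h := hq.ψ_dz_ψ_om γ ⟨u, hu⟩ l (torusCoeff γ)
  rw [h, dop_torusCoeff]
  split_ifs
  · rw [Algebra.algebraMap_eq_smul_one, map_smul, dd_one, map_smul, LinearMap.smul_apply,
      ‹Sum.inr l = γ›.symm, QPData.ψ_dz_om, smul_zero]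
  · simp

theorem IsBased.coe_X_torus (hb : IsBased 𝓜 S μ) (γ : Idx m n) (u : S.om μ) :
    (hb.X (torus γ) u : M) = S.ψ (torus γ) u := hb.ev_of_mem (hb.qp.om_torus γ u.2)

theorem IsBased.mem_owt_iff (hb : IsBased 𝓜 S μ) {l : Fin n → ℂ} {u : S.om μ} :
    u ∈ hb.owt l ↔ (u : M) ∈ S.wt (Sum.elim μ l) := by
  rw [hb.mem_owt, QPData.mem_wt, Sum.forall]
  refine ⟨fun h => ⟨fun i => QPData.ψ_del_om u (Sum.inl i), fun k => ?_⟩, fun h k => ?_⟩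
  · rw [← hb.coe_X_torus, h]; rfl
  · exact Subtype.ext ((hb.coe_X_torus _ u).trans (h.2 k))

theorem IsBased.iSup_owt (hb : IsBased 𝓜 S μ) : ⨆ l, hb.owt l = ⊤ := by
  obtain ⟨l, p, hl, h⟩ := hb.le_iSup (Z := S.om μ) fun γ v hv => hb.qp.om_torus γ hv
  refine eq_top_iff.2 fun u _ => ?_
  have h1 : ⨆ g, S.om μ ⊓ S.pieces 𝓜 l p g ≤ (⨆ l, hb.owt l).map (S.om μ).subtype := by
    refine iSup_le fun g v hv => ⟨⟨v, hv.1⟩, Submodule.mem_iSup_of_mem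
      (fun k => (l + wtc g.1 g.2) (Sum.inr k)) (hb.mem_owt.2 fun k => ?_), rfl⟩
    refine Subtype.ext ((hb.coe_X_torus _ _).trans ?_)
    exact QPData.mem_wt.1 hv.2.1 (Sum.inr k)
  obtain ⟨w, hw, he⟩ := h1 (h u.2)
  rwa [← Subtype.ext he]

theorem zeta_mul_dop_of_mem_awz {w : Fin n → ℤ} {a : SAlg m n} (ha : a ∈ awz w) (k : Fin n) :
    zeta m k * dop (Sum.inr k) a = (w k : ℂ) • a := by
  have h : (awz w : Submodule ℂ (SAlg m n)) ≤ LinearMap.ker (LinearMap.mulLeft ℂ (zeta m k) ∘ₗ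
      dop (Sum.inr k) - (w k : ℂ) • LinearMap.id) := iSup_le fun r a ha => by
    have h1 := (mem_awt.1 ha).2 (Sum.inr k)
    rw [LinearMap.mem_ker, LinearMap.sub_apply, sub_eq_zero]
    exact h1
  have h2 := h ha
  rwa [LinearMap.mem_ker, LinearMap.sub_apply, sub_eq_zero] at h2

theorem IsBased.X_owt (hb : IsBased 𝓜 S μ) {w : Fin n → ℤ} {a : SAlg m n} (α : Idx m n)
    (ha : a ∈ awz w) (ha0 : aug a = 0) {l : Fin n → ℂ} {u : S.om μ} (hu : u ∈ hb.owt l) :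
    hb.X (dd α a) u ∈ hb.owt (l + fun k => ((w - dwt α) k : ℂ)) := by
  rw [hb.mem_owt] at *
  intro k
  have e : dop α (zeta m k) = ((dwt α k : ℤ) : ℂ) • 1 := by
    rcases α with i | j
    · simp [dop_inl_zeta, dwt]
    · rw [dop_inr_zeta]
      by_cases h : j = k
      · subst h; simp [dwt]
      · simp [dwt, h]
  have e2 : ((dwt α k : ℤ) : ℂ) • hb.X (dd (Sum.inr k) a) u =
      ((dwt α k : ℤ) : ℂ) • hb.X (dd α a) u := by
    rcases α with i | j
    · simp [dwt]
    · by_cases h : j = k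
      · subst h; rfl
      · simp [dwt, h]
  have h1 := hb.X_X (Sum.inr k) α (zeta_mem_par k) (awz_le_par w ha) (aug_zeta k) ha0 u
  rw [show (1 : ZMod 2) + idxPar (Sum.inr k : Idx m n) = 0 from rfl, sgn_zero_left, one_smul,
    one_smul, zeta_mul_dop_of_mem_awz ha, e, mul_smul_comm, mul_one] at h1
  rw [torus_inr, h1, ← torus_inr, hu, map_smul, map_smul, map_smul, map_smul, map_smul,
    LinearMap.smul_apply, LinearMap.smul_apply, e2]
  simp only [Pi.add_apply, Pi.sub_apply, Int.cast_sub]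
  module

theorem IsBased.X_owt' (hb : IsBased 𝓜 S μ) {a : SAlg m n} (α : Idx m n)
    (ha : a ∈ awz (dwt α)) (ha0 : aug a = 0) {l : Fin n → ℂ} {u : S.om μ} (hu : u ∈ hb.owt l) :
    hb.X (dd α a) u ∈ hb.owt l := by
  have h := hb.X_owt α ha ha0 hu
  rw [sub_self] at h
  convert h using 2
  ext; simp

theorem IsBased.hop_owt (hb : IsBased 𝓜 S μ) (α : Idx m n) {l : Fin n → ℂ} {u : S.om μ}
    (hu : u ∈ hb.owt l) : hb.hop α u ∈ hb.owt (l - fun k => (dwt α k : ℂ)) := by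
  rw [hb.mem_owt] at *
  intro k
  have h1 := hb.hop_X α (Sum.inr k) (zeta_mem_par k) (aug_zeta k) u
  rw [show (1 : ZMod 2) + idxPar (Sum.inr k : Idx m n) = 0 from rfl, sgn_zero_right, one_smul,
    delA_inr, mul_zero, map_zero, map_zero, ← torus_inr, hu, map_smul] at h1
  have e : aug (dop α (zeta m k)) • hb.hop (Sum.inr k) u = ((dwt α k : ℤ) : ℂ) • hb.hop α u := by
    rcases α with i | j
    · simp [dop_inl_zeta, dwt]
    · rw [dop_inr_zeta]
      by_cases h : j = k
      · subst h; simp [dwt]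
      · simp [dwt, h]
  rw [e, LinearMap.zero_apply, smul_zero, sub_zero] at h1
  rw [Pi.sub_apply, sub_smul]
  exact eq_sub_of_add_eq h1.symm

/-! ### Vanishing of the operators of second order -/

/-- When `a` has the parity of `∂_α` the field `a ∂_α` is even, and the reverse term of the bracket
is absent because `∂_0` annihilates `A`. No homogeneity of `b` is then needed. -/
theorem IsBased.even_X (hb : IsBased 𝓜 S μ) {α : Idx m n} {a : SAlg m n}
    (ha : a ∈ par m n (idxPar α)) (ha0 : aug a = 0) {b : SAlg m n} (hb0 : aug b = 0) (u : S.om μ) :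
    hb.X (dd α a) (hb.X (dd (Sum.inl 0) b) u) = hb.X (dd (Sum.inl 0) b) (hb.X (dd α a) u) +
      hb.X (dd (Sum.inl 0) (a * dop α b)) u := by
  refine augIdeal_induction (P := fun b => hb.X (dd α a) (hb.X (dd (Sum.inl 0) b) u) =
    hb.X (dd (Sum.inl 0) b) (hb.X (dd α a) u) + hb.X (dd (Sum.inl 0) (a * dop α b)) u)
    (fun x y hx hy => ?_) (fun q b hq hb0 => ?_) b hb0
  · simp only [map_add, LinearMap.add_apply, mul_add, hx, hy]; abel
  · rw [hb.X_X α (Sum.inl 0) ha hq ha0 hb0, idxPar_add_self, sgn_zero_left, dop_zero]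
    simp

theorem aug_uu_pow_mul (i : Fin m) (k : ℕ) (a : SAlg m n) :
    aug ((uu (Sum.inl i.succ) : SAlg m n) ^ (k + 1) * a) = 0 := by
  rw [pow_succ', mul_assoc, aug_mul, aug_uu, zero_mul]

/-- The field `a (t_i - 1) ∂/∂t_i` multiplies `(t_i - 1)^{k+1} ζ_J` by `(k + 1) a`. The case `a = 1`
gives eigenvectors of a commutator; the case `a = t^r` spreads vanishing to all monomial multiples.
-/
theorem IsBased.euler_X (hb : IsBased 𝓜 S μ) (i : Fin m) (J : Finset (Fin n)) (k : ℕ)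
    {a : SAlg m n} (ha : a ∈ par m n 0) (u : S.om μ) :
    hb.X (dd (Sum.inl i.succ) (a * uv (Sum.inl i.succ)))
        (hb.X (dd (Sum.inl 0) (uu (Sum.inl i.succ) ^ (k + 1) * zetaI m J)) u) =
      hb.X (dd (Sum.inl 0) (uu (Sum.inl i.succ) ^ (k + 1) * zetaI m J))
        (hb.X (dd (Sum.inl i.succ) (a * uv (Sum.inl i.succ))) u) +
      ((k + 1 : ℕ) : ℂ) •
        hb.X (dd (Sum.inl 0) (a * (uu (Sum.inl i.succ) ^ (k + 1) * zetaI m J))) u := by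
  have hp : a * uv (Sum.inl i.succ) ∈ par m n (idxPar (Sum.inl i.succ : Idx m n)) := by
    have := isSupercommutative_par.mul_mem ha (uv_mem_par (Sum.inl i.succ : Idx m n))
    rwa [zero_add] at this
  have e : a * uv (Sum.inl i.succ) * dop (Sum.inl i.succ) (uu (Sum.inl i.succ) ^ (k + 1) *
      zetaI m J) = ((k + 1 : ℕ) : ℂ) • (a * (uu (Sum.inl i.succ) ^ (k + 1) * zetaI m J)) := by
    rw [mul_assoc, ← euler_apply, euler_mul, euler_pow, euler_zetaI, mul_zero, add_zero,
      smul_mul_assoc, mul_smul_comm]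
  have h := hb.even_X hp (by rw [aug_mul, aug_uv, mul_zero]) (aug_uu_pow_mul i k (zetaI m J)) u
  rw [e] at h
  rw [h, map_smul, map_smul, LinearMap.smul_apply]

theorem IsBased.X_uv_owt (hb : IsBased 𝓜 S μ) (i : Fin m) {a : SAlg m n} (ha : a ∈ awz 0)
    {l : Fin n → ℂ} {u : S.om μ} (hu : u ∈ hb.owt l) :
    hb.X (dd (Sum.inl i.succ) (a * uv (Sum.inl i.succ))) u ∈ hb.owt l :=
  hb.X_owt' _ (awz_mul_zero ha (uv_mem_awz _)) (by rw [aug_mul, aug_uv, mul_zero]) hu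

/-- The commutator with the `i`-th Euler operator, which preserves all weight spaces, has eigenvalue
`k + 1` on these maps between two fixed finite dimensional weight spaces. The exponent `k + 1` keeps
the augmentation zero. -/
theorem IsBased.exists_monomial_bound (hb : IsBased 𝓜 S μ) [∀ l, FiniteDimensional ℂ (hb.owt l)]
    (l : Fin n → ℂ) (i : Fin m) (J : Finset (Fin n)) : ∃ K, ∀ k, K ≤ k → ∀ u ∈ hb.owt l,
      hb.X (dd (Sum.inl 0) (uu (Sum.inl i.succ) ^ (k + 1) * zetaI m J)) u = 0 := by
  let l' : Fin n → ℂ := l + fun k => ((zwt J - dwt (Sum.inl 0 : Idx m n) : Fin n → ℤ) k : ℂ)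
  have h1 : ∀ l, ∀ u ∈ hb.owt l,
      hb.X (dd (Sum.inl i.succ) (1 * uv (Sum.inl i.succ))) u ∈ hb.owt l :=
    fun l u hu => hb.X_uv_owt i one_mem_awz hu
  have h2 : ∀ k : ℕ, ∀ u ∈ hb.owt l,
      hb.X (dd (Sum.inl 0) (uu (Sum.inl i.succ) ^ (k + 1) * zetaI m J)) u ∈ hb.owt l' :=
    fun k u hu => hb.X_owt _ (awz_mul_zero (uu_pow_mem_awz i _) (zetaI_mem_awz J))
      (aug_uu_pow_mul i k _) hu
  have hc : Function.Injective fun k : ℕ => ((k + 1 : ℕ) : ℂ) := fun a b h => by simpa using h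
  refine exists_bound_of_commutator (h1 l) (h1 l') h2 hc fun k u => ?_
  have h3 := hb.euler_X i J k isSupercommutative_par.one_mem u
  rwa [one_mul (uu _ ^ _ * _)] at h3

theorem IsBased.X_mul_eq_zero (hb : IsBased 𝓜 S μ) {w : SAlg m n} {u : S.om μ}
    (h : ∀ r J, hb.X (dd (Sum.inl 0) (tpow n r * (w * zetaI m J))) u = 0)
    (hw : ∀ a, w * a = a * w) (a : SAlg m n) : hb.X (dd (Sum.inl 0) (w * a)) u = 0 :=
  mem_of_monomials (LinearMap.ker ((LinearMap.applyₗ u).comp (hb.X ∘ₗ dd (Sum.inl 0)) ∘ₗ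
    LinearMap.mulLeft ℂ w)) (fun r J => by
      rw [LinearMap.mem_ker, LinearMap.comp_apply, LinearMap.mulLeft_apply, ← mul_assoc, hw,
        mul_assoc]
      exact h r J) a

/-- A bound uniform in the finitely many `i` and `J` handles the coefficients `ζ_J`; the factors
`t^r` follow from `euler_X` with `a = t^r`, whose other terms vanish on the same weight space. -/
theorem IsBased.exists_pow_bound (hb : IsBased 𝓜 S μ) [∀ l, FiniteDimensional ℂ (hb.owt l)]
    (l : Fin n → ℂ) : ∃ K, 2 ≤ K ∧ ∀ b ∈ (powIdeal K : Submodule ℂ (SAlg m n)), ∀ u ∈ hb.owt l,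
      hb.X (dd (Sum.inl 0) b) u = 0 := by
  choose K hK using hb.exists_monomial_bound l
  -- The sum dominates every individual bound, and the two extra units make the exponent at least
  -- `2`.
  refine ⟨1 + ∑ i, ∑ J, K i J + 1, by omega, fun b hb' u hu => ?_⟩
  set L := 1 + ∑ i, ∑ J, K i J with hL
  have hz : ∀ (i : Fin m) (a : SAlg m n),
      hb.X (dd (Sum.inl 0) (uu (Sum.inl i.succ) ^ (L + 1) * a)) u = 0 := by
    intro i
    refine hb.X_mul_eq_zero (fun r J => ?_) (uu_pow_comm i _)
    have hKL : K i J ≤ L := by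
      have h1 : K i J ≤ ∑ J, K i J :=
        Finset.single_le_sum (f := fun J => K i J) (fun _ _ => Nat.zero_le _) (Finset.mem_univ J)
      have h2 : ∑ J, K i J ≤ ∑ i, ∑ J, K i J :=
        Finset.single_le_sum (f := fun i => ∑ J, K i J) (fun _ _ => Nat.zero_le _)
          (Finset.mem_univ i)
      omega
    have hz := hK i J L hKL
    have h1 := hb.euler_X i J L (tpow_mem_par r) u
    rw [hz u hu, map_zero, hz _ (hb.X_uv_owt i (tpow_mem_awz r) hu), zero_add] at h1
    exact (smul_eq_zero.1 h1.symm).resolve_left (Nat.cast_ne_zero.2 (Nat.succ_ne_zero L))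
  have hle : (powIdeal (L + 1) : Submodule ℂ (SAlg m n)) ≤
      LinearMap.ker ((LinearMap.applyₗ u).comp (hb.X ∘ₗ dd (Sum.inl 0))) := by
    refine iSup_le fun i => ?_
    rintro _ ⟨a, rfl⟩
    exact hz i a
  exact hle hb'

/-- The total Euler operator on `Ω`. -/
def IsBased.etot (hb : IsBased 𝓜 S μ) : Module.End ℂ (S.om μ) :=
  ∑ β, hb.X (dd β (uv β)) + hb.hop (Sum.inl 0)

theorem IsBased.etot_apply (hb : IsBased 𝓜 S μ) (u : S.om μ) :
    hb.etot u = ∑ β, hb.X (dd β (uv β)) u + hb.hop (Sum.inl 0) u := by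
  rw [IsBased.etot, LinearMap.add_apply, LinearMap.sum_apply]

/-- The Euler fields contribute the degree of `b` and the summand `-φ̂_{∂_0}` contributes `-1`. Thus
linear `b` commute with `etot` and Euler eigenvectors of degree at least two raise its eigenvalue.
-/
theorem IsBased.etot_X (hb : IsBased 𝓜 S μ) {b : SAlg m n} (hb0 : aug b = 0) (u : S.om μ) :
    hb.etot (hb.X (dd (Sum.inl 0) b) u) = hb.X (dd (Sum.inl 0) b) (hb.etot u) +
      (hb.X (dd (Sum.inl 0) (eul b)) u - hb.X (dd (Sum.inl 0) b) u) := by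
  have h : hb.hop (Sum.inl 0) (hb.X (dd (Sum.inl 0) b) u) =
      hb.X (dd (Sum.inl 0) b) (hb.hop (Sum.inl 0) u) - hb.X (dd (Sum.inl 0) b) u := by
    refine augIdeal_induction (P := fun b => hb.hop (Sum.inl 0) (hb.X (dd (Sum.inl 0) b) u) =
      hb.X (dd (Sum.inl 0) b) (hb.hop (Sum.inl 0) u) - hb.X (dd (Sum.inl 0) b) u)
      (fun x y hx hy => ?_) (fun q b hq hb0 => ?_) b hb0
    · simp only [map_add, LinearMap.add_apply, hx, hy]; abel
    · rw [hb.hop_X _ _ hq hb0, dop_zero, delA_zero, mul_one,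
        show idxPar (Sum.inl 0 : Idx m n) = 0 from rfl]
      simp [sub_eq_add_neg]
  have h2 : ∑ β, hb.X (dd β (uv β)) (hb.X (dd (Sum.inl 0) b) u) =
      hb.X (dd (Sum.inl 0) b) (∑ β, hb.X (dd β (uv β)) u) + hb.X (dd (Sum.inl 0) (eul b)) u := by
    have e : hb.X (dd (Sum.inl 0) (eul b)) u =
        ∑ β, hb.X (dd (Sum.inl 0) (uv β * dop β b)) u := by
      rw [eul, LinearMap.sum_apply, map_sum, map_sum, LinearMap.sum_apply]; rfl
    rw [e, map_sum, ← Finset.sum_add_distrib]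
    exact Finset.sum_congr rfl fun β _ => hb.even_X (uv_mem_par β) (aug_uv β) hb0 u
  rw [hb.etot_apply, hb.etot_apply, h, h2, map_add]
  abel

/-- For `α ≠ 0` the Euler fields together produce one copy of `hop α`, which the commutator with
`hop 0` removes; this is the reason for the summand `hop 0` in `etot`. -/
theorem IsBased.etot_hop (hb : IsBased 𝓜 S μ) (α : Idx m n) (u : S.om μ) :
    hb.etot (hb.hop α u) = hb.hop α (hb.etot u) := by
  have e0 : ∀ β : Idx m n, uv β * delA β = 0 := fun β => by
    by_cases h : β = Sum.inl 0
    · subst h; rw [uv_zero, zero_mul]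
    · rw [delA_of_ne h, mul_zero]
  have h1 : ∀ β, hb.hop α (hb.X (dd β (uv β)) u) = hb.X (dd β (uv β)) (hb.hop α u) +
      aug (dop α (uv β)) • hb.hop β u := fun β => by
    rw [hb.hop_X α β (uv_mem_par β) (aug_uv β), idxPar_add_self, e0]
    simp
  rw [hb.etot_apply, hb.etot_apply, map_add, map_sum, Finset.sum_congr rfl fun β _ => h1 β,
    Finset.sum_add_distrib, hb.hop_hop α (Sum.inl 0), delA_zero,
    show idxPar (Sum.inl 0 : Idx m n) = 0 from rfl, sgn_zero_right, one_smul, aug_one, one_smul]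
  by_cases h : α = Sum.inl 0
  · subst h
    simp only [dop_zero, LinearMap.zero_apply, map_zero, zero_smul, Finset.sum_const_zero, delA_zero, aug_one, one_smul]
    abel
  · simp only [aug_dop_uv h, ite_smul, one_smul, zero_smul, Finset.sum_ite_eq, Finset.mem_univ,
      if_true, delA_of_ne h, map_zero]
    abel

theorem IsBased.etot_owt (hb : IsBased 𝓜 S μ) {l : Fin n → ℂ} {u : S.om μ} (hu : u ∈ hb.owt l) :
    hb.etot u ∈ hb.owt l := by
  rw [hb.etot_apply]
  refine add_mem (Submodule.sum_mem _ fun β _ => hb.X_owt' _ (uv_mem_awz β) (aug_uv β) hu) ?_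
  have h := hb.hop_owt (Sum.inl 0) hu
  convert h using 2
  ext; simp [dwt]

/-- `etot` preserves each weight space, and there the torus acts by scalars. -/
theorem IsBased.etot_torus (hb : IsBased 𝓜 S μ) (k : Fin n) (u : S.om μ) :
    hb.etot (hb.X (torus (Sum.inr k)) u) = hb.X (torus (Sum.inr k)) (hb.etot u) := by
  have h : ⨆ l, hb.owt l ≤ LinearMap.ker (hb.etot ∘ₗ hb.X (torus (Sum.inr k)) -
      hb.X (torus (Sum.inr k)) ∘ₗ hb.etot) := iSup_le fun l u hu => by
    rw [LinearMap.mem_ker, LinearMap.sub_apply, LinearMap.comp_apply, LinearMap.comp_apply,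
      hb.mem_owt.1 hu, hb.mem_owt.1 (hb.etot_owt hu), map_smul, sub_self]
  rw [hb.iSup_owt] at h
  exact sub_eq_zero.1 (h (Submodule.mem_top (x := u)))

theorem IsBased.eigenspace_le (hb : IsBased 𝓜 S μ) (d : ℂ) :
    Module.End.eigenspace hb.etot d ≤ ⨆ l, Module.End.eigenspace hb.etot d ⊓ hb.owt l := by
  have h := inf_iSup_weight_le (T := fun k => hb.X (torus (Sum.inr k)))
    (l := fun l : Fin n → ℂ => l) (W := Module.End.eigenspace hb.etot d) (P := hb.owt)
    (fun _ _ h => h) (fun k v hv => by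
      rw [Module.End.mem_eigenspace_iff] at *
      rw [hb.etot_torus, hv, map_smul]) (fun _ => le_rfl)
  rwa [hb.iSup_owt, inf_top_eq] at h

theorem IsBased.X_eigen (hb : IsBased 𝓜 S μ) {b : SAlg m n} (hb0 : aug b = 0) {c d : ℂ}
    (hc : eul b = c • b) {u : S.om μ} (hu : u ∈ Module.End.eigenspace hb.etot d) :
    hb.X (dd (Sum.inl 0) b) u ∈ Module.End.eigenspace hb.etot (d + (c - 1)) := by
  rw [Module.End.mem_eigenspace_iff] at *
  rw [hb.etot_X hb0, hu, hc, map_smul, map_smul, map_smul, LinearMap.smul_apply]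
  module

theorem IsBased.X_highDeg (hb : IsBased 𝓜 S μ) {y : SAlg m n} (hy : y ∈ highDeg) {d : ℂ}
    {u : S.om μ} (hu : u ∈ Module.End.eigenspace hb.etot d) :
    hb.X (dd (Sum.inl 0) y) u ∈ ⨆ j : ℕ, Module.End.eigenspace hb.etot (d + 1 + j) := by
  have h : (highDeg : Submodule ℂ (SAlg m n)) ≤ (⨆ j : ℕ, Module.End.eigenspace hb.etot
      (d + 1 + j)).comap ((LinearMap.applyₗ u).comp (hb.X ∘ₗ dd (Sum.inl 0))) := by
    refine iSup_le fun j b hb' => Submodule.mem_iSup_of_mem j ?_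
    have h1 := hb.X_eigen (mem_secondOrder.1 hb'.2).1 (Module.End.mem_eigenspace_iff.1 hb'.1) hu
    rwa [show d + ((j : ℂ) + 2 - 1) = d + 1 + j by ring] at h1
  exact h hy

/-- On a single weight space the coefficient splits into a linear part, which preserves eigenvalues,
a part of high degree, which raises them by positive integers, and a multiple of high powers, which
acts by zero. -/
theorem IsBased.isStable_iSup_eigenspace (hb : IsBased 𝓜 S μ)
    [∀ l, FiniteDimensional ℂ (hb.owt l)] (c : ℂ) :
    hb.IsStable (⨆ j : ℕ, Module.End.eigenspace hb.etot (c + j)) := by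
  refine ⟨fun b hb0 => iSup_stable fun j u hu => ?_, fun α => iSup_stable fun j u hu => ?_⟩
  · have h : ⨆ l, Module.End.eigenspace hb.etot (c + j) ⊓ hb.owt l ≤
        (⨆ j : ℕ, Module.End.eigenspace hb.etot (c + j)).comap (hb.X (dd (Sum.inl 0) b)) := by
      refine iSup_le fun l u hu => ?_
      obtain ⟨K, hK, hz⟩ := hb.exists_pow_bound l
      obtain ⟨x, hx, y, hy, z, hz', rfl⟩ := exists_decomposition hK hb0
      rw [Submodule.mem_comap, map_add, map_add, map_add, map_add, LinearMap.add_apply,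
        LinearMap.add_apply, hz z hz' u hu.2, add_zero]
      refine add_mem ?_ ?_
      · have h1 : Submodule.span ℂ (Set.range (uu : Idx m n → SAlg m n)) ≤
            (Module.End.eigenspace hb.etot (c + j)).comap
              ((LinearMap.applyₗ u).comp (hb.X ∘ₗ dd (Sum.inl 0))) := by
          rw [Submodule.span_le]
          rintro _ ⟨β, rfl⟩
          have h2 := hb.X_eigen (aug_uu β) (c := 1) (by rw [eul_uu, one_smul]) hu.1
          rwa [sub_self, add_zero] at h2
        exact Submodule.mem_iSup_of_mem j (h1 hx)
      · refine (iSup_le fun i => ?_ : (⨆ i : ℕ, Module.End.eigenspace hb.etot (c + j + 1 + i)) ≤ _)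
          (hb.X_highDeg hy hu.1)
        refine le_iSup_of_le (j + 1 + i) (le_of_eq ?_)
        push_cast
        congr 1
        ring
    exact h (hb.eigenspace_le _ hu)
  · refine Submodule.mem_iSup_of_mem j ?_
    rw [Module.End.mem_eigenspace_iff] at *
    rw [hb.etot_hop, hu, map_smul]

/-- `etot` has an eigenvalue `c` on some weight space, so the stable sum along `c + ℕ` is all of
`Ω`. The sum along `c + 1 + ℕ` is also stable but omits the eigenvector, so it is zero, and raising
operators have nowhere to land. -/
theorem IsBased.X_highDeg_eq_zero (hb : IsBased 𝓜 S μ) [∀ l, FiniteDimensional ℂ (hb.owt l)]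
    {y : SAlg m n} (hy : y ∈ highDeg) (u : S.om μ) : hb.X (dd (Sum.inl 0) y) u = 0 := by
  have hnt := hb.nontrivial_om
  obtain ⟨l, hl⟩ : ∃ l, hb.owt l ≠ ⊥ := by
    by_contra h
    push Not at h
    have := hb.iSup_owt
    simp only [h, iSup_bot] at this
    exact bot_ne_top this
  have : Nontrivial (hb.owt l) := Submodule.nontrivial_iff_ne_bot.2 hl
  obtain ⟨c, hc⟩ := Module.End.exists_eigenvalue (hb.etot.restrict fun u hu => hb.etot_owt (l := l) hu)
  obtain ⟨v, hv⟩ := hc.exists_hasEigenvector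
  have hv1 : (v : S.om μ) ∈ Module.End.eigenspace hb.etot c :=
    Module.End.mem_eigenspace_iff.2 (congrArg Subtype.val hv.apply_eq_smul)
  have hv0 : (v : S.om μ) ≠ 0 := fun h => hv.2 (Subtype.ext h)
  have htop : ⨆ j : ℕ, Module.End.eigenspace hb.etot (c + j) = ⊤ := by
    refine (hb.isStable_iSup_eigenspace c).eq_top fun h => hv0 ?_
    rw [← Submodule.mem_bot ℂ, ← h]
    exact Submodule.mem_iSup_of_mem 0 (by simpa using hv1)
  have hbot : ⨆ j : ℕ, Module.End.eigenspace hb.etot (c + 1 + j) = ⊥ := by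
    by_contra h
    have h1 := (hb.isStable_iSup_eigenspace (c + 1)).eq_top h
    -- The family is reindexed along `c + ℕ` with the zero subspace at index `0`; independence of
    -- eigenspaces then puts the eigenvector for `c` into that zero subspace.
    have h2 : ⨆ j : ℕ, Module.End.eigenspace hb.etot (c + 1 + j) ≤
        ⨆ j : ℕ, (Nat.casesOn j ⊥ fun j => Module.End.eigenspace hb.etot (c + 1 + j) :
          Submodule ℂ (S.om μ)) := iSup_le fun j => le_iSup_of_le (j + 1) le_rfl
    rw [h1] at h2
    refine hv0 (mem_of_mem_iSup_weight (κ := Unit) (T := fun _ => hb.etot)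
      (l := fun (j : ℕ) _ => c + j) (j := 0) (fun a b h => ?_) (fun j => ?_) ?_
      (h2 (Submodule.mem_top (x := (v : S.om μ)))))
    · simpa using congrFun h ()
    · cases j with
      | zero => exact bot_le
      | succ j =>
        intro w hw
        refine mem_weightSpace.2 fun _ => ?_
        rw [Module.End.mem_eigenspace_iff.1 hw]
        push_cast; congr 1; ring
    · refine mem_weightSpace.2 fun _ => ?_
      rw [Module.End.mem_eigenspace_iff.1 hv1]; simp
  have h : ⨆ j : ℕ, Module.End.eigenspace hb.etot (c + j) ≤
      LinearMap.ker (hb.X (dd (Sum.inl 0) y)) := iSup_le fun j w hw => by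
    have h1 := hb.X_highDeg hy hw
    have h2 : ⨆ i : ℕ, Module.End.eigenspace hb.etot (c + j + 1 + i) ≤ ⊥ := by
      rw [← hbot]
      refine iSup_le fun i => le_iSup_of_le (j + i) (le_of_eq ?_)
      push_cast; congr 1; ring
    exact h2 h1
  rw [htop] at h
  exact h (Submodule.mem_top (x := u))

theorem IsBased.X_zero_secondOrder (hb : IsBased 𝓜 S μ) [∀ l, FiniteDimensional ℂ (hb.owt l)]
    {b : SAlg m n} (hb2 : b ∈ secondOrder) (u : S.om μ) : hb.X (dd (Sum.inl 0) b) u = 0 := by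
  have h : ⨆ l, hb.owt l ≤ LinearMap.ker (hb.X (dd (Sum.inl 0) b)) := iSup_le fun l v hv => by
    obtain ⟨K, hK, hz⟩ := hb.exists_pow_bound l
    obtain ⟨y, hy, z, hz', rfl⟩ := Submodule.mem_sup.1 (secondOrder_le hK hb2)
    rw [LinearMap.mem_ker, map_add, map_add, LinearMap.add_apply, hz z hz' v hv,
      hb.X_highDeg_eq_zero hy, add_zero]
  rw [hb.iSup_owt] at h
  exact h (Submodule.mem_top (x := u))

theorem parityAut_mem_secondOrder {b : SAlg m n} (hb : b ∈ secondOrder) :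
    parityAut m n b ∈ secondOrder := by
  rw [mem_secondOrder] at *
  refine ⟨by rw [aug_parityAut, hb.1], fun β => ?_⟩
  rcases β with i | k
  · rw [← parityAut_dop_inl, aug_parityAut, hb.2]
  · have e : dop (Sum.inr k) (parityAut m n b) = -parityAut m n (dop (Sum.inr k) b) := by
      rw [dop_inr, parityAut_dz, neg_neg]
    rw [e, map_neg, aug_parityAut, hb.2, neg_zero]

/-- For homogeneous `b` all terms of `X_eq_hop` involve only the direction `∂_0` or the vanishing
first derivatives. The general case follows from the even and odd parts, which are again of second
order. -/
theorem IsBased.X_secondOrder (hb : IsBased 𝓜 S μ) [∀ l, FiniteDimensional ℂ (hb.owt l)]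
    (α : Idx m n) {b : SAlg m n} (hb2 : b ∈ secondOrder) (u : S.om μ) : hb.X (dd α b) u = 0 := by
  have key : ∀ q, ∀ b ∈ par m n q, b ∈ secondOrder → hb.X (dd α b) u = 0 := fun q b hq hb2 => by
    rw [hb.X_eq_hop α hq (mem_secondOrder.1 hb2).1, hb.X_zero_secondOrder hb2,
      hb.X_zero_secondOrder hb2, (mem_secondOrder.1 hb2).2]
    simp
  have h2 := parityAut_mem_secondOrder hb2
  have h0 := key 0 (b + parityAut m n b) (by
    rw [mem_par, map_add, parityAut_parityAut, sgn_zero_right, one_smul, add_comm]) (add_mem hb2 h2)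
  have h1 := key 1 (b - parityAut m n b) (by
    rw [mem_par, map_sub, parityAut_parityAut, sgn_one_one, neg_one_smul, neg_sub]) (sub_mem hb2 h2)
  have h3 : (2 : ℂ) • hb.X (dd α b) u = 0 := by
    rw [← LinearMap.smul_apply, ← map_smul, ← map_smul, two_smul]
    have : b + b = (b + parityAut m n b) + (b - parityAut m n b) := by abel
    rw [this, map_add, map_add, LinearMap.add_apply, h0, h1, add_zero]
  exact (smul_eq_zero.1 h3).resolve_left two_ne_zero

/-- Subtracting the linear part leaves a second order element, which acts by zero: `X (b ∂_α)` sees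
only the differential of `b` at the point. -/
theorem IsBased.X_eq_sum (hb : IsBased 𝓜 S μ) [∀ l, FiniteDimensional ℂ (hb.owt l)]
    (α : Idx m n) {b : SAlg m n} (hb0 : aug b = 0) (u : S.om μ) :
    hb.X (dd α b) u = ∑ β, aug (dop β b) • hb.X (dd α (uu β)) u := by
  have h := hb.X_secondOrder α (sub_linPart_mem hb0) u
  have e : b = (b - linPart b) + linPart b := by abel
  conv_lhs => rw [e]
  rw [map_add, map_add, LinearMap.add_apply, h, zero_add, linPart]
  simp only [map_sum, map_smul, LinearMap.sum_apply, LinearMap.smul_apply]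

end Fibre

/-- Commuting operators on a nonzero finite dimensional subspace have a common eigenvector. -/
theorem exists_weightSpace_ne_bot {ι V : Type*} [Finite ι] [AddCommGroup V] [Module ℂ V]
    {T : ι → Module.End ℂ V} (hT : ∀ i j v, T i (T j v) = T j (T i v)) {W : Submodule ℂ V}
    [FiniteDimensional ℂ W] (hW : W ≠ ⊥) (hTW : ∀ i, ∀ v ∈ W, T i v ∈ W) :
    ∃ l, weightSpace T l ≠ ⊥ := by
  classical
  have := Fintype.ofFinite ι
  have key : ∀ s : Finset ι, ∃ (W' : Submodule ℂ V) (l : ι → ℂ), W' ≤ W ∧ W' ≠ ⊥ ∧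
      (∀ i, ∀ v ∈ W', T i v ∈ W') ∧ ∀ i ∈ s, ∀ v ∈ W', T i v = l i • v := by
    intro s
    induction s using Finset.induction_on with
    | empty => exact ⟨W, 0, le_rfl, hW, hTW, by simp⟩
    | insert j s hj ih =>
      obtain ⟨W', l, hle, hne, hs, hl⟩ := ih
      have : Nontrivial W' := Submodule.nontrivial_iff_ne_bot.2 hne
      have : FiniteDimensional ℂ W' := Submodule.finiteDimensional_of_le hle
      obtain ⟨c, hc⟩ := Module.End.exists_eigenvalue ((T j).restrict (hs j))
      obtain ⟨v, hv⟩ := hc.exists_hasEigenvector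
      refine ⟨W' ⊓ Module.End.eigenspace (T j) c, Function.update l j c, inf_le_left.trans hle,
        fun h => hv.2 (Subtype.ext ?_), fun i w hw => ?_, fun i hi w hw => ?_⟩
      · rw [ZeroMemClass.coe_zero, ← Submodule.mem_bot ℂ, ← h]
        refine ⟨v.2, ?_⟩
        exact Module.End.mem_eigenspace_iff.2 (congrArg Subtype.val hv.apply_eq_smul)
      · refine ⟨hs i w hw.1, Module.End.mem_eigenspace_iff.2 ?_⟩
        rw [hT, Module.End.mem_eigenspace_iff.1 hw.2, map_smul]
      · rcases Finset.mem_insert.1 hi with rfl | hi'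
        · rw [Function.update_self]
          exact Module.End.mem_eigenspace_iff.1 hw.2
        · rw [Function.update_of_ne (by rintro rfl; exact hj hi')]
          exact hl i hi' w hw.1
  obtain ⟨W', l, -, hne, -, hl⟩ := key Finset.univ
  refine ⟨l, fun h => hne ?_⟩
  rw [eq_bot_iff, ← h]
  exact fun v hv => mem_weightSpace.2 fun i => hl i (Finset.mem_univ i) v hv

section Fibre

variable {M : Type*} [AddCommGroup M] [Module ℂ M] {𝓜 : ZMod 2 → Submodule ℂ M}
  {S : QPData (par m n) M} {μ : Fin (m + 1) → ℂ}

/-! ### The representation of `𝔤𝔩(m+1, n)` on `Ω` -/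

/-- The operators `Φ(E_{α,β})` on `Ω`. -/
def IsBased.G (hb : IsBased 𝓜 S μ) (α β : Idx m n) : Module.End ℂ (S.om μ) :=
  if α = Sum.inl 0 then hb.hop β else hb.X (dd β (uu α))

theorem IsBased.G_zero (hb : IsBased 𝓜 S μ) (β : Idx m n) : hb.G (Sum.inl 0) β = hb.hop β :=
  if_pos rfl

theorem IsBased.G_of_ne (hb : IsBased 𝓜 S μ) {α : Idx m n} (hα : α ≠ Sum.inl 0) (β : Idx m n) :
    hb.G α β = hb.X (dd β (uu α)) := if_neg hα

/-- This is the alternating sum for `J = ∅` with `t^r = t_i`. -/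
theorem IsBased.coe_X_uu_succ (hb : IsBased 𝓜 S μ) (i : Fin m) (β : Idx m n) (u : S.om μ) :
    (hb.X (dd β (uu (Sum.inl i.succ))) u : M) =
      S.φ (tpow n (-Pi.single i 1)) (S.ψ (dd β (tpow n (Pi.single i 1))) u) - S.ψ (del β) u := by
  have h := hb.coe_ev_alt_tfam (Pi.single i 1) 0 β u ∅
  rw [alt_empty, QPData.tfam_apply, zetaI_empty, mul_one, zero_smul, sub_zero, zero_mul, zero_smul,
    add_zero] at h
  have h4 : ((hb.X (del β) u : S.om μ) : M) = S.ψ (del β) (u : M) := by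
    rw [hb.X_apply, QPData.ψ_del_om, map_smul, hb.ev_coe]; rfl
  rw [h, uu_succ, map_sub, dd_one, map_sub, LinearMap.sub_apply, Submodule.coe_sub, h4]

/-- This is the alternating sum for `J = {k}` with `r = 0`. -/
theorem IsBased.coe_X_uu_inr (hb : IsBased 𝓜 S μ) (k : Fin n) (β : Idx m n) (u : S.om μ) :
    (hb.X (dd β (uu (Sum.inr k))) u : M) =
      S.ψ (dd β (zeta m k)) u - S.φ (zeta m k) (S.ψ (del β) u) := by
  have h := hb.coe_ev_alt_tfam 0 0 β u {k}
  have e : ({k} : Finset (Fin n)) = insert k ∅ := rfl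
  rw [e, hb.qp.alt_insert _ (by simp), alt_empty, QPData.shift_apply, QPData.tfam_apply,
    QPData.tfam_apply, ← e, zetaI_singleton] at h
  simp only [map_one, mul_one, neg_zero, tpow_zero, one_mul, zero_smul, sub_zero,
    dd_one, Finset.card_empty, pow_zero, one_smul, zero_mul, add_zero] at h
  exact h.symm

theorem IsBased.coe_G (hb : IsBased 𝓜 S μ) (α β : Idx m n) (u : S.om μ) :
    (hb.G α β u : M) = S.glOp α β u := by
  rcases α with i | k
  · refine Fin.cases ?_ (fun i => ?_) i
    · rw [hb.G_zero, hb.coe_hop]; rfl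
    · rw [hb.G_of_ne (by simp), hb.coe_X_uu_succ]; rfl
  · rw [hb.G_of_ne (by simp), hb.coe_X_uu_inr]; rfl

theorem IsBased.glOp_mem (hb : IsBased 𝓜 S μ) (α β : Idx m n) {u : M} (hu : u ∈ S.om μ) :
    S.glOp α β u ∈ S.om μ := by
  have h := hb.coe_G α β ⟨u, hu⟩
  rw [← h]; exact Subtype.coe_prop _

/-- `u_α c` and `aug c • u_α` differ by an element of second order. -/
theorem IsBased.X_uu_mul (hb : IsBased 𝓜 S μ) [∀ l, FiniteDimensional ℂ (hb.owt l)]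
    (α δ : Idx m n) (c : SAlg m n) (u : S.om μ) :
    hb.X (dd δ (uu α * c)) u = aug c • hb.X (dd δ (uu α)) u := by
  rw [hb.X_eq_sum δ (by rw [aug_mul, aug_uu, zero_mul]), hb.X_eq_sum δ (aug_uu α), Finset.smul_sum]
  refine Finset.sum_congr rfl fun ε _ => ?_
  rw [dop_mul, map_add, aug_mul, aug_mul, aug_twist, aug_uu, zero_mul, add_zero, smul_smul, mul_comm]

theorem aug_dop_uu' {γ : Idx m n} (hγ : γ ≠ Sum.inl 0) (β : Idx m n) :
    aug (dop β (uu γ)) = if β = γ then 1 else 0 := by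
  by_cases hβ : β = Sum.inl 0
  · subst hβ
    rw [if_neg hγ.symm, dop_zero]; simp
  · exact aug_dop_uu hβ γ

theorem aug_delA (α : Idx m n) : aug (delA α) = if α = Sum.inl 0 then 1 else 0 := by
  split_ifs with h
  · rw [h, delA_zero, aug_one]
  · rw [delA_of_ne h, map_zero]

theorem IsBased.hop_G (hb : IsBased 𝓜 S μ) (β γ δ : Idx m n) (u : S.om μ) :
    hb.hop β (hb.G γ δ u) = sgn (idxPar β) (idxPar γ + idxPar δ) • hb.G γ δ (hb.hop β u) +
      ((if β = γ then (1 : ℂ) else 0) • hb.hop δ u - (sgn (idxPar β) (idxPar γ + idxPar δ) *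
        if Sum.inl 0 = δ then 1 else 0) • hb.G γ β u) := by
  have e0 : idxPar (Sum.inl 0 : Idx m n) = 0 := rfl
  by_cases hγ : γ = Sum.inl 0
  · subst hγ
    rw [hb.G_zero, hb.G_zero, hb.hop_hop, aug_delA, aug_delA, e0, zero_add]
    by_cases hδ : δ = Sum.inl 0
    · subst hδ; simp [e0]
    · simp [hδ, Ne.symm hδ]
  · rw [hb.G_of_ne hγ, hb.G_of_ne hγ, hb.hop_X β δ (uu_mem_par γ) (aug_uu γ), aug_dop_uu' hγ]
    by_cases hδ : δ = Sum.inl 0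
    · subst hδ; simp [e0, delA_zero]
    · simp [delA_of_ne hδ, Ne.symm hδ]

/-- For nonzero row indices the bracket of `u_α ∂_β` and `u_γ ∂_δ` has coefficients such as `u_α
∂_β(u_γ)`, which may be replaced by their linear parts and leave Kronecker deltas. -/
theorem IsBased.G_G (hb : IsBased 𝓜 S μ) [∀ l, FiniteDimensional ℂ (hb.owt l)]
    (α β γ δ : Idx m n) (u : S.om μ) :
    hb.G α β (hb.G γ δ u) =
      sgn (idxPar α + idxPar β) (idxPar γ + idxPar δ) • hb.G γ δ (hb.G α β u) +
      ((if β = γ then (1 : ℂ) else 0) • hb.G α δ u -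
        (sgn (idxPar α + idxPar β) (idxPar γ + idxPar δ) * if α = δ then 1 else 0) •
          hb.G γ β u) := by
  have e0 : idxPar (Sum.inl 0 : Idx m n) = 0 := rfl
  by_cases hα : α = Sum.inl 0
  · subst hα
    rw [hb.G_zero, hb.hop_G, e0, zero_add, hb.G_zero]
  · by_cases hγ : γ = Sum.inl 0
    · subst hγ
      have c1 : (if Sum.inl 0 = β then (1 : ℂ) else 0) = if β = Sum.inl 0 then 1 else 0 := by
        simp only [eq_comm]
      have c2 : (if δ = α then (1 : ℂ) else 0) = if α = δ then 1 else 0 := by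
        simp only [eq_comm]
      -- Here only the second row index is `0`: the relation of `hop_G` with the factors exchanged
      -- is solved for the other product.
      rw [hb.G_zero, hb.hop_G, e0, zero_add, sgn_comm (idxPar δ), c1, c2, hb.G_zero]
      simp only [smul_add, smul_sub, smul_smul, mul_ite, mul_one, mul_zero, sgn_mul_self, one_smul,
        ite_smul, zero_smul, smul_ite, smul_zero]
      split_ifs <;> abel
    · rw [hb.G_of_ne hα, hb.G_of_ne hγ, hb.G_of_ne hα, hb.G_of_ne hγ,
        hb.X_X β δ (uu_mem_par α) (uu_mem_par γ) (aug_uu α) (aug_uu γ), hb.X_uu_mul, hb.X_uu_mul,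
        aug_dop_uu' hγ, aug_dop_uu' hα, smul_smul]
      simp only [eq_comm (a := δ)]

/-- The representation `Φ`. -/
def IsBased.glRep (hb : IsBased 𝓜 S μ) :
    Matrix (Idx m n) (Idx m n) ℂ →ₗ[ℂ] Module.End ℂ (S.om μ) where
  toFun x := ∑ α, ∑ β, x α β • hb.G α β
  map_add' x y := by simp only [Matrix.add_apply, add_smul, Finset.sum_add_distrib]
  map_smul' c x := by
    simp only [Matrix.smul_apply, smul_eq_mul, mul_smul, Finset.smul_sum, RingHom.id_apply]

theorem IsBased.glRep_apply (hb : IsBased 𝓜 S μ) (x : Matrix (Idx m n) (Idx m n) ℂ) :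
    hb.glRep x = ∑ α, ∑ β, x α β • hb.G α β := rfl

theorem IsBased.glRep_single (hb : IsBased 𝓜 S μ) (α β : Idx m n) :
    hb.glRep (Matrix.single α β 1) = hb.G α β := by
  rw [hb.glRep_apply, Finset.sum_eq_single α, Finset.sum_eq_single β]
  · rw [Matrix.single_apply_same, one_smul]
  · intro δ _ hδ
    rw [Matrix.single_apply_of_ne _ _ _ _ _ (fun h => hδ h.2.symm), zero_smul]
  · exact fun h => absurd (Finset.mem_univ _) h
  · intro γ _ hγ
    refine Finset.sum_eq_zero fun δ _ => ?_
    rw [Matrix.single_apply_of_ne _ _ _ _ _ (fun h => hγ h.1.symm), zero_smul]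
  · exact fun h => absurd (Finset.mem_univ _) h

theorem homMatrix_mem_span {p : ZMod 2} {x : Matrix (Idx m n) (Idx m n) ℂ}
    (hx : IsHomMatrix p x) : x ∈ Submodule.span ℂ {y : Matrix (Idx m n) (Idx m n) ℂ |
      ∃ α β, idxPar α + idxPar β = p ∧ y = Matrix.single α β 1} := by
  rw [Matrix.matrix_eq_sum_single x]
  refine Submodule.sum_mem _ fun α _ => Submodule.sum_mem _ fun β _ => ?_
  by_cases h : x α β = 0
  · rw [h, Matrix.single_zero]; exact zero_mem _
  · have e : Matrix.single α β (x α β) = x α β • Matrix.single α β (1 : ℂ) := by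
      rw [Matrix.smul_single, smul_eq_mul, mul_one]
    rw [e]
    exact Submodule.smul_mem _ _ (Submodule.subset_span ⟨α, β, hx α β h, rfl⟩)

theorem IsBased.glRep_bracket (hb : IsBased 𝓜 S μ) [∀ l, FiniteDimensional ℂ (hb.owt l)]
    {p q : ZMod 2} {x y : Matrix (Idx m n) (Idx m n) ℂ}
    (hx : IsHomMatrix p x) (hy : IsHomMatrix q y) :
    hb.glRep (x * y - sgn p q • (y * x)) = scomm p q (hb.glRep x) (hb.glRep y) := by
  have hx' := homMatrix_mem_span hx
  have hy' := homMatrix_mem_span hy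
  clear hx hy
  rw [scomm]
  induction hx' using Submodule.span_induction with
  | zero => simp
  | add x₁ x₂ _ _ h₁ h₂ =>
    have e : (x₁ + x₂) * y - sgn p q • (y * (x₁ + x₂)) =
        (x₁ * y - sgn p q • (y * x₁)) + (x₂ * y - sgn p q • (y * x₂)) := by
      rw [add_mul, mul_add, smul_add]; abel
    rw [e, map_add, h₁, h₂, map_add, add_mul, mul_add, smul_add]; abel
  | smul c x₁ _ h₁ =>
    have e : (c • x₁) * y - sgn p q • (y * (c • x₁)) = c • (x₁ * y - sgn p q • (y * x₁)) := by
      rw [smul_mul_assoc, mul_smul_comm, smul_sub, smul_comm c]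
    rw [e, map_smul, h₁, map_smul, smul_mul_assoc, mul_smul_comm, smul_sub, smul_comm c]
  | mem x hx =>
    obtain ⟨α, β, rfl, rfl⟩ := hx
    induction hy' using Submodule.span_induction with
    | zero => simp
    | add x₁ x₂ _ _ h₁ h₂ =>
      set x := Matrix.single α β (1 : ℂ)
      set p := idxPar α + idxPar β
      have e : x * (x₁ + x₂) - sgn p q • ((x₁ + x₂) * x) =
          (x * x₁ - sgn p q • (x₁ * x)) + (x * x₂ - sgn p q • (x₂ * x)) := by
        rw [add_mul, mul_add, smul_add]; abel
      rw [e, map_add, h₁, h₂, map_add, add_mul, mul_add, smul_add]; abel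
    | smul c x₁ _ h₁ =>
      set x := Matrix.single α β (1 : ℂ)
      set p := idxPar α + idxPar β
      have e : x * (c • x₁) - sgn p q • ((c • x₁) * x) = c • (x * x₁ - sgn p q • (x₁ * x)) := by
        rw [smul_mul_assoc, mul_smul_comm, smul_sub, smul_comm c]
      rw [e, map_smul, h₁, map_smul, smul_mul_assoc, mul_smul_comm, smul_sub, smul_comm c]
    | mem y hy =>
      obtain ⟨γ, δ, rfl, rfl⟩ := hy
      have hs : ∀ α β γ δ : Idx m n, Matrix.single α β (1 : ℂ) * Matrix.single γ δ 1 =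
          (if β = γ then (1 : ℂ) else 0) • Matrix.single α δ 1 := by
        intro α β γ δ
        split_ifs with h
        · subst h; rw [Matrix.single_mul_single_same, one_mul, one_smul]
        · rw [Matrix.single_mul_single_of_ne _ _ _ _ h, zero_smul]
      have c2 : (if δ = α then (1 : ℂ) else 0) = if α = δ then 1 else 0 := by
        simp only [eq_comm]
      refine LinearMap.ext fun u => ?_
      rw [hs, hs, map_sub, map_smul, map_smul, map_smul]
      simp only [hb.glRep_single, LinearMap.sub_apply, LinearMap.smul_apply, Module.End.mul_apply]
      rw [hb.G_G α β γ δ u, c2, smul_smul]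
      abel

/-- The parity of `Ω`. -/
def QPData.omPar (S : QPData (par m n) M) (𝓜 : ZMod 2 → Submodule ℂ M) (μ : Fin (m + 1) → ℂ)
    (p : ZMod 2) : Submodule ℂ (S.om μ) := (𝓜 p).comap (S.om μ).subtype

theorem IsBased.isInternal_omPar (hb : IsBased 𝓜 S μ) : DirectSum.IsInternal (S.omPar 𝓜 μ) := by
  rw [DirectSum.isInternal_submodule_iff_isCompl (S.omPar 𝓜 μ) (i := 0) (j := 1) (by decide) (by
    ext p
    simpa using zmod_two_cases p)]
  have hsub := hb.isSubsuperspace (Z := S.om μ) fun γ v hv => hb.qp.om_torus γ hv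
  refine ⟨?_, ?_⟩
  · rw [Submodule.disjoint_def]
    intro u h0 h1
    exact Subtype.ext (Submodule.disjoint_def.1 hb.qp.isCompl.disjoint _ h0 h1)
  · rw [codisjoint_iff, eq_top_iff]
    intro u _
    obtain ⟨a, ha, b, hb', he⟩ := Submodule.mem_sup.1 (hsub u.2)
    have e : u = ⟨a, ha.1⟩ + ⟨b, hb'.1⟩ := Subtype.ext he.symm
    rw [e]
    exact Submodule.add_mem_sup ha.2 hb'.2

theorem IsQPModule.glOp_parity (hq : IsQPModule 𝓜 S) (α β : Idx m n) {q : ZMod 2} {v : M}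
    (hv : v ∈ 𝓜 q) : S.glOp α β v ∈ 𝓜 (idxPar α + idxPar β + q) := by
  have hd := hq.ψ_parity _ q _ (del_mem β) v hv
  rcases α with i | k
  · have e : idxPar (Sum.inl i : Idx m n) + idxPar β + q = idxPar β + q := by
      rw [show idxPar (Sum.inl i : Idx m n) = 0 from rfl, zero_add]
    rw [e]
    refine Fin.cases ?_ (fun i => ?_) i
    · exact neg_mem (hq.φhat_parity _ q _ (del_mem β) v hv)
    · refine sub_mem ?_ hd
      have h1 := hq.ψ_parity _ q _ (dd_mem β (tpow_mem_par (Pi.single i 1))) v hv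
      have h2 := hq.φ_parity _ _ _ (tpow_mem_par (-Pi.single i 1)) _ h1
      rwa [zero_add, zero_add] at h2
  · refine sub_mem ?_ ?_
    · exact hq.ψ_parity _ q _ (dd_mem β (zeta_mem_par k)) v hv
    · have h2 := hq.φ_parity _ _ _ (zeta_mem_par k) _ hd
      rwa [← add_assoc] at h2

theorem IsBased.G_parity (hb : IsBased 𝓜 S μ) (α β : Idx m n) {q : ZMod 2} {u : S.om μ}
    (hu : u ∈ S.omPar 𝓜 μ q) : hb.G α β u ∈ S.omPar 𝓜 μ (idxPar α + idxPar β + q) := by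
  change (hb.G α β u : M) ∈ 𝓜 _
  rw [hb.coe_G]
  exact hb.qp.glOp_parity α β hu

theorem IsBased.isGlModule (hb : IsBased 𝓜 S μ) [∀ l, FiniteDimensional ℂ (hb.owt l)] :
    IsGlModule (S.omPar 𝓜 μ) hb.glRep where
  isInternal := hb.isInternal_omPar
  parity p q x hx w hw := by
    rw [hb.glRep_apply, LinearMap.sum_apply]
    refine Submodule.sum_mem _ fun α _ => ?_
    rw [LinearMap.sum_apply]
    refine Submodule.sum_mem _ fun β _ => ?_
    by_cases h : x α β = 0
    · rw [h, zero_smul]; exact zero_mem _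
    · rw [← hx α β h]
      exact Submodule.smul_mem _ _ (hb.G_parity α β hw)
  map_bracket p q x y hx hy := hb.glRep_bracket hx hy

/-- By `X_eq_sum` every `X (b ∂_0)` is a combination of the `G β 0`, so simplicity over `𝔤𝔩(m+1, n)`
reduces to the triviality of stable subspaces. -/
theorem IsBased.isStable_of_G (hb : IsBased 𝓜 S μ) [∀ l, FiniteDimensional ℂ (hb.owt l)]
    {U : Submodule ℂ (S.om μ)}
    (hU : ∀ α β, ∀ u ∈ U, hb.G α β u ∈ U) : hb.IsStable U := by
  refine ⟨fun b hb0 u hu => ?_, fun α u hu => ?_⟩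
  · rw [hb.X_eq_sum _ hb0]
    refine Submodule.sum_mem _ fun β _ => U.smul_mem _ ?_
    by_cases hβ : β = Sum.inl 0
    · subst hβ; rw [uu_zero, map_zero, map_zero]; exact zero_mem _
    · rw [← hb.G_of_ne hβ]; exact hU _ _ u hu
  · rw [← hb.G_zero]; exact hU _ _ u hu

theorem IsBased.isSimpleGl (hb : IsBased 𝓜 S μ) [∀ l, FiniteDimensional ℂ (hb.owt l)] :
    IsSimpleGl hb.glRep := by
  refine ⟨hb.nontrivial_om, fun U hU => ?_⟩
  by_cases h : U = ⊥
  · exact Or.inl h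
  · refine Or.inr ((hb.isStable_of_G fun α β u hu => ?_).eq_top h)
    rw [← hb.glRep_single]; exact hU _ u hu

theorem IsBased.weightSpace_le_owt (hb : IsBased 𝓜 S μ) (l : Idx m n → ℂ) :
    weightSpace (fun α => hb.G α α) l ≤ hb.owt fun k => l (Sum.inr k) := by
  intro u hu
  rw [mem_weightSpace] at hu
  rw [hb.mem_owt]
  intro k
  have h := hu (Sum.inr k)
  rwa [hb.G_of_ne (by simp)] at h

/-- The sum of the weight spaces is invariant under all `G γ δ`, and it is nonzero because the
commuting diagonal operators have a common eigenvector in a finite dimensional space `owt l`; hence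
it is everything. The bound is inherited from the spaces `owt`, which contain these weight spaces.
-/
theorem IsBased.isAdmissible (hb : IsBased 𝓜 S μ) [∀ l, FiniteDimensional ℂ (hb.owt l)]
    {d : ℕ} (hd : ∀ l, Module.finrank ℂ (hb.owt l) ≤ d) :
    IsAdmissible hb.glRep := by
  have e : (fun α => hb.glRep (Matrix.single α α 1)) = fun α => hb.G α α :=
    funext fun α => hb.glRep_single α α
  rw [IsAdmissible, e]
  refine ⟨(hb.isStable_of_G fun γ δ => iSup_stable fun l u hu => ?_).eq_top ?_, d, fun l => ⟨?_, ?_⟩⟩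
  -- `E_{γ,δ}` has weight `ε_γ - ε_δ`.
  · refine Submodule.mem_iSup_of_mem (fun α => l α + ((if α = γ then (1 : ℂ) else 0) -
      if α = δ then 1 else 0)) ?_
    rw [mem_weightSpace] at *
    intro α
    have e1 : (if α = γ then (1 : ℂ) else 0) • hb.G α δ u =
        (if α = γ then (1 : ℂ) else 0) • hb.G γ δ u := by
      split_ifs with h
      · rw [h]
      · rw [zero_smul, zero_smul]
    have e2 : (if α = δ then (1 : ℂ) else 0) • hb.G γ α u =
        (if α = δ then (1 : ℂ) else 0) • hb.G γ δ u := by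
      split_ifs with h
      · rw [h]
      · rw [zero_smul, zero_smul]
    rw [hb.G_G, hu, idxPar_add_self, sgn_zero_left, map_smul, one_smul, one_mul, e1, e2, add_smul,
      sub_smul]
  · obtain ⟨l, hl⟩ : ∃ l, hb.owt l ≠ ⊥ := by
      by_contra h
      push Not at h
      have := hb.nontrivial_om
      have h2 := hb.iSup_owt
      simp only [h, iSup_bot] at h2
      exact bot_ne_top h2
    obtain ⟨l', hl'⟩ := exists_weightSpace_ne_bot (T := fun α => hb.G α α) (fun α β u => by
      rw [hb.G_G, idxPar_add_self, sgn_zero_left, one_smul]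
      by_cases h : α = β
      · subst h; simp
      · simp [h]) hl fun α u hu => by
        by_cases h : α = Sum.inl 0
        · subst h
          rw [hb.G_zero]
          have h3 := hb.hop_owt (Sum.inl 0) hu
          convert h3 using 2
          ext; simp [dwt]
        · rw [hb.G_of_ne h]
          exact hb.X_owt' _ (uu_mem_awz α) (aug_uu α) hu
    intro h
    rw [iSup_eq_bot] at h
    exact hl' (h l')
  · exact Submodule.finiteDimensional_of_le (hb.weightSpace_le_owt l)
  · exact (Submodule.finrank_mono (hb.weightSpace_le_owt l)).trans (hd _)

end Fibre

/-! ### The Shen-Larsson formula for `ψ` -/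

theorem twist_dop_inr (p : ZMod 2) (k : Fin n) (a : SAlg m n) :
    twist p (dop (Sum.inr k) a) = sgn p 1 • dop (Sum.inr k) (twist p a) := by
  rcases zmod_two_cases p with rfl | rfl
  · simp [twist_zero]
  · rw [twist_one, sgn_one_one, neg_one_smul]
    exact parityAut_dz k a

/-- The coefficient of `∂_β(a) ⊗ E_{β,α}` in Shen-Larsson modules. -/
def slCoeff (β : Idx m n) : ℂ := if β = Sum.inl 0 then 0 else sgn (idxPar β) 1

/-- For odd `β` the sign in the coefficient undoes the one produced by the twist; for `β = 0` both
sides vanish. -/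
theorem slCoeff_mul_aug (β : Idx m n) (a : SAlg m n) :
    slCoeff β * aug (dop β (twist (idxPar β) a)) = aug (dop β a) := by
  rcases β with i | k
  · rw [show idxPar (Sum.inl i : Idx m n) = 0 from rfl, twist_zero, slCoeff]
    split_ifs with h
    · rw [h, dop_zero]; simp
    · simp [idxPar]
  · rw [show idxPar (Sum.inr k : Idx m n) = 1 from rfl, slCoeff, if_neg (by simp)]
    have h := twist_dop_inr 1 k a
    have h2 := congrArg aug h
    rw [aug_twist, map_smul, smul_eq_mul] at h2
    exact h2.symm

theorem twist_monomial (p : ZMod 2) (r : Fin m → ℤ) (J : Finset (Fin n)) :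
    twist p (tpow n r * zetaI m J) = sgn p (wpar (zwt J)) • (tpow n r * zetaI m J) :=
  twist_of_mem (mem_awt.1 (monomial_mem_awt r J)).1

section Fibre

variable {M : Type*} [AddCommGroup M] [Module ℂ M] {𝓜 : ZMod 2 → Submodule ℂ M}
  {S : QPData (par m n) M} {μ : Fin (m + 1) → ℂ}

theorem IsQPModule.φ_dop_ewt (h : IsQPModule 𝓜 S) (r : Fin m → ℤ) (J : Finset (Fin n))
    (β : Idx m n) {ν : Fin (m + 1) → ℂ} {v : M} (hv : v ∈ S.ewt ν) :
    S.φ (dop β (tpow n r * zetaI m J)) v ∈ S.ewt (ν + etc r) := by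
  rw [QPData.mem_ewt] at *
  intro i
  have h1 := (mem_awt.1 (monomial_mem_awt r J)).2 (Sum.inl i)
  have h2 : dop (Sum.inl i) (tpow n r * zetaI m J) = etc r i • (tpow n r * zetaI m J) := by
    rw [torusCoeff, Sum.elim_inl, one_mul] at h1
    exact h1
  rw [h.ψ_del_φ, dop_comm, h2, hv, idxPar, Sum.elim_inl, twist_zero]
  simp [add_smul, add_comm]

/-- The part of `ψ_{a ∂_α} u`, `u ∈ Ω`, given by the matrix units. -/
def IsBased.slPart (hb : IsBased 𝓜 S μ) (α : Idx m n) (u : S.om μ) : SAlg m n →ₗ[ℂ] M :=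
  ∑ β, slCoeff β • ((LinearMap.applyₗ (hb.G β α u : M)).comp S.φ.toLinearMap ∘ₗ dop β ∘ₗ
    twist (idxPar β))

theorem IsBased.slPart_apply (hb : IsBased 𝓜 S μ) (α : Idx m n) (u : S.om μ) (a : SAlg m n) :
    hb.slPart α u a = ∑ β, slCoeff β • S.φ (dop β (twist (idxPar β) a)) (hb.G β α u) := by
  rw [IsBased.slPart, LinearMap.sum_apply]; rfl

/-- The operators `ψ_{a ∂_α}` on `Ω`. -/
theorem IsBased.ψ_om (hb : IsBased 𝓜 S μ) [∀ l, FiniteDimensional ℂ (hb.owt l)]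
    (α : Idx m n) (a : SAlg m n) (u : S.om μ) :
    S.ψ (dd α a) (u : M) = rho μ α • S.φ a u + hb.slPart α u a := by
  -- The difference of the two sides is compatible with the `∂_k` and evaluates to zero, so
  -- `family_mem_gen` with `U = ⊥` makes it vanish.
  let f : SAlg m n →ₗ[ℂ] M := (LinearMap.applyₗ (u : M)).comp (S.ψ ∘ₗ dd α) -
    (rho μ α • (LinearMap.applyₗ (u : M)).comp S.φ.toLinearMap + hb.slPart α u)
  have hf : ∀ a, f a = S.ψ (dd α a) (u : M) - (rho μ α • S.φ a u + hb.slPart α u a) := fun _ => rfl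
  have key : f a ∈ S.gen (⊥ : Submodule ℂ (S.om μ)) := by
    refine hb.family_mem_gen f (fun k a => ?_) (fun r J => ?_) (fun a => ?_) a
    · rw [hf, hf, map_sub, map_add, map_smul, hb.qp.ψ_dz_ψ_om, hb.qp.ψ_del_φ_om, hb.slPart_apply,
        hb.slPart_apply, map_sum]
      congr 2
      refine Finset.sum_congr rfl fun β _ => ?_
      rw [map_smul, hb.qp.ψ_del_φ_om, twist_dop_inr, dop_comm, map_smul, map_smul, map_smul, sgn_comm]
      rfl
    · rw [hf]
      have hu := QPData.om_le_ewt u.2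
      refine sub_mem (hb.qp.ψ_ewt (monomial_mem_awt r J) α hu) (add_mem (Submodule.smul_mem _ _
        (hb.qp.φ_ewt (monomial_mem_awt r J) hu)) ?_)
      rw [hb.slPart_apply]
      refine Submodule.sum_mem _ fun β _ => Submodule.smul_mem _ _ ?_
      rw [twist_monomial, map_smul, map_smul, LinearMap.smul_apply]
      exact Submodule.smul_mem _ _ (hb.qp.φ_dop_ewt r J β (QPData.om_le_ewt (hb.G β α u).2))
    · rw [Submodule.mem_bot, hf, map_sub, map_add, map_smul, hb.ev_φ_om, hb.slPart_apply, map_sum,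
        ← hb.X_apply, hb.X_dd, hb.X_eq_sum α (by simp), sub_eq_zero, smul_comm]
      congr 1
      refine Finset.sum_congr rfl fun β _ => ?_
      rw [map_smul, hb.ev_φ_om, smul_smul, slCoeff_mul_aug, map_sub, map_smul, dop_one, smul_zero,
        sub_zero]
      by_cases h : β = Sum.inl 0
      · subst h; rw [dop_zero]; simp
      · rw [hb.G_of_ne h]
  have h0 : S.gen (⊥ : Submodule ℂ (S.om μ)) = ⊥ := Submodule.map₂_bot_right _ _
  rw [h0, Submodule.mem_bot, hf, sub_eq_zero] at key
  exact key

/-- The operators `ψ_{a ∂_α}` on `φ_b Ω`. -/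
theorem IsBased.ψ_φ_om (hb : IsBased 𝓜 S μ) [∀ l, FiniteDimensional ℂ (hb.owt l)]
    (α : Idx m n) (a b : SAlg m n) (u : S.om μ) :
    S.ψ (dd α a) (S.φ b u) = S.φ (a * (dop α b + rho μ α • b)) u +
      ∑ β, slCoeff β • S.φ (dop β (twist (idxPar β) a) * twist (idxPar β + idxPar α) b)
        (hb.G β α u) := by
  induction a using par_induction with
  | hadd x y hx hy =>
    simp only [map_add, LinearMap.add_apply, hx, hy, add_mul, smul_add, Finset.sum_add_distrib]
    abel
  | h p a ha =>
    induction b using par_induction with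
    | hadd x y hx hy =>
      simp only [map_add, LinearMap.add_apply, hx, hy, mul_add, smul_add, Finset.sum_add_distrib]
      abel
    | h q b hb' =>
      rw [hb.qp.ψ_φ_apply α ha hb', hb.ψ_om, map_add, map_smul, ← hb.qp.φ_mul, smul_add,
        hb.slPart_apply, map_sum, mul_add, map_add, LinearMap.add_apply, add_assoc, Finset.smul_sum]
      congr 2
      · rw [par_comm hb' ha, mul_smul_comm, map_smul, map_smul, LinearMap.smul_apply,
          LinearMap.smul_apply, smul_smul, smul_smul]
        congr 1
        -- For an even index the two signs multiply to `1`; for an odd one the scalar `rho μ α` is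
        -- zero and the sign is irrelevant.
        rcases α with i | k
        · rw [show idxPar (Sum.inl i : Idx m n) = 0 from rfl, add_zero, sgn_comm q p]
          linear_combination rho μ (Sum.inl i : Idx m n) * sgn_mul_self p q
        · rw [show rho μ (Sum.inr k : Idx m n) = 0 from rfl]; simp
      · refine Finset.sum_congr rfl fun β _ => ?_
        have hp : dop β (twist (idxPar β) a) ∈ par m n (idxPar β + p) :=
          dop_mem_par β (by rw [twist_of_mem ha]; exact Submodule.smul_mem _ _ ha)
        rw [map_smul, ← hb.qp.φ_mul, par_comm hb' hp, twist_of_mem hb', mul_smul_comm, map_smul,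
          map_smul, LinearMap.smul_apply, LinearMap.smul_apply, smul_comm (sgn _ _) (slCoeff β),
          smul_smul (sgn _ _) (sgn _ _)]
        congr 2
        simp only [sgn_comm q, sgn_add_left]
        linear_combination (sgn (idxPar α) q * sgn (idxPar β) q) * sgn_mul_self p q

/-! ### The isomorphism with a Shen-Larsson module -/

theorem IsBased.theta_ψ (hb : IsBased 𝓜 S μ) [∀ l, FiniteDimensional ℂ (hb.owt l)]
    (x : QPg m n) (z : SAlg m n ⊗[ℂ] S.om μ) :
    S.theta μ ((shenLarsson hb.glRep (rho μ)).ψ x z) = S.ψ x (S.theta μ z) := by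
  induction z using TensorProduct.induction_on with
  | zero => simp
  | add y z hy hz => rw [map_add, map_add, hy, hz, map_add, map_add]
  | tmul b u =>
    rw [QPData.theta_tmul]
    conv_rhs => rw [← sum_dd_coord x]
    rw [map_sum, LinearMap.sum_apply]
    change S.theta μ ((∑ α : Idx m n, _ : Module.End ℂ (SAlg m n ⊗[ℂ] S.om μ)) (b ⊗ₜ u)) = _
    rw [LinearMap.sum_apply, map_sum]
    refine Finset.sum_congr rfl fun α _ => ?_
    rw [hb.ψ_φ_om, LinearMap.add_apply, map_add, LinearMap.sum_apply, map_sum, TensorProduct.map_tmul,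
      QPData.theta_tmul]
    congr 1
    refine Finset.sum_congr rfl fun β _ => ?_
    rw [LinearMap.smul_apply, map_smul, TensorProduct.map_tmul, QPData.theta_tmul, hb.glRep_single]
    rfl

theorem IsBased.theta_φhat (hb : IsBased 𝓜 S μ)
    (x : QPg m n) (z : SAlg m n ⊗[ℂ] S.om μ) :
    S.theta μ ((shenLarsson hb.glRep (rho μ)).φhat x z) = S.φhat x (S.theta μ z) := by
  induction z using TensorProduct.induction_on with
  | zero => simp
  | add y z hy hz => rw [map_add, map_add, hy, hz, map_add, map_add]
  | tmul b u =>
    rw [QPData.theta_tmul]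
    conv_rhs => rw [← sum_dd_coord x]
    rw [map_sum, LinearMap.sum_apply]
    change S.theta μ (((-1 : ℂ) • ∑ α : Idx m n, _ : Module.End ℂ (SAlg m n ⊗[ℂ] S.om μ))
      (b ⊗ₜ u)) = _
    rw [LinearMap.smul_apply, map_smul, LinearMap.sum_apply, map_sum, Finset.smul_sum]
    refine Finset.sum_congr rfl fun α _ => ?_
    rw [TensorProduct.map_tmul, QPData.theta_tmul, hb.glRep_single, hb.G_zero, hb.coe_hop,
      hb.qp.φhat_dd, hb.qp.φhat_del_φ, ← hb.qp.φ_mul, map_neg, neg_one_smul, neg_neg]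
    rfl

theorem IsBased.theta_φ (hb : IsBased 𝓜 S μ) (a : SAlg m n) (z : SAlg m n ⊗[ℂ] S.om μ) :
    S.theta μ ((shenLarsson hb.glRep (rho μ)).φ a z) = S.φ a (S.theta μ z) := by
  induction z using TensorProduct.induction_on with
  | zero => simp
  | add y z hy hz => rw [map_add, map_add, hy, hz, map_add, map_add]
  | tmul b u =>
    rw [QPData.theta_tmul, ← hb.qp.φ_mul]
    exact QPData.theta_tmul (a * b) u

theorem IsQPModule.theta_parity (hq : IsQPModule 𝓜 S) (p : ZMod 2) :
    tensorPar (S.omPar 𝓜 μ) p ≤ (𝓜 p).comap (S.theta μ) := by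
  refine iSup_le fun q => Submodule.map₂_le.2 fun a ha u hu => ?_
  have h := hq.φ_parity q (p - q) a ha u hu
  rw [add_sub_cancel] at h
  change S.theta μ (a ⊗ₜ u) ∈ 𝓜 p
  rwa [QPData.theta_tmul]

theorem IsBased.tensorPar_sup (hb : IsBased 𝓜 S μ) :
    tensorPar (m := m) (n := n) (S.omPar 𝓜 μ) 0 ⊔ tensorPar (S.omPar 𝓜 μ) 1 = ⊤ := by
  have hle : ∀ p, tensorPar (m := m) (n := n) (S.omPar 𝓜 μ) p ≤
      tensorPar (S.omPar 𝓜 μ) 0 ⊔ tensorPar (S.omPar 𝓜 μ) 1 := fun p => by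
    rcases zmod_two_cases p with rfl | rfl
    · exact le_sup_left
    · exact le_sup_right
  have hmem : ∀ p q (a : SAlg m n), a ∈ par m n p → ∀ u ∈ S.omPar 𝓜 μ q,
      a ⊗ₜ u ∈ tensorPar (m := m) (n := n) (S.omPar 𝓜 μ) 0 ⊔ tensorPar (S.omPar 𝓜 μ) 1 := by
    intro p q a ha u hu
    refine hle (p + q) (Submodule.mem_iSup_of_mem p (Submodule.apply_mem_map₂ _ ha ?_))
    rwa [add_sub_cancel_left]
  rw [eq_top_iff, ← TensorProduct.span_tmul_eq_top, Submodule.span_le]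
  rintro _ ⟨a, u, rfl⟩
  have hu : u ∈ S.omPar 𝓜 μ 0 ⊔ S.omPar 𝓜 μ 1 := by
    rw [((DirectSum.isInternal_submodule_iff_isCompl (S.omPar 𝓜 μ) (i := 0) (j := 1) (by decide) (by
      ext p
      simpa using zmod_two_cases p)).1 hb.isInternal_omPar).sup_eq_top]
    trivial
  obtain ⟨u₀, h₀, u₁, h₁, rfl⟩ := Submodule.mem_sup.1 hu
  induction a using par_induction with
  | hadd x y hx hy => rw [TensorProduct.add_tmul]; exact add_mem hx hy
  | h p a ha => rw [TensorProduct.tmul_add]; exact add_mem (hmem _ _ a ha _ h₀) (hmem _ _ a ha _ h₁)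

theorem IsBased.thetaEquiv_symm_parity (hb : IsBased 𝓜 S μ) (p : ZMod 2) {v : M} (hv : v ∈ 𝓜 p) :
    hb.thetaEquiv.symm v ∈ tensorPar (m := m) (n := n) (S.omPar 𝓜 μ) p := by
  have hs : hb.thetaEquiv.symm v ∈ tensorPar (m := m) (n := n) (S.omPar 𝓜 μ) p ⊔
      tensorPar (S.omPar 𝓜 μ) (p + 1) := by
    have h : tensorPar (m := m) (n := n) (S.omPar 𝓜 μ) p ⊔ tensorPar (S.omPar 𝓜 μ) (p + 1) = ⊤ := by
      rcases zmod_two_cases p with rfl | rfl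
      · exact hb.tensorPar_sup
      · rw [sup_comm]; exact hb.tensorPar_sup
    rw [h]; trivial
  obtain ⟨x, hx, y, hy, he⟩ := Submodule.mem_sup.1 hs
  have h1 : v = S.theta μ x + S.theta μ y := by
    rw [← map_add, he, ← hb.thetaEquiv_apply, LinearEquiv.apply_symm_apply]
  have hx' : S.theta μ x ∈ 𝓜 p := hb.qp.theta_parity p hx
  have hy' : S.theta μ y ∈ 𝓜 (p + 1) := hb.qp.theta_parity _ hy
  -- The image of the component of wrong parity has both parities, so it is zero, and `theta` is
  -- injective.
  have h2 : S.theta μ y ∈ 𝓜 p := by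
    have := sub_mem hv hx'
    rwa [h1, add_sub_cancel_left] at this
  have h3 : S.theta μ y = 0 := Submodule.disjoint_def.1 (hb.qp.isCompl' p).disjoint _ h2 hy'
  have h4 : y = 0 := hb.thetaEquiv.injective (by rw [hb.thetaEquiv_apply, h3, map_zero])
  rwa [← he, h4, add_zero]

theorem IsBased.isomorphic (hb : IsBased 𝓜 S μ) [∀ l, FiniteDimensional ℂ (hb.owt l)] :
    S.Isomorphic 𝓜 (tensorPar (S.omPar 𝓜 μ)) (shenLarsson hb.glRep (rho μ)) := by
  refine ⟨hb.thetaEquiv.symm, fun p v hv => hb.thetaEquiv_symm_parity p hv, fun a v => ?_,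
    fun x v => ?_, fun x v => ?_⟩
  · rw [LinearEquiv.symm_apply_eq, hb.thetaEquiv_apply, hb.theta_φ, ← hb.thetaEquiv_apply,
      LinearEquiv.apply_symm_apply]
  · rw [LinearEquiv.symm_apply_eq, hb.thetaEquiv_apply, hb.theta_ψ, ← hb.thetaEquiv_apply,
      LinearEquiv.apply_symm_apply]
  · rw [LinearEquiv.symm_apply_eq, hb.thetaEquiv_apply, hb.theta_φhat, ← hb.thetaEquiv_apply,
      LinearEquiv.apply_symm_apply]

end Fibre

/-! ### Transfer to subspaces of `M` -/

section Fibre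

variable {M : Type*} [AddCommGroup M] [Module ℂ M] {𝓜 : ZMod 2 → Submodule ℂ M}
  {S : QPData (par m n) M} {μ : Fin (m + 1) → ℂ}

theorem IsQPModule.isBased (hq : IsQPModule 𝓜 S) (hs : S.IsSimple 𝓜) (h : S.block μ ≠ ⊥) :
    IsBased 𝓜 S μ := by
  refine ⟨hq, hs, ?_⟩
  by_contra hne
  push Not at hne
  refine h (eq_bot_iff.2 (iSup₂_le fun l hl => ?_))
  by_contra hl'
  obtain ⟨p, hp⟩ := hq.exists_homogeneous (l := l) fun h0 => hl' h0.le
  exact hp (hne l p hl)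

theorem IsBased.map_owt_le (hb : IsBased 𝓜 S μ) (l : Fin n → ℂ) :
    (hb.owt l).map (S.om μ).subtype ≤ S.wt (Sum.elim μ l) := by
  rintro _ ⟨u, hu, rfl⟩
  exact hb.mem_owt_iff.1 hu

theorem IsBased.finiteDimensional_owt (hb : IsBased 𝓜 S μ) (l : Fin n → ℂ)
    [FiniteDimensional ℂ (S.wt (Sum.elim μ l))] : FiniteDimensional ℂ (hb.owt l) := by
  have := Submodule.finiteDimensional_of_le (hb.map_owt_le l)
  exact (Submodule.equivMapOfInjective (S.om μ).subtype
    (S.om μ).subtype_injective (hb.owt l)).symm.finiteDimensional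

theorem IsBased.finrank_owt_le (hb : IsBased 𝓜 S μ) (l : Fin n → ℂ)
    [FiniteDimensional ℂ (S.wt (Sum.elim μ l))] :
    Module.finrank ℂ (hb.owt l) ≤ Module.finrank ℂ (S.wt (Sum.elim μ l)) := by
  rw [(Submodule.equivMapOfInjective (S.om μ).subtype
    (S.om μ).subtype_injective (hb.owt l)).finrank_eq]
  exact Submodule.finrank_mono (hb.map_owt_le l)

theorem IsBased.comap_ne_bot {U : Submodule ℂ M} (hU : U ≤ S.om μ) (h0 : U ≠ ⊥) :
    U.comap (S.om μ).subtype ≠ ⊥ := by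
  obtain ⟨u, hu, hu0⟩ := Submodule.exists_mem_ne_zero_of_ne_bot h0
  intro h
  have h1 : (⟨u, hU hu⟩ : S.om μ) ∈ U.comap (S.om μ).subtype := hu
  rw [h, Submodule.mem_bot] at h1
  exact hu0 (congrArg Subtype.val h1)

theorem IsBased.span_φ_eq_top (hb : IsBased 𝓜 S μ) {U : Submodule ℂ M} (hU : U ≤ S.om μ)
    (h0 : U ≠ ⊥) (hT : S.IsTInvariant U) :
    Submodule.span ℂ {v | ∃ a : SAlg m n, ∃ u ∈ U, v = S.φ a u} = ⊤ := by
  rw [eq_top_iff, ← (hb.isStable_comap hT).gen_eq_top (comap_ne_bot hU h0)]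
  exact QPData.gen_le fun a u hu => Submodule.subset_span ⟨a, u, hu, rfl⟩

/-- The spaces `t^r Λ U` together span `M` and lie in distinct joint eigenspaces of `ψ_1` and the
`ψ_{d_i}`, so each fills its eigenspace; `r = 0` is the block of `μ`. -/
theorem IsBased.span_φ_zetaI_eq (hb : IsBased 𝓜 S μ) {U : Submodule ℂ M} (hU : U ≤ S.om μ)
    (h0 : U ≠ ⊥) (hT : S.IsTInvariant U) :
    Submodule.span ℂ {v | ∃ I : Finset (Fin n), ∃ u ∈ U, v = S.φ (zetaI m I) u} = S.ewt μ := by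
  let P : (Fin m → ℤ) → Submodule ℂ M := fun r =>
    Submodule.span ℂ {v | ∃ I : Finset (Fin n), ∃ u ∈ U, v = S.φ (tpow n r * zetaI m I) u}
  have hP : ∀ r, P r ≤ S.ewt (μ + etc r) := fun r => by
    rw [Submodule.span_le]
    rintro _ ⟨I, u, hu, rfl⟩
    exact hb.qp.φ_ewt (monomial_mem_awt r I) (QPData.om_le_ewt (hU hu))
  have hP0 : Submodule.span ℂ {v | ∃ I : Finset (Fin n), ∃ u ∈ U, v = S.φ (zetaI m I) u} = P 0 := by
    simp only [P, tpow_zero, one_mul]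
  have e : μ + etc (0 : Fin m → ℤ) = μ := by rw [etc_zero, add_zero]
  rw [hP0]
  refine le_antisymm ((hP 0).trans_eq (by rw [e])) fun v hv => ?_
  have htop : ⨆ r, P r = ⊤ := by
    rw [eq_top_iff, ← (hb.isStable_comap hT).gen_eq_top (comap_ne_bot hU h0)]
    refine QPData.gen_le fun a u hu => ?_
    exact mem_of_monomials ((⨆ r, P r).comap ((LinearMap.applyₗ (u : M)).comp S.φ.toLinearMap))
      (fun r J => Submodule.mem_iSup_of_mem r (Submodule.subset_span ⟨J, u, hu, rfl⟩)) a
  refine mem_of_mem_iSup_weight (T := fun i => S.ψ (del (Sum.inl i)))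
    (l := fun r : Fin m → ℤ => μ + etc r) (etc_injective μ) hP (j := 0) ?_ (by rw [htop]; trivial)
  rw [e]; exact hv

theorem IsBased.eq_bot_or_eq_om (hb : IsBased 𝓜 S μ) {U : Submodule ℂ M} (hU : U ≤ S.om μ)
    (hT : S.IsTInvariant U) : U = ⊥ ∨ U = S.om μ := by
  by_cases h0 : U = ⊥
  · exact Or.inl h0
  · refine Or.inr (le_antisymm hU fun u hu => ?_)
    have h := (hb.isStable_comap hT).eq_top (comap_ne_bot hU h0)
    have h1 : (⟨u, hu⟩ : S.om μ) ∈ U.comap (S.om μ).subtype := by rw [h]; trivial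
    exact h1

end Fibre

end QP

end

/-- The structure of a simple cuspidal quasi-Poisson module `M` over `(A, Der(A))`, where
`A = ℂ[t₁^{±1}, …, t_m^{±1}] ⊗ Λ_n`. -/
theorem theorem3p9 {m n : ℕ} (hm : 0 < m) (hn : 0 < n)
    {M : Type*} [AddCommGroup M] [Module ℂ M] (𝓜 : ZMod 2 → Submodule ℂ M)
    (S : QP.QPData (QP.par m n) M) (hQP : QP.IsQPModule 𝓜 S)
    (hsimple : S.IsSimple 𝓜) (hcusp : S.IsCuspidal)
    (μ₀ : Fin (m + 1) → ℂ) (N : Submodule ℂ M) (hN : N = S.block μ₀) (hN0 : N ≠ ⊥)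
    (Ω : Submodule ℂ M) (hΩ : Ω = S.omega N) :
    -- (i)
    (∀ β : QP.Idx m n,
      (∀ j : Fin m, ∀ u ∈ Ω,
        S.φ (QP.tpow n (-Pi.single j 1))
            (S.ψ (QP.lmul (QP.tpow n (Pi.single j 1)) (QP.del β)) u) -
          S.ψ (QP.del β) u ∈ Ω) ∧
      (∀ p : Fin n, ∀ u ∈ Ω,
        S.φ (QP.zeta m p) (S.ψ (QP.del β) u) -
          S.ψ (QP.lmul (QP.zeta m p) (QP.del β)) u ∈ Ω) ∧
      ∀ u ∈ Ω, S.φhat (QP.del β) u ∈ Ω) ∧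
    -- (ii)
    (S.IsTInvariant Ω ∧
      ∃ H : Fin n → Module.End ℂ Ω,
        (∀ (k : Fin n) (u : Ω),
          (H k u : M) = S.ψ (QP.lmul (QP.zeta m k) (QP.del (Sum.inr k))) u) ∧
        QP.HasBoundedWeights H) ∧
    -- (iii)
    (∀ U : Submodule ℂ M, U ≤ Ω → U ≠ ⊥ → S.IsTInvariant U →
      Submodule.span ℂ {v | ∃ I : Finset (Fin n), ∃ u ∈ U, v = S.φ (QP.zetaI m I) u} = N ∧
      Submodule.span ℂ {v | ∃ a : QP.SAlg m n, ∃ u ∈ U, v = S.φ a u} = ⊤) ∧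
    -- (iv), simplicity over `𝒯`
    (Ω ≠ ⊥ ∧ ∀ U : Submodule ℂ M, U ≤ Ω → S.IsTInvariant U → U = ⊥ ∨ U = Ω) ∧
    -- (iv), the representation `Φ` of `𝔤𝔩(m+1, n)` on `Ω`
    QP.IsSubsuperspace 𝓜 Ω ∧
    ∃ Φ : Matrix (QP.Idx m n) (QP.Idx m n) ℂ →ₗ[ℂ] Module.End ℂ Ω,
      (∀ (α β : QP.Idx m n) (u : Ω),
        (Φ (Matrix.single α β 1) u : M) = S.glOp α β u) ∧
      QP.IsGlModule (fun p => (𝓜 p).comap Ω.subtype) Φ ∧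
      QP.IsSimpleGl Φ ∧ QP.IsAdmissible Φ ∧
      -- (v)
      S.Isomorphic 𝓜 (QP.tensorPar fun p => (𝓜 p).comap Ω.subtype)
        (QP.shenLarsson Φ (Sum.elim μ₀ fun _ => 0)) := by
  subst hN
  have hb := hQP.isBased hsimple hN0
  rw [hb.omega_eq] at hΩ
  subst hΩ
  obtain ⟨-, d, hd⟩ := hcusp
  have hfd : ∀ l, FiniteDimensional ℂ (S.wt l) := fun l => (hd l).1
  have hfd' : ∀ l, FiniteDimensional ℂ (hb.owt l) := fun l => hb.finiteDimensional_owt l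
  have hd' : ∀ l, Module.finrank ℂ (hb.owt l) ≤ d := fun l => (hb.finrank_owt_le l).trans (hd _).2
  refine ⟨fun β => ⟨fun j u hu => hb.glOp_mem (Sum.inl j.succ) β hu, fun p u hu => ?_,
    fun u hu => hQP.φhat_om β hu⟩, ⟨?_, fun k => hb.X (QP.torus (Sum.inr k)),
    fun k u => hb.coe_X_torus (Sum.inr k) u, hb.iSup_owt, d, fun l => ⟨hfd' l, hd' l⟩⟩,
    fun U hU h0 hT => ⟨?_, hb.span_φ_eq_top hU h0 hT⟩,
    ⟨Submodule.nontrivial_iff_ne_bot.1 hb.nontrivial_om, fun U hU hT => hb.eq_bot_or_eq_om hU hT⟩,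
    hb.isSubsuperspace fun γ v hv => hQP.om_torus γ hv, hb.glRep, fun α β u => ?_,
    hb.isGlModule, hb.isSimpleGl, hb.isAdmissible hd', hb.isomorphic⟩
  -- The operator in (i) is minus `Φ(E_{p̄,β})`.
  · have h := neg_mem (hb.glOp_mem (Sum.inr p) β hu)
    rwa [← neg_sub]
  · have h := hb.isTInvariant hb.isStable_top
    rwa [Submodule.map_top, Submodule.range_subtype] at h
  · rw [hb.span_φ_zetaI_eq hU h0 hT, hb.block_eq]
  · rw [hb.glRep_single, hb.coe_G]
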